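/- Let $G$ be a compact connected Lie group with Lie algebra $\mathfrak g$, and let $H<G$ be a closed connected subgroup with Lie algebra $\mathfrak h$ such that $M=G/H$ has dimension at least $3$ and $G$ acts effectively on $M$. Choose an $\mathrm{Ad}(G)$-invariant scalar product $Q$ on $\mathfrak g$ and let $\mathfrak m$ be the $Q$-orthogonal complement of $\mathfrak h$ in $\mathfrak g$, identified with the tangent space of $M$ at the base point. Suppose that $\mathfrak m=\mathfrak m_1\oplus\mathfrak m_2$, where $\mathfrak m_1,\mathfrak m_2$ are $Q$-orthogonal and $\mathrm{Ad}(H)$-invariant and the representations $\mathrm{Ad}(H)|_{\mathfrak m_1}$ and $\mathrm{Ad}(H)|_{\mathfrak m_2}$ are irreducible and inequivalent. Suppose that there is a connected Lie subgroup $K$ of $G$ with $H\subsetneq K\subsetneq G$ whose Lie algebra is $\mathfrak h\oplus\mathfrak m_1$. Let $d_i=\dim\mathfrak m_i$. For $i,k,l\in\{1,2\}$ let $\gamma_{ik}^l=\sum Q([e,e'],e'')^2$, where $e,e',e''$ run over $Q$-orthonormal bases of $\mathfrak m_i,\mathfrak m_k,\mathfrak m_l$ respectively, and assume $\gamma_{22}^1\neq0$.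 Let $(w_j)_{j=1}^q$ be a $Q$-orthonormal basis of $\mathfrak h$. Let $T$ be a $G$-invariant symmetric positive-semidefinite $(0,2)$-tensor field on $M$ that is not identically zero. Then there are constants $\zeta_1,\zeta_2,z_1,z_2\ge0$ with $-\sum_{j=1}^q[w_j,[w_j,X]]=\zeta_iX$ for all $X\in\mathfrak m_i$ $(i=1,2)$ and $$T(X_1+X_2,Y_1+Y_2)=z_1Q(X_1,Y_1)+z_2Q(X_2,Y_2)\qquad(X_i,Y_i\in\mathfrak m_i)$$ at the base point, and, with these constants, the following statements are equivalent: 1. There exist a $G$-invariant Riemannian metric $g$ on $M$ and a number $c>0$ such that $\mathrm{Ric}(g)=cT$ on $M$. 2. $\displaystyle\Big(\zeta_2+\frac{\gamma_{22}^2}{4d_2}+\frac{\gamma_{22}^1}{d_2}\Big)z_1>\Big(\zeta_1+\frac{\gamma_{11}^1}{4d_1}\Big)z_2.$ Moreover, the pair $(g,c)$ is unique up to scaling of $g$: if $g,g'$ are $G$-invariant Riemannian metrics on $M$ and $c,c'>0$ satisfy $\mathrm{Ric}(g)=cT$ and $\mathrm{Ric}(g')=c'T$, then $c=c'$ and $g'=tg$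 for some $t>0$. -/

import Mathlib

open scoped Manifold ContDiff Topology

set_option maxSynthPendingDepth 3

noncomputable section

/-! ### Ricci curvature of a Riemannian metric -/

section FlatRicci

variable {F : Type*} [NormedAddCommGroup F] [NormedSpace ℝ F]

/-- For a field `B` of bilinear forms on (an open subset of) the vector space `F`, the trilinear
expression `(∂_u B)(v, w) + (∂_v B)(u, w) - (∂_w B)(u, v)` at the point `y`. -/
def koszulForm (B : F → F →L[ℝ] F →L[ℝ] ℝ) (y : F) : F →L[ℝ] F →L[ℝ] F →L[ℝ] ℝ :=
  let D : F →L[ℝ] F →L[ℝ] F →L[ℝ] ℝ := fderiv ℝ B y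
  let flip : (F →L[ℝ] F →L[ℝ] ℝ) →L[ℝ] (F →L[ℝ] F →L[ℝ] ℝ) :=
    (ContinuousLinearMap.flipₗᵢ ℝ F F ℝ).toContinuousLinearEquiv.toContinuousLinearMap
  D + D.flip - flip.comp D.flip

theorem koszulForm_apply (B : F → F →L[ℝ] F →L[ℝ] ℝ) (y u v w : F) :
    koszulForm B y u v w
      = fderiv ℝ B y u v w + fderiv ℝ B y v u w - fderiv ℝ B y w u v := by
  simp [koszulForm]

/-- The Christoffel symbol at `y` of a metric `B` given on (an open subset of) the vector space `F`:
`Γ(u, v)` is the vector with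
`2 B(Γ(u, v), w) = (∂_u B)(v, w) + (∂_v B)(u, w) - (∂_w B)(u, v)` for all `w`. -/
def christoffel (B : F → F →L[ℝ] F →L[ℝ] ℝ) (y : F) : F →L[ℝ] F →L[ℝ] F :=
  (2⁻¹ : ℝ) • (ContinuousLinearMap.compL ℝ F (F →L[ℝ] ℝ) F (B y).inverse).comp (koszulForm B y)

/-- For `v, w` fixed, the linear map `u ↦ R(u, v) w`, where
`R(u, v) w = (∂_u Γ)(v, w) - (∂_v Γ)(u, w) + Γ(u, Γ(v, w)) - Γ(v, Γ(u, w))`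
is the Riemann curvature tensor at `y` of the metric `B`. -/
def curvatureMap (B : F → F →L[ℝ] F →L[ℝ] ℝ) (y v w : F) : F →L[ℝ] F :=
  ((fderiv ℝ (christoffel B) y).flip v).flip w
    - ((fderiv ℝ (christoffel B) y) v).flip w
    + (christoffel B y).flip (christoffel B y v w)
    - (christoffel B y v).comp ((christoffel B y).flip w)

theorem curvatureMap_apply (B : F → F →L[ℝ] F →L[ℝ] ℝ) (y u v w : F) :
    curvatureMap B y v w u
      = fderiv ℝ (christoffel B) y u v w - fderiv ℝ (christoffel B) y v u w
        + christoffel B y u (christoffel B y v w) - christoffel B y v (christoffel B y u w) := by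
  simp [curvatureMap]

/-- The Ricci curvature at `y` of the metric `B`, as the trace of `u ↦ R(u, v) w`. -/
def flatRicci (B : F → F →L[ℝ] F →L[ℝ] ℝ) (y v w : F) : ℝ :=
  LinearMap.trace ℝ F (curvatureMap B y v w).toLinearMap

end FlatRicci

section ManifoldRicci

variable {F : Type*} [NormedAddCommGroup F] [NormedSpace ℝ F]
  {M : Type*} [TopologicalSpace M] [ChartedSpace F M]

/-- A field of bilinear forms on the tangent spaces of the manifold `M`, that is, a `(0,2)`-tensor
field (no smoothness is included). -/
abbrev BilinField (F : Type*) [NormedAddCommGroup F] [NormedSpace ℝ F]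
    (M : Type*) [TopologicalSpace M] [ChartedSpace F M] : Type _ :=
  (p : M) → TangentSpace 𝓘(ℝ, F) p →L[ℝ] TangentSpace 𝓘(ℝ, F) p →L[ℝ] ℝ

/-- The expression of a `(0,2)`-tensor field `B` in the preferred chart at `p`: the pull-back of `B`
under the inverse of that chart. -/
def inChart (B : BilinField F M) (p : M) (y : F) : F →L[ℝ] F →L[ℝ] ℝ :=
  ContinuousLinearMap.bilinearComp (E := F) (F := F) (G := ℝ) (E' := F) (F' := F)
    (B ((extChartAt 𝓘(ℝ, F) p).symm y))
    (mfderiv 𝓘(ℝ, F) 𝓘(ℝ, F) (extChartAt 𝓘(ℝ, F) p).symm y)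
    (mfderiv 𝓘(ℝ, F) 𝓘(ℝ, F) (extChartAt 𝓘(ℝ, F) p).symm y)

/-- A smooth Riemannian metric on the manifold `M`. -/
abbrev RiemMetric (F : Type*) [NormedAddCommGroup F] [NormedSpace ℝ F]
    (M : Type*) [TopologicalSpace M] [ChartedSpace F M] [IsManifold 𝓘(ℝ, F) ∞ M] : Type _ :=
  Bundle.ContMDiffRiemannianMetric 𝓘(ℝ, F) ∞ F (fun p : M ↦ TangentSpace 𝓘(ℝ, F) p)

/-- The Ricci curvature `Ric(g)(u, v)` of a Riemannian metric `g`, for `u, v` tangent to `M` at `p`,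
computed in the preferred chart at `p`. -/
def ricci [IsManifold 𝓘(ℝ, F) ∞ M] (g : RiemMetric F M) (p : M)
    (u v : TangentSpace 𝓘(ℝ, F) p) : ℝ :=
  flatRicci (inChart g.inner p) (extChartAt 𝓘(ℝ, F) p p)
    (mfderiv 𝓘(ℝ, F) 𝓘(ℝ, F) (extChartAt 𝓘(ℝ, F) p) p u)
    (mfderiv 𝓘(ℝ, F) 𝓘(ℝ, F) (extChartAt 𝓘(ℝ, F) p) p v)

/-- Invariance of a `(0,2)`-tensor field under the action of the group `G` on `M`. -/
def IsInvariantField (G : Type*) [SMul G M] (B : BilinField F M) : Prop :=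
  ∀ (a : G) (p : M) (u v : TangentSpace 𝓘(ℝ, F) p),
    B (a • p) (mfderiv 𝓘(ℝ, F) 𝓘(ℝ, F) (fun x : M ↦ a • x) p u)
      (mfderiv 𝓘(ℝ, F) 𝓘(ℝ, F) (fun x : M ↦ a • x) p v) = B p u v

end ManifoldRicci

/-! ### Lie groups, their subgroups and Lie algebras -/

section LieGroups

variable {E : Type*} [NormedAddCommGroup E] [NormedSpace ℝ E]
  {G : Type*} [TopologicalSpace G] [ChartedSpace E G] [Group G]

/-- The adjoint action of `a ∈ G` on the Lie algebra: the derivative at `1` of `x ↦ a x a⁻¹`. -/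
def Ad (a : G) : GroupLieAlgebra 𝓘(ℝ, E) G →L[ℝ] GroupLieAlgebra 𝓘(ℝ, E) G :=
  (mfderiv 𝓘(ℝ, E) 𝓘(ℝ, E) (fun x : G ↦ a * x * a⁻¹) 1 : E →L[ℝ] E)

/-- The Lie algebra of a subgroup `S` of a Lie group `G`, as a subspace of the Lie algebra of `G`:
the set of the velocities at time `0` of the smooth curves in `G` that start at `1` and lie
in `S`. -/
def subgroupLieAlgebra [LieGroup 𝓘(ℝ, E) ∞ G] (S : Subgroup G) :
    Submodule ℝ (GroupLieAlgebra 𝓘(ℝ, E) G) where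
  carrier := {X | ∃ γ : ℝ → G, ContMDiff 𝓘(ℝ, ℝ) 𝓘(ℝ, E) ∞ γ ∧ γ 0 = 1 ∧ (∀ t, γ t ∈ S) ∧
    (mfderiv 𝓘(ℝ, ℝ) 𝓘(ℝ, E) γ 0 : ℝ →L[ℝ] E) 1 = X}
  zero_mem' := by
    refine ⟨fun _ ↦ 1, contMDiff_const, rfl, fun _ ↦ S.one_mem, ?_⟩
    rw [mfderiv_const]
    rfl
  add_mem' := by
    rintro _ _ ⟨γ, hγ, h0, hS, rfl⟩ ⟨δ, hδ, h0', hS', rfl⟩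
    refine ⟨fun t ↦ γ t * δ t, hγ.mul hδ, by simp [h0, h0'],
      fun t ↦ S.mul_mem (hS t) (hS' t), ?_⟩
    have hγd : MDifferentiableAt 𝓘(ℝ, ℝ) 𝓘(ℝ, E) γ 0 := hγ.mdifferentiableAt (by simp)
    have hδd : MDifferentiableAt 𝓘(ℝ, ℝ) 𝓘(ℝ, E) δ 0 := hδ.mdifferentiableAt (by simp)
    have hm : MDifferentiableAt (𝓘(ℝ, E).prod 𝓘(ℝ, E)) 𝓘(ℝ, E) (fun p : G × G ↦ p.1 * p.2)
        (γ 0, δ 0) := (contMDiff_mul 𝓘(ℝ, E) ∞).mdifferentiableAt (by simp)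
    have hc := mfderiv_comp_apply (I := 𝓘(ℝ, ℝ)) (I' := 𝓘(ℝ, E).prod 𝓘(ℝ, E)) (I'' := 𝓘(ℝ, E))
      (x := (0 : ℝ)) (f := fun t ↦ (γ t, δ t)) (g := fun p : G × G ↦ p.1 * p.2)
      hm (hγd.prodMk hδd) (1 : ℝ)
    rw [mfderiv_prodMk hγd hδd, mfderiv_prod_eq_add_apply hm] at hc
    have e1 : (fun z : G ↦ z * δ 0) = id := by ext z; simp [h0']
    have e2 : (fun z : G ↦ γ 0 * z) = id := by ext z; simp [h0]
    have e1' : mfderiv 𝓘(ℝ, E) 𝓘(ℝ, E) (fun z : G ↦ z * δ 0) (γ 0)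
        = (ContinuousLinearMap.id ℝ E : E →L[ℝ] E) := by rw [e1]; exact mfderiv_id
    have e2' : mfderiv 𝓘(ℝ, E) 𝓘(ℝ, E) (fun z : G ↦ γ 0 * z) (δ 0)
        = (ContinuousLinearMap.id ℝ E : E →L[ℝ] E) := by rw [e2]; exact mfderiv_id
    refine hc.trans ?_
    exact congrArg₂ (· + · : E → E → E)
      (DFunLike.congr_fun (F := E →L[ℝ] E) e1' _) (DFunLike.congr_fun (F := E →L[ℝ] E) e2' _)
  smul_mem' := by
    rintro c _ ⟨γ, hγ, h0, hS, rfl⟩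
    have hs : ContMDiff 𝓘(ℝ, ℝ) 𝓘(ℝ, ℝ) ∞ (fun t : ℝ ↦ c * t) :=
      (contDiff_const.mul contDiff_id).contMDiff
    refine ⟨fun t ↦ γ (c * t), hγ.comp hs, by simp [h0], fun t ↦ hS _, ?_⟩
    have hγd : MDifferentiableAt 𝓘(ℝ, ℝ) 𝓘(ℝ, E) γ (c * 0) := hγ.mdifferentiableAt (by simp)
    have hc := mfderiv_comp_apply (I := 𝓘(ℝ, ℝ)) (I' := 𝓘(ℝ, ℝ)) (I'' := 𝓘(ℝ, E))
      (x := (0 : ℝ)) (f := fun t ↦ c * t) (g := γ) hγd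
      (hs.mdifferentiableAt (by simp)) (1 : ℝ)
    refine hc.trans ?_
    have e : (mfderiv 𝓘(ℝ, ℝ) 𝓘(ℝ, ℝ) (fun t : ℝ ↦ c * t) 0 : ℝ →L[ℝ] ℝ) 1 = c • (1 : ℝ) := by
      rw [mfderiv_eq_fderiv]
      change fderiv ℝ (fun t : ℝ ↦ c * t) 0 1 = _
      rw [((hasDerivAt_id' (0 : ℝ)).const_mul c).hasFDerivAt.fderiv]
      simp
    have e0 : (mfderiv 𝓘(ℝ, ℝ) 𝓘(ℝ, E) γ (c * 0) : ℝ →L[ℝ] E)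
        = (mfderiv 𝓘(ℝ, ℝ) 𝓘(ℝ, E) γ 0 : ℝ →L[ℝ] E) := by rw [mul_zero]
    exact (congrArg (mfderiv 𝓘(ℝ, ℝ) 𝓘(ℝ, E) γ (c * 0) : ℝ →L[ℝ] E) e).trans
      ((ContinuousLinearMap.map_smul _ c (1 : ℝ)).trans
        (congrArg (fun L : ℝ →L[ℝ] E ↦ c • L 1) e0))

/-- `L` is a connected Lie group of dimension `n`, and `ι` is a smooth immersion of `L` into `G`. -/
def IsImmersedConnectedLieGroup (E : Type*) [NormedAddCommGroup E] [NormedSpace ℝ E]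
    {G : Type*} [TopologicalSpace G] [ChartedSpace E G] (n : ℕ) (L : Type*) [Group L]
    [TopologicalSpace L] [ChartedSpace (EuclideanSpace ℝ (Fin n)) L] (ι : L → G) : Prop :=
  ConnectedSpace L ∧ LieGroup (𝓡 n) ∞ L ∧ Manifold.IsImmersion (𝓡 n) 𝓘(ℝ, E) ∞ ι

/-- The subgroup `K` of `G` is a connected Lie subgroup: it carries the structure of a connected
Lie group for which the inclusion into `G` is a smooth immersion. The topology `τ` of this Lie
group may be finer than the topology induced by `G`. -/
def IsConnectedLieSubgroup (E : Type*) [NormedAddCommGroup E] [NormedSpace ℝ E]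
    {G : Type*} [TopologicalSpace G] [ChartedSpace E G] [Group G] (K : Subgroup G) : Prop :=
  ∃ (n : ℕ) (τ : TopologicalSpace K) (A : @ChartedSpace (EuclideanSpace ℝ (Fin n)) _ K τ),
    @IsImmersedConnectedLieGroup E _ _ G _ _ n K _ τ A (fun x : K ↦ (x : G))

/-- The Lie algebra of the Lie group `G` modelled on `E`: the tangent space at `1`, with
the bracket of left-invariant vector fields. -/
abbrev LieAlg (E : Type*) [NormedAddCommGroup E] [NormedSpace ℝ E]
    (G : Type*) [TopologicalSpace G] [ChartedSpace E G] [Group G] : Type _ :=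
  GroupLieAlgebra 𝓘(ℝ, E) G

/-- `Q` is an `Ad(G)`-invariant scalar product on the Lie algebra of `G`. -/
structure IsAdInvariantScalarProduct (Q : LinearMap.BilinForm ℝ (LieAlg E G)) : Prop where
  symm : ∀ X Y, Q X Y = Q Y X
  pos : ∀ X, X ≠ 0 → 0 < Q X X
  inv : ∀ (a : G) (X Y), Q (Ad a X) (Ad a Y) = Q X Y

/-- The subspace `V` of the Lie algebra of `G` is `Ad(S)`-invariant. -/
def IsAdInvariant (S : Subgroup G) (V : Submodule ℝ (LieAlg E G)) : Prop :=
  ∀ a ∈ S, ∀ X ∈ V, Ad a X ∈ V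

/-- `V` is an `Ad(S)`-invariant subspace on which the representation `Ad(S)|_V` is irreducible. -/
structure IsAdIrreducible (S : Subgroup G) (V : Submodule ℝ (LieAlg E G)) : Prop where
  invariant : IsAdInvariant S V
  ne_bot : V ≠ ⊥
  eq_bot_or_eq : ∀ W : Submodule ℝ (LieAlg E G), W ≤ V → IsAdInvariant S W → W = ⊥ ∨ W = V

/-- The representations of `S` on the invariant subspaces `V` and `W` given by restriction of the
adjoint representation are equivalent. -/
def AdEquivalent (S : Subgroup G) (V W : Submodule ℝ (LieAlg E G)) : Prop :=
  ∃ φ : V ≃ₗ[ℝ] W, ∀ a ∈ S, ∀ X Y : V,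
    (Y : LieAlg E G) = Ad a (X : LieAlg E G) → (φ Y : LieAlg E G) = Ad a (φ X : LieAlg E G)

/-- The finite family `e` is a `Q`-orthonormal basis of the subspace `V`. -/
structure IsOrthonormalBasisOf (Q : LinearMap.BilinForm ℝ (LieAlg E G))
    (V : Submodule ℝ (LieAlg E G)) {d : ℕ} (e : Fin d → LieAlg E G) : Prop where
  orthonormal : ∀ i j, Q (e i) (e j) = if i = j then 1 else 0
  span : Submodule.span ℝ (Set.range e) = V

/-- The structure constant `∑ Q([e_i, f_j], h_k)²` of three finite families in the Lie algebra. -/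
def gammaConst (Q : LinearMap.BilinForm ℝ (LieAlg E G)) {a b c : ℕ}
    (e : Fin a → LieAlg E G) (f : Fin b → LieAlg E G) (h : Fin c → LieAlg E G) : ℝ :=
  ∑ i, ∑ j, ∑ k, (Q ⁅e i, f j⁆ (h k)) ^ 2

/-- The operator `-∑ ad w_j ∘ ad w_j` on the Lie algebra of `G`. -/
def casimir {q : ℕ} (w : Fin q → LieAlg E G) (X : LieAlg E G) : LieAlg E G :=
  -∑ j, ⁅w j, ⁅w j, X⁆⁆

end LieGroups

section Quotient

variable {E : Type*} [NormedAddCommGroup E] [NormedSpace ℝ E]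
  {G : Type*} [TopologicalSpace G] [ChartedSpace E G] [Group G]
  {F : Type*} [NormedAddCommGroup F] [NormedSpace ℝ F]

/-- The value of a `(0,2)`-tensor field `B` on `G/H` at the base point, evaluated on the images of
`X, Y` under the differential at `1` of the projection `G → G/H`. On an `Ad(H)`-invariant complement
of the Lie algebra of `H`, this differential is the usual identification with the tangent space
of `G/H` at the base point. -/
def atBasePoint {H : Subgroup G} [ChartedSpace F (G ⧸ H)] (B : BilinField F (G ⧸ H))
    (X Y : LieAlg E G) : ℝ :=
  B ((1 : G) : G ⧸ H)
    (mfderiv 𝓘(ℝ, E) 𝓘(ℝ, F) (fun x : G ↦ (x : G ⧸ H)) 1 X)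
    (mfderiv 𝓘(ℝ, E) 𝓘(ℝ, F) (fun x : G ↦ (x : G ⧸ H)) 1 Y)

end Quotient

end

noncomputable section

/-! ### Levi-Civita connection of a metric on an open subset of a vector space -/

section KillingRicci

variable {F : Type*} [NormedAddCommGroup F] [NormedSpace ℝ F]

/-! By Schur's lemma (`IsAdIrreducible.exists_form_eq`, `IsAdIrreducible.form_eq_zero`), an
`Ad(H)`-invariant form on `𝔪₁ ⊕ 𝔪₂` that is symmetric on each summand is diagonal: a multiple of `Q`
on each summand. This applies to the metric, `g = x₁ Q + x₂ Q`, to `T = z₁ Q + z₂ Q` and to the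
Ricci curvature. The subgroup `K` forces `[𝔪₁, 𝔪₁]` to be orthogonal to `𝔪₂`, so up to the order of
the indices `γ = γ₂₂¹` is the only mixed structure constant that survives. With `s = x₁ / x₂`, the
Ricci coefficients are `r₁ = A₁ + B₁ s²` and `r₂ = A₂ - B₂ s`, where `A₁ = ζ₁ + γ₁₁¹/(4d₁)`, `A₂ =
ζ₂ + γ₂₂²/(4d₂) + γ/d₂`, `B₁ = γ/(4d₁)`, `B₂ = γ/(2d₂)`
(`IsTwoSummandSplitting.ricciForm_eq_diagForm`).

Hence `Ric(g) = cT` is the system `A₁ + B₁ s² = c z₁`, `A₂ - B₂ s = c z₂` in `s, c > 0`. Eliminating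
`c` leaves a zero of `(A₂ - B₂ s) z₁ - (A₁ + B₁ s²) z₂`, which equals `A₂ z₁ - A₁ z₂` at `s = 0` and
is nonpositive at `s = A₂/B₂`. The intermediate value theorem gives existence, and positivity of the
terms gives necessity (`exists_ratio_iff`). A larger `s` needs a larger `c` in the first equation
but not in the second, so the solution is unique (`ratio_unique`). The metric is then known up to
scale.

Most of the work derives the Ricci formula from the definition in charts. The fundamental vector
fields of the action are Killing fields closed under brackets. For such fields the Koszul formula
involves no derivatives, and it can be differentiated once more along a Killing field, so the
curvature becomes an expression in brackets and inner products
(`IsKillingAlgebraAt.two_mul_flatRicci`). The computation is made at every point `a • o` in its own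
chart, with the action conjugated by `a`. The result does not depend on `a`, which also yields the
invariance of the Ricci curvature. -/

theorem christoffel_apply (B : F → F →L[ℝ] F →L[ℝ] ℝ) (y u v : F) :
    christoffel B y u v = (2⁻¹ : ℝ) • (B y).inverse (koszulForm B y u v) := by
  simp [christoffel]

theorem two_mul_apply_christoffel {B : F → F →L[ℝ] F →L[ℝ] ℝ} {y : F}
    (h : (B y).IsInvertible) (u v w : F) :
    2 * B y (christoffel B y u v) w = koszulForm B y u v w := by
  rw [christoffel_apply, map_smul, h.self_apply_inverse]
  simp

theorem contDiffAt_koszulForm {B : F → F →L[ℝ] F →L[ℝ] ℝ} {y : F}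
    (hB : ContDiffAt ℝ ∞ B y) : ContDiffAt ℝ ∞ (koszulForm B) y := by
  have hD : ContDiffAt ℝ ∞ (fderiv ℝ B) y := hB.fderiv_right (m := ∞) (by simp)
  have h1 : ContDiffAt ℝ ∞ (fun y ↦ (fderiv ℝ B y).flip) y :=
    (ContinuousLinearMap.flipₗᵢ ℝ F F (F →L[ℝ] ℝ)).toContinuousLinearEquiv.contDiff.contDiffAt.comp
      y hD
  exact (hD.add h1).sub (contDiffAt_const.clm_comp h1)

theorem eventually_isInvertible [CompleteSpace F] {B : F → F →L[ℝ] F →L[ℝ] ℝ} {y : F}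
    (hB : ContinuousAt B y) (h : (B y).IsInvertible) : ∀ᶠ z in 𝓝 y, (B z).IsInvertible := by
  obtain ⟨e, he⟩ := h
  have := hB.eventually (he ▸ e.nhds)
  filter_upwards [this] with z ⟨e', he'⟩ using ⟨e', he'⟩

theorem contDiffAt_christoffel [CompleteSpace F] {B : F → F →L[ℝ] F →L[ℝ] ℝ} {y : F}
    (hB : ContDiffAt ℝ ∞ B y) (h : (B y).IsInvertible) : ContDiffAt ℝ ∞ (christoffel B) y := by
  have hi : ContDiffAt ℝ ∞ (fun y ↦ (B y).inverse) y :=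
    (h.contDiffAt_map_inverse).comp y hB
  have h1 : ContDiffAt ℝ ∞
      (fun y ↦ ContinuousLinearMap.compL ℝ F (F →L[ℝ] ℝ) F (B y).inverse) y :=
    (ContinuousLinearMap.contDiff _).contDiffAt.comp y hi
  exact (contDiffAt_const (c := (2⁻¹ : ℝ))).smul (h1.clm_comp (contDiffAt_koszulForm hB))

theorem isInvertible_of_pos [FiniteDimensional ℝ F] {b : F →L[ℝ] F →L[ℝ] ℝ}
    (h : ∀ u, u ≠ 0 → 0 < b u u) : b.IsInvertible := by
  have hinj : Function.Injective b := by
    rw [injective_iff_map_eq_zero]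
    intro u hu
    by_contra hne
    have := h u hne
    simp [hu] at this
  have hfr : Module.finrank ℝ F = Module.finrank ℝ (F →L[ℝ] ℝ) := by
    rw [← (LinearMap.toContinuousLinearMap : (F →ₗ[ℝ] ℝ) ≃ₗ[ℝ] (F →L[ℝ] ℝ)).finrank_eq]
    exact (Subspace.dual_finrank_eq (K := ℝ) (V := F)).symm
  refine ⟨(LinearEquiv.ofInjectiveOfFinrankEq b.toLinearMap hinj hfr).toContinuousLinearEquiv, ?_⟩
  ext u v
  rfl

/-- The covariant derivative of the vector field `W` along the vector field `V`. -/
def flatNabla (B : F → F →L[ℝ] F →L[ℝ] ℝ) (V W : F → F) (y : F) : F :=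
  fderiv ℝ W y (V y) + christoffel B y (V y) (W y)

/-- The two evaluations are the same function near `y`, so their derivatives agree. -/
theorem koszulForm_eventually_symm {B : F → F →L[ℝ] F →L[ℝ] ℝ} {y : F}
    (hd : DifferentiableAt ℝ B y) (hsymm : ∀ᶠ z in 𝓝 y, ∀ u v, B z u v = B z v u) (u v w : F) :
    fderiv ℝ B y u v w = fderiv ℝ B y u w v := by
  have h1 : HasFDerivAt (fun z ↦ B z v w) (((fderiv ℝ B y).flip v).flip w) y := by
    have := (hd.hasFDerivAt.clm_apply (hasFDerivAt_const v y)).clm_apply (hasFDerivAt_const w y)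
    convert! this using 1
    ext; simp
  have h2 : HasFDerivAt (fun z ↦ B z w v) (((fderiv ℝ B y).flip w).flip v) y := by
    have := (hd.hasFDerivAt.clm_apply (hasFDerivAt_const w y)).clm_apply (hasFDerivAt_const v y)
    convert! this using 1
    ext; simp
  have h3 : (fun z ↦ B z v w) =ᶠ[𝓝 y] fun z ↦ B z w v := by
    filter_upwards [hsymm] with z hz using hz v w
  have := h1.unique (h2.congr_of_eventuallyEq h3)
  simpa using DFunLike.congr_fun this u

/-- Add the Koszul identities for `(u, v, w)` and `(u, w, v)`: by symmetry of `B` the derivatives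
along `v` and `w` cancel. -/
theorem metric_compatible {B : F → F →L[ℝ] F →L[ℝ] ℝ} {y : F}
    (hd : DifferentiableAt ℝ B y) (hsymm : ∀ᶠ z in 𝓝 y, ∀ u v, B z u v = B z v u)
    (h : (B y).IsInvertible) (u v w : F) :
    fderiv ℝ B y u v w = B y (christoffel B y u v) w + B y v (christoffel B y u w) := by
  have h1 := two_mul_apply_christoffel h u v w
  have h2 := two_mul_apply_christoffel h u w v
  rw [koszulForm_apply] at h1 h2
  rw [hsymm.self_of_nhds v]
  have h3 := koszulForm_eventually_symm hd hsymm u v w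
  have h4 := koszulForm_eventually_symm hd hsymm v u w
  have h5 := koszulForm_eventually_symm hd hsymm w u v
  linarith

end KillingRicci

/-! ### Curvature and Ricci curvature through Killing fields -/

section KillingRicci

variable {F : Type*} [NormedAddCommGroup F] [NormedSpace ℝ F]

theorem fderiv_flatNabla {B : F → F →L[ℝ] F →L[ℝ] ℝ} {y : F} {V W : F → F}
    (hΓ : DifferentiableAt ℝ (christoffel B) y) (hV : DifferentiableAt ℝ V y)
    (hW : ContDiffAt ℝ ∞ W y) (u : F) :
    fderiv ℝ (flatNabla B V W) y u = fderiv ℝ (fderiv ℝ W) y u (V y) + fderiv ℝ W y (fderiv ℝ V y u)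
      + (fderiv ℝ (christoffel B) y u (V y) (W y) + christoffel B y (fderiv ℝ V y u) (W y)
        + christoffel B y (V y) (fderiv ℝ W y u)) := by
  have hDW : DifferentiableAt ℝ (fderiv ℝ W) y :=
    (hW.fderiv_right (m := ∞) (by simp)).differentiableAt (by simp)
  have hW1 : DifferentiableAt ℝ W y := hW.differentiableAt (by simp)
  have h1 := hDW.hasFDerivAt.clm_apply hV.hasFDerivAt
  have h2 := (hΓ.hasFDerivAt.clm_apply hV.hasFDerivAt).clm_apply hW1.hasFDerivAt
  have h3 : HasFDerivAt (flatNabla B V W) _ y := h1.add h2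
  rw [h3.fderiv]
  simp
  abel

theorem differentiableAt_flatNabla {B : F → F →L[ℝ] F →L[ℝ] ℝ} {y : F} {V W : F → F}
    (hΓ : DifferentiableAt ℝ (christoffel B) y) (hV : DifferentiableAt ℝ V y)
    (hW : ContDiffAt ℝ ∞ W y) : DifferentiableAt ℝ (flatNabla B V W) y := by
  have hDW : DifferentiableAt ℝ (fderiv ℝ W) y :=
    (hW.fderiv_right (m := ∞) (by simp)).differentiableAt (by simp)
  have hW1 : DifferentiableAt ℝ W y := hW.differentiableAt (by simp)
  exact ((hDW.clm_apply hV).add ((hΓ.clm_apply hV).clm_apply hW1))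

/-- Second derivatives of `W` cancel by symmetry, and the last bracket is the covariant derivative
of `W` along `[U, V]`. Curvature can thus be computed from any fields with the given values, in
particular from Killing fields. -/
theorem curvatureMap_eq_flatNabla {B : F → F →L[ℝ] F →L[ℝ] ℝ} {y : F} {U V W : F → F}
    (hΓ : DifferentiableAt ℝ (christoffel B) y) (hU : DifferentiableAt ℝ U y)
    (hV : DifferentiableAt ℝ V y) (hW : ContDiffAt ℝ ∞ W y) :
    curvatureMap B y (V y) (W y) (U y) = flatNabla B U (flatNabla B V W) y
      - flatNabla B V (flatNabla B U W) y
      - (fderiv ℝ W y (fderiv ℝ V y (U y) - fderiv ℝ U y (V y))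
        + christoffel B y (fderiv ℝ V y (U y) - fderiv ℝ U y (V y)) (W y)) := by
  have hs : fderiv ℝ (fderiv ℝ W) y (U y) (V y) = fderiv ℝ (fderiv ℝ W) y (V y) (U y) :=
    (hW.isSymmSndFDerivAt (by simpa using (WithTop.coe_le_coe.2 le_top : ((2 : ℕ∞) : WithTop ℕ∞) ≤ ∞))).eq _ _
  rw [curvatureMap_apply]
  simp only [flatNabla.eq_1 B U (flatNabla B V W), flatNabla.eq_1 B V (flatNabla B U W),
    fderiv_flatNabla hΓ hV hW, fderiv_flatNabla hΓ hU hW, hs]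
  simp only [flatNabla, map_add, map_sub, sub_apply]
  abel

variable {L : Type*} [LieRing L] [LieAlgebra ℝ L]

/-- `K` is a Lie algebra of Killing fields (with the bracket relation of the fundamental vector
fields of a left action) of the metric `B` near `y`. -/
structure IsKillingAlgebraAt (B : F → F →L[ℝ] F →L[ℝ] ℝ) (y : F) (K : L →ₗ[ℝ] F → F) : Prop where
  contDiffAt : ContDiffAt ℝ ∞ B y
  symm : ∀ᶠ z in 𝓝 y, ∀ u v, B z u v = B z v u
  pos : ∀ u, u ≠ 0 → 0 < B y u u
  field_contDiffAt : ∀ X, ContDiffAt ℝ ∞ (K X) y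
  killing : ∀ X, ∀ᶠ z in 𝓝 y, ∀ u v,
    fderiv ℝ B z (K X z) u v + B z (fderiv ℝ (K X) z u) v + B z u (fderiv ℝ (K X) z v) = 0
  bracket : ∀ X Z, ∀ᶠ z in 𝓝 y,
    fderiv ℝ (K X) z (K Z z) - fderiv ℝ (K Z) z (K X z) = K ⁅X, Z⁆ z

namespace IsKillingAlgebraAt

variable {B : F → F →L[ℝ] F →L[ℝ] ℝ} {y : F} {K : L →ₗ[ℝ] F → F}

/-- The left side is the derivative of `⟨K P, K R⟩` along `K W`. The Killing equation removes the
derivative of `B`, and the bracket relation absorbs the derivatives of the fields. -/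
theorem fderiv_pairing (h : IsKillingAlgebraAt B y K) (W P R : L) :
    fderiv ℝ B y (K W y) (K P y) (K R y) + B y (fderiv ℝ (K P) y (K W y)) (K R y)
      + B y (K P y) (fderiv ℝ (K R) y (K W y))
      = -(B y (K ⁅W, P⁆ y) (K R y) + B y (K P y) (K ⁅W, R⁆ y)) := by
  have h1 := (h.killing W).self_of_nhds (K P y) (K R y)
  have h2 := (h.bracket W P).self_of_nhds
  have h3 := (h.bracket W R).self_of_nhds
  rw [← h2, ← h3]
  simp only [map_sub, sub_apply]
  linarith

/-- In the Koszul form, each derivative of `B` is taken along a Killing field and is replaced by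
means of its Killing equation; the derivatives of the fields then pair up into brackets. The
identity is needed on a neighbourhood because it is differentiated next. -/
theorem two_mul_inner_flatNabla [FiniteDimensional ℝ F] (h : IsKillingAlgebraAt B y K) (X Y Z : L) :
    ∀ᶠ z in 𝓝 y, 2 * B z (flatNabla B (K X) (K Y) z) (K Z z)
      = -(B z (K ⁅X, Y⁆ z) (K Z z) + B z (K ⁅X, Z⁆ z) (K Y z) + B z (K ⁅Y, Z⁆ z) (K X z)) := by
  have : CompleteSpace F := FiniteDimensional.complete ℝ F
  have hinv := eventually_isInvertible h.contDiffAt.continuousAt (isInvertible_of_pos h.pos)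
  filter_upwards [h.killing X, h.killing Y, h.killing Z, h.bracket X Y, h.bracket X Z,
    h.bracket Y Z, h.symm, hinv] with z hX hY hZ hXY hXZ hYZ hs hi
  have hk := two_mul_apply_christoffel hi (K X z) (K Y z) (K Z z)
  rw [koszulForm_apply] at hk
  have e1 := hX (K Y z) (K Z z)
  have e2 := hY (K X z) (K Z z)
  have e3 := hZ (K X z) (K Y z)
  rw [← hXY, ← hXZ, ← hYZ]
  simp only [flatNabla, map_sub, map_add, sub_apply,
    add_apply]
  rw [hs (K Y z)] at e1
  rw [hs (K X z)] at e2
  rw [hs (K X z)] at e3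
  linarith

/-- The derivative of `two_mul_inner_flatNabla` along `K W`: metric compatibility acts on the left
side and `fderiv_pairing` on the right. -/
theorem two_mul_inner_flatNabla_flatNabla [FiniteDimensional ℝ F]
    (h : IsKillingAlgebraAt B y K) (W X Y Z : L) :
    2 * B y (flatNabla B (K W) (flatNabla B (K X) (K Y)) y) (K Z y)
      + 2 * B y (flatNabla B (K X) (K Y) y) (flatNabla B (K W) (K Z) y)
      = B y (K ⁅W, ⁅X, Y⁆⁆ y) (K Z y) + B y (K ⁅X, Y⁆ y) (K ⁅W, Z⁆ y)
        + (B y (K ⁅W, ⁅X, Z⁆⁆ y) (K Y y) + B y (K ⁅X, Z⁆ y) (K ⁅W, Y⁆ y))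
        + (B y (K ⁅W, ⁅Y, Z⁆⁆ y) (K X y) + B y (K ⁅Y, Z⁆ y) (K ⁅W, X⁆ y)) := by
  have : CompleteSpace F := FiniteDimensional.complete ℝ F
  have hinv := isInvertible_of_pos h.pos
  have hd : DifferentiableAt ℝ B y := h.contDiffAt.differentiableAt (by simp)
  have hK : ∀ X, DifferentiableAt ℝ (K X) y := fun X ↦
    (h.field_contDiffAt X).differentiableAt (by simp)
  have hΓ := (contDiffAt_christoffel h.contDiffAt hinv).differentiableAt (by simp)
  have hN := differentiableAt_flatNabla hΓ (hK X) (h.field_contDiffAt Y)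
  have hpair : ∀ (P Q : F → F) (_ : DifferentiableAt ℝ P y) (_ : DifferentiableAt ℝ Q y),
      HasFDerivAt (fun z ↦ B z (P z) (Q z)) _ y := fun P Q hP hQ ↦
    (hd.hasFDerivAt.clm_apply hP.hasFDerivAt).clm_apply hQ.hasFDerivAt
  have hl := (hpair _ _ hN (hK Z)).const_mul 2
  have hr := (((hpair _ _ (hK ⁅X, Y⁆) (hK Z)).add (hpair _ _ (hK ⁅X, Z⁆) (hK Y))).add
    (hpair _ _ (hK ⁅Y, Z⁆) (hK X))).neg
  have hu := hl.unique (hr.congr_of_eventuallyEq (h.two_mul_inner_flatNabla X Y Z))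
  have hu' := DFunLike.congr_fun hu (K W y)
  simp only [smul_apply, add_apply,
    neg_apply, ContinuousLinearMap.comp_apply,
    ContinuousLinearMap.flip_apply, smul_eq_mul] at hu'
  have p1 := h.fderiv_pairing W ⁅X, Y⁆ Z
  have p2 := h.fderiv_pairing W ⁅X, Z⁆ Y
  have p3 := h.fderiv_pairing W ⁅Y, Z⁆ X
  have hc := metric_compatible hd h.symm hinv (K W y) (flatNabla B (K X) (K Y) y) (K Z y)
  simp only [flatNabla.eq_1 B (K W), map_add, add_apply]
  linarith

/-- Each of the three terms of the curvature is paired with `K W` by the preceding formulas, and the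
Jacobi identity cancels the other double brackets. The products of two covariant derivatives are
left to be expanded in a frame. -/
theorem two_mul_inner_curvatureMap [FiniteDimensional ℝ F]
    (h : IsKillingAlgebraAt B y K) (X Y Z W : L) :
    2 * B y (curvatureMap B y (K Y y) (K Z y) (K X y)) (K W y)
      = B y (K ⁅X, ⁅Z, W⁆⁆ y) (K Y y) - B y (K ⁅Y, ⁅Z, W⁆⁆ y) (K X y)
        + B y (K ⁅Z, W⁆ y) (K ⁅X, Y⁆ y)
        - 2 * B y (flatNabla B (K Y) (K Z) y) (flatNabla B (K X) (K W) y)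
        + 2 * B y (flatNabla B (K X) (K Z) y) (flatNabla B (K Y) (K W) y) := by
  have : CompleteSpace F := FiniteDimensional.complete ℝ F
  have hinv := isInvertible_of_pos h.pos
  have hK : ∀ X, DifferentiableAt ℝ (K X) y := fun X ↦
    (h.field_contDiffAt X).differentiableAt (by simp)
  have hΓ := (contDiffAt_christoffel h.contDiffAt hinv).differentiableAt (by simp)
  have hs := h.symm.self_of_nhds
  -- The field bracket of `K X` and `K Y` is `K ⁅Y, X⁆`: fundamental fields of a left action reverse
  -- the order of the bracket.
  rw [curvatureMap_eq_flatNabla hΓ (hK X) (hK Y) (h.field_contDiffAt Z),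
    (h.bracket Y X).self_of_nhds]
  have e1 := h.two_mul_inner_flatNabla_flatNabla X Y Z W
  have e2 := h.two_mul_inner_flatNabla_flatNabla Y X Z W
  have e3 := (h.two_mul_inner_flatNabla ⁅Y, X⁆ Z W).self_of_nhds
  rw [flatNabla] at e3
  have j1 : ∀ V : L, K ⁅⁅Y, X⁆, V⁆ y = K ⁅Y, ⁅X, V⁆⁆ y - K ⁅X, ⁅Y, V⁆⁆ y := by
    intro V
    rw [lie_lie, map_sub]; rfl
  have j2 : K ⁅Y, X⁆ y = -K ⁅X, Y⁆ y := by
    rw [← lie_skew, map_neg]; rfl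
  simp only [j1, map_sub, sub_apply] at e3 ⊢
  rw [j2] at e2 e3 ⊢
  simp only [map_neg, neg_apply] at e2 e3 ⊢
  rw [hs (K ⁅X, Z⁆ y) (K ⁅Y, W⁆ y), hs (K ⁅X, W⁆ y) (K ⁅Y, Z⁆ y)] at e2
  linarith

/-- The frame is orthogonal with squared lengths `l i`, so it is a basis and the coordinates of `x`
are `b x (f i) / l i`. -/
theorem trace_eq_sum_of_orthogonal {b : F →L[ℝ] F →L[ℝ] ℝ} {ι : Type*} [Fintype ι]
    {f : ι → F} {l : ι → ℝ} (hl : ∀ i, 0 < l i) (hf : ∀ i j, i ≠ j → b (f i) (f j) = 0)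
    (hfl : ∀ i, b (f i) (f i) = l i) (hspan : ⊤ ≤ Submodule.span ℝ (Set.range f))
    (S : F →ₗ[ℝ] F) : LinearMap.trace ℝ F S = ∑ i, (l i)⁻¹ * b (S (f i)) (f i) := by
  classical
  have hli : LinearIndependent ℝ f := by
    rw [Fintype.linearIndependent_iff]
    intro c hc i
    have h1 : b (∑ j, c j • f j) (f i) = 0 := by rw [hc]; simp
    rw [map_sum, sum_apply, Finset.sum_eq_single i] at h1
    · simp only [map_smul, smul_apply, hfl, smul_eq_mul] at h1
      exact (mul_eq_zero.mp h1).resolve_right (hl i).ne'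
    · intro j _ hj
      simp [hf j i hj]
    · simp
  let v := Module.Basis.mk hli hspan
  have hv : ∀ i, v i = f i := fun i ↦ Module.Basis.mk_apply hli hspan i
  have hrepr : ∀ x i, v.repr x i = (l i)⁻¹ * b x (f i) := by
    intro x i
    conv_rhs => rw [← v.sum_repr x]
    rw [map_sum, sum_apply, Finset.sum_eq_single i]
    · simp only [map_smul, smul_apply, hv, hfl, smul_eq_mul]
      field_simp [(hl i).ne']
    · intro j _ hj
      simp [hv, hf j i hj]
    · simp
  rw [LinearMap.trace_eq_matrix_trace ℝ v, Matrix.trace]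
  refine Finset.sum_congr rfl fun i _ ↦ ?_
  rw [Matrix.diag_apply, LinearMap.toMatrix_apply, hrepr, hv]

theorem inner_eq_sum_of_orthogonal {b : F →L[ℝ] F →L[ℝ] ℝ} {ι : Type*} [Fintype ι]
    {f : ι → F} {l : ι → ℝ} (hl : ∀ i, 0 < l i) (hf : ∀ i j, i ≠ j → b (f i) (f j) = 0)
    (hfl : ∀ i, b (f i) (f i) = l i) (hspan : ⊤ ≤ Submodule.span ℝ (Set.range f))
    (hs : ∀ u v, b u v = b v u) (u v : F) :
    b u v = ∑ i, (l i)⁻¹ * (b u (f i) * b v (f i)) := by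
  classical
  obtain ⟨c, rfl⟩ := (Submodule.mem_span_range_iff_exists_fun ℝ).1 (hspan (Submodule.mem_top (x := u)))
  have h1 : ∀ i, b (∑ j, c j • f j) (f i) = c i * l i := by
    intro i
    rw [map_sum, sum_apply, Finset.sum_eq_single i]
    · simp [hfl]
    · intro j _ hj
      simp [hf j i hj]
    · simp
  simp only [h1]
  rw [map_sum, sum_apply]
  refine Finset.sum_congr rfl fun i _ ↦ ?_
  have := (hl i).ne'
  rw [map_smul, smul_apply, smul_eq_mul, hs (f i)]
  field_simp

/-- The Ricci curvature of a metric with a transitive Lie algebra of Killing fields. -/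
theorem two_mul_flatRicci [FiniteDimensional ℝ F] (h : IsKillingAlgebraAt B y K)
    {ι : Type*} [Fintype ι] {e : ι → L} {l : ι → ℝ} (hl : ∀ i, 0 < l i)
    (he : ∀ i j, i ≠ j → B y (K (e i) y) (K (e j) y) = 0)
    (hel : ∀ i, B y (K (e i) y) (K (e i) y) = l i)
    (hspan : ⊤ ≤ Submodule.span ℝ (Set.range fun i ↦ K (e i) y))
    (huni : ∀ i j, B y (K ⁅e i, e j⁆ y) (K (e i) y) = 0)
    {b : L → L → ℝ} (hb : ∀ X Y, b X Y = B y (K X y) (K Y y)) (Y Z : L) :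
    2 * flatRicci B y (K Y y) (K Z y)
      = ∑ i, (l i)⁻¹ * (b ⁅e i, ⁅Z, e i⁆⁆ Y - b ⁅Y, ⁅Z, e i⁆⁆ (e i) - b ⁅Z, e i⁆ ⁅Y, e i⁆)
        + ∑ i, ∑ j, (l i)⁻¹ * (l j)⁻¹ * 2⁻¹ *
          ((b ⁅e i, Z⁆ (e j) + b ⁅e i, e j⁆ Z + b ⁅Z, e j⁆ (e i)) *
            (b ⁅Y, e i⁆ (e j) + b ⁅Y, e j⁆ (e i) + b ⁅e i, e j⁆ Y)) := by
  have hs := h.symm.self_of_nhds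
  have hn : ∀ X Y Z, 2 * B y (flatNabla B (K X) (K Y) y) (K Z y)
      = -(b ⁅X, Y⁆ Z + b ⁅X, Z⁆ Y + b ⁅Y, Z⁆ X) := fun X Y Z ↦ by
    simp only [hb]
    exact (h.two_mul_inner_flatNabla X Y Z).self_of_nhds
  -- By `huni` the vector `∇_{e_i} e_i` is orthogonal to the whole frame. This removes one of the
  -- two products of covariant derivatives in the curvature.
  have hee : ∀ i v, B y v (flatNabla B (K (e i)) (K (e i)) y) = 0 := by
    intro i v
    rw [inner_eq_sum_of_orthogonal hl he hel hspan hs]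
    refine Finset.sum_eq_zero fun j _ ↦ ?_
    have h0 := hn (e i) (e i) (e j)
    have h1 : b ⁅e i, e i⁆ (e j) = 0 := by
      rw [hb, lie_self, map_zero]
      simp
    have h2 : b ⁅e i, e j⁆ (e i) = 0 := by rw [hb, huni]
    rw [h1, h2] at h0
    have h3 : B y (flatNabla B (K (e i)) (K (e i)) y) (K (e j) y) = 0 := by linarith
    rw [h3]
    ring
  rw [flatRicci, trace_eq_sum_of_orthogonal hl he hel hspan, Finset.mul_sum,
    ← Finset.sum_add_distrib]
  refine Finset.sum_congr rfl fun i _ ↦ ?_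
  have hc := h.two_mul_inner_curvatureMap (e i) Y Z (e i)
  rw [hee, inner_eq_sum_of_orthogonal hl he hel hspan hs
    (flatNabla B (K (e i)) (K Z) y), Finset.mul_sum] at hc
  have hterm : ∀ j, 2 * ((l j)⁻¹ * (B y (flatNabla B (K (e i)) (K Z) y) (K (e j) y)
        * B y (flatNabla B (K Y) (K (e i)) y) (K (e j) y)))
      = (l j)⁻¹ * 2⁻¹ * ((b ⁅e i, Z⁆ (e j) + b ⁅e i, e j⁆ Z + b ⁅Z, e j⁆ (e i)) *
            (b ⁅Y, e i⁆ (e j) + b ⁅Y, e j⁆ (e i) + b ⁅e i, e j⁆ Y)) := by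
    intro j
    have h1 := hn (e i) Z (e j)
    have h2 := hn Y (e i) (e j)
    have h1' : B y (flatNabla B (K (e i)) (K Z) y) (K (e j) y)
        = -(b ⁅e i, Z⁆ (e j) + b ⁅e i, e j⁆ Z + b ⁅Z, e j⁆ (e i)) / 2 := by linarith
    have h2' : B y (flatNabla B (K Y) (K (e i)) y) (K (e j) y)
        = -(b ⁅Y, e i⁆ (e j) + b ⁅Y, e j⁆ (e i) + b ⁅e i, e j⁆ Y) / 2 := by linarith
    rw [h1', h2']
    ring
  simp only [hterm] at hc
  have hneg : K ⁅e i, Y⁆ y = -K ⁅Y, e i⁆ y := by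
    rw [← lie_skew, map_neg]; rfl
  rw [hneg, map_neg, ← hb, ← hb, ← hb] at hc
  have hfac : ∑ j, (l i)⁻¹ * (l j)⁻¹ * 2⁻¹ *
          ((b ⁅e i, Z⁆ (e j) + b ⁅e i, e j⁆ Z + b ⁅Z, e j⁆ (e i)) *
            (b ⁅Y, e i⁆ (e j) + b ⁅Y, e j⁆ (e i) + b ⁅e i, e j⁆ Y))
      = (l i)⁻¹ * ∑ j, (l j)⁻¹ * 2⁻¹ *
          ((b ⁅e i, Z⁆ (e j) + b ⁅e i, e j⁆ Z + b ⁅Z, e j⁆ (e i)) *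
            (b ⁅Y, e i⁆ (e j) + b ⁅Y, e j⁆ (e i) + b ⁅e i, e j⁆ Y)) := by
    rw [Finset.mul_sum]
    exact Finset.sum_congr rfl fun j _ ↦ by ring
  rw [hfac, ← mul_add, mul_left_comm, ContinuousLinearMap.coe_coe, hc]
  congr 1
  ring

end IsKillingAlgebraAt
end KillingRicci

/-! ### Local groups and local actions: brackets, Killing equation, adjoint action -/

section LocalAction

variable {E : Type*} [NormedAddCommGroup E] [NormedSpace ℝ E]
  {F : Type*} [NormedAddCommGroup F] [NormedSpace ℝ F]
  {F' : Type*} [NormedAddCommGroup F'] [NormedSpace ℝ F']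

theorem fderiv_comp_left {f : E × F → F'} {x : E} {y : F} (hf : DifferentiableAt ℝ f (x, y)) :
    HasFDerivAt (fun z ↦ f (z, y)) ((fderiv ℝ f (x, y)).comp (ContinuousLinearMap.inl ℝ E F)) x :=
  hf.hasFDerivAt.comp x (hasFDerivAt_prodMk_left x y)

theorem fderiv_comp_right {f : E × F → F'} {x : E} {y : F} (hf : DifferentiableAt ℝ f (x, y)) :
    HasFDerivAt (fun z ↦ f (x, z)) ((fderiv ℝ f (x, y)).comp (ContinuousLinearMap.inr ℝ E F)) y :=
  hf.hasFDerivAt.comp y (hasFDerivAt_prodMk_right x y)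

/-- The bracket at the neutral element `x₀` of a local group with multiplication `μ`. -/
def localBracket (μ : E × E → E) (x₀ X Z : E) : E :=
  fderiv ℝ (fderiv ℝ μ) (x₀, x₀) (X, 0) (0, Z) - fderiv ℝ (fderiv ℝ μ) (x₀, x₀) (Z, 0) (0, X)

theorem contDiffAt_two {f : E → F} {x : E} (hf : ContDiffAt ℝ ∞ f x) : ContDiffAt ℝ 2 f x :=
  hf.of_le (by simpa using (WithTop.coe_le_coe.2 le_top : ((2 : ℕ∞) : WithTop ℕ∞) ≤ ∞))

theorem contDiffAt_two_eventually {f : E → F} {x : E} (hf : ContDiffAt ℝ ∞ f x) :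
    ∀ᶠ z in 𝓝 x, ContDiffAt ℝ 2 f z :=
  (contDiffAt_two hf).eventually (by simp)

theorem differentiableAt_fderiv {f : E → F} {x : E} (hf : ContDiffAt ℝ 2 f x) :
    DifferentiableAt ℝ (fderiv ℝ f) x :=
  (hf.fderiv_right (m := 1) (by norm_num)).differentiableAt (by simp)

theorem second_fderiv_symm {f : E → F} {x : E} (hf : ContDiffAt ℝ 2 f x) (u v : E) :
    fderiv ℝ (fderiv ℝ f) x u v = fderiv ℝ (fderiv ℝ f) x v u :=
  (hf.isSymmSndFDerivAt (by simp)).eq u v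

/-- The fundamental vector field of a local action. -/
def fundField (α : E × F → F) (x₀ : E) (X : E) (y : F) : F := fderiv ℝ α (x₀, y) (X, 0)

theorem hasFDerivAt_fundField {α : E × F → F} {x₀ : E} {y : F} (hα : ContDiffAt ℝ 2 α (x₀, y))
    (X : E) : HasFDerivAt (fundField α x₀ X)
      (((fderiv ℝ (fderiv ℝ α) (x₀, y)).flip (X, 0)).comp (ContinuousLinearMap.inr ℝ E F)) y := by
  have h1 := fderiv_comp_right (differentiableAt_fderiv hα)
  have h2 := h1.clm_apply (hasFDerivAt_const ((X, 0) : E × F) y)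
  convert! h2 using 1
  ext; simp

theorem fderiv_fundField {α : E × F → F} {x₀ : E} {y : F} (hα : ContDiffAt ℝ 2 α (x₀, y))
    (X : E) (u : F) : fderiv ℝ (fundField α x₀ X) y u
      = fderiv ℝ (fderiv ℝ α) (x₀, y) (0, u) (X, 0) := by
  rw [(hasFDerivAt_fundField hα X).fderiv]
  simp

theorem contDiffAt_fundField {α : E × F → F} {x₀ : E} {y : F} (hα : ContDiffAt ℝ ∞ α (x₀, y))
    (X : E) : ContDiffAt ℝ ∞ (fundField α x₀ X) y := by
  have h1 : ContDiffAt ℝ ∞ (fderiv ℝ α) (x₀, y) := hα.fderiv_right (m := ∞) (by simp)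
  have h2 : ContDiffAt ℝ ∞ (fun z ↦ fderiv ℝ α (x₀, z)) y :=
    h1.comp y (contDiffAt_const.prodMk contDiffAt_id)
  exact h2.clm_apply contDiffAt_const

/-- Differentiate the action law `α(μ(x, x'), y) = α(x, α(x', y))` at `x₀`, in `x` and then in `x'`.
This expresses the derivative of one fundamental field along another by a mixed second derivative of
`μ` and a symmetric second derivative of `α`; the latter disappears on antisymmetrising. -/
theorem bracket_fundField {α : E × F → F} {μ : E × E → E} {x₀ : E} {y₀ : F}
    (hα : ContDiffAt ℝ ∞ α (x₀, y₀)) (hμ : ContDiffAt ℝ ∞ μ (x₀, x₀))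
    (hα1 : ∀ᶠ y in 𝓝 y₀, α (x₀, y) = y)
    (hμ1 : ∀ᶠ x in 𝓝 x₀, μ (x₀, x) = x) (hμ2 : ∀ᶠ x in 𝓝 x₀, μ (x, x₀) = x)
    (hact : ∀ᶠ p : (E × E) × F in 𝓝 ((x₀, x₀), y₀), α (μ p.1, p.2) = α (p.1.1, α (p.1.2, p.2)))
    (X Z : E) : ∀ᶠ y in 𝓝 y₀,
      fderiv ℝ (fundField α x₀ X) y (fundField α x₀ Z y)
        - fderiv ℝ (fundField α x₀ Z) y (fundField α x₀ X y)
      = fundField α x₀ (localBracket μ x₀ X Z) y := by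
  have hμ0 : μ (x₀, x₀) = x₀ := hμ1.self_of_nhds
  have hμd : ContDiffAt ℝ 2 μ (x₀, x₀) := contDiffAt_two hμ
  have hcont : ContinuousAt (fun y : F ↦ (x₀, y)) y₀ := by fun_prop
  have hcont' : ContinuousAt (fun y : F ↦ ((x₀, x₀), y)) y₀ := by fun_prop
  filter_upwards [hα1, hcont.eventually (contDiffAt_two_eventually hα),
    hcont'.eventually hact.eventually_nhds] with y hy hαy hacty
  have key : ∀ X Z : E, fderiv ℝ (fundField α x₀ X) y (fundField α x₀ Z y)
      = fderiv ℝ (fderiv ℝ α) (x₀, y) (Z, 0) (X, 0)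
        + fundField α x₀ (fderiv ℝ (fderiv ℝ μ) (x₀, x₀) (0, Z) (X, 0)) y := by
    intro X Z
    -- The action law differentiated in the first group variable only.
    have step : ∀ᶠ x' in 𝓝 x₀, fderiv ℝ α (x', y) (fderiv ℝ μ (x₀, x') (X, 0), 0)
        = fundField α x₀ X (α (x', y)) := by
      have c1 : ContinuousAt (fun x' : E ↦ (x', y)) x₀ := by fun_prop
      have c2 : ContinuousAt (fun x' : E ↦ (x₀, x')) x₀ := by fun_prop
      have c3 : ContinuousAt (fun x' : E ↦ ((x₀, x'), y)) x₀ := by fun_prop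
      have c4 : ContinuousAt (fun x' : E ↦ (x₀, α (x', y))) x₀ :=
        continuousAt_const.prodMk (hαy.continuousAt.comp_of_eq c1 rfl)
      filter_upwards [hμ1, c1.eventually (hαy.eventually (by simp)),
        c2.eventually (hμd.eventually (by simp)), c3.eventually hacty.eventually_nhds,
        c4.eventually (p := fun q ↦ ContDiffAt ℝ 2 α q)
          (by simp only [hy]; exact hαy.eventually (by simp))]
        with x' h1 h2 h3 h4 h5
      have g1 : HasFDerivAt (fun x ↦ μ (x, x')) _ x₀ :=
        fderiv_comp_left (h3.differentiableAt (by simp))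
      have g2 : HasFDerivAt (fun z ↦ α (z, y)) _ (μ (x₀, x')) :=
        fderiv_comp_left (by rw [h1]; exact h2.differentiableAt (by simp))
      have g3 := g2.comp x₀ g1
      have g4 : HasFDerivAt (fun x ↦ α (x, α (x', y))) _ x₀ :=
        fderiv_comp_left (h5.differentiableAt (by simp))
      have c5 : ContinuousAt (fun x : E ↦ ((x, x'), y)) x₀ := by fun_prop
      have g5 := g3.unique (g4.congr_of_eventuallyEq (c5.eventually h4))
      have g6 := DFunLike.congr_fun g5 X
      simpa [h1, fundField] using g6
    have l1 := fderiv_comp_left (differentiableAt_fderiv hαy)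
    have l2 := (fderiv_comp_right (differentiableAt_fderiv hμd)).clm_apply
      (hasFDerivAt_const ((X, 0) : E × E) x₀)
    have l3 := l1.clm_apply (l2.prodMk (hasFDerivAt_const (0 : F) x₀))
    have r1 : HasFDerivAt (fun x' ↦ α (x', y)) _ x₀ :=
      fderiv_comp_left (hαy.differentiableAt (by simp))
    have r2 : HasFDerivAt (fundField α x₀ X) (fderiv ℝ (fundField α x₀ X) y) (α (x₀, y)) := by
      rw [hy]; exact (hasFDerivAt_fundField hαy X).differentiableAt.hasFDerivAt
    have r3 := r2.comp x₀ r1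
    have u := l3.unique (r3.congr_of_eventuallyEq step)
    have u1 := DFunLike.congr_fun u Z
    have m1 : fderiv ℝ μ (x₀, x₀) (X, 0) = X := by
      have a1 : HasFDerivAt (fun x ↦ μ (x, x₀)) _ x₀ :=
        fderiv_comp_left (hμd.differentiableAt (by simp))
      have a2 := a1.unique ((hasFDerivAt_id x₀).congr_of_eventuallyEq hμ2)
      simpa using DFunLike.congr_fun a2 X
    simp only [ContinuousLinearMap.comp_apply, ContinuousLinearMap.inl_apply,
      ContinuousLinearMap.flip_apply, add_apply, ContinuousLinearMap.prod_apply,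
      zero_apply, ContinuousLinearMap.inr_apply, m1, map_zero, zero_add] at u1
    rw [fundField, fundField, ← u1]
    exact add_comm _ _
  rw [key, key, localBracket, second_fderiv_symm hαy (Z, 0), second_fderiv_symm hμd (0, Z),
    second_fderiv_symm hμd (0, X)]
  simp only [fundField]
  rw [show ((fderiv ℝ (fderiv ℝ μ) (x₀, x₀) (X, 0) (0, Z)
    - fderiv ℝ (fderiv ℝ μ) (x₀, x₀) (Z, 0) (0, X), 0) : E × F)
    = (fderiv ℝ (fderiv ℝ μ) (x₀, x₀) (X, 0) (0, Z), 0)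
      - (fderiv ℝ (fderiv ℝ μ) (x₀, x₀) (Z, 0) (0, X), 0) by simp, map_sub]
  abel

/-- The Killing equation is the derivative of the isometry identity in the group variable at `x₀`.
The mixed second derivatives of `α` that occur are the derivatives of the fundamental field. -/
theorem killing_fundField {α : E × F → F} {x₀ : E} {y₀ : F} {B : F → F →L[ℝ] F →L[ℝ] ℝ}
    (hα : ContDiffAt ℝ ∞ α (x₀, y₀)) (hB : ContDiffAt ℝ ∞ B y₀)
    (hα1 : ∀ᶠ y in 𝓝 y₀, α (x₀, y) = y)
    (hiso : ∀ᶠ p in 𝓝 (x₀, y₀), ∀ u v,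
      B (α p) (fderiv ℝ α p (0, u)) (fderiv ℝ α p (0, v)) = B p.2 u v)
    (X : E) : ∀ᶠ y in 𝓝 y₀, ∀ u v,
      fderiv ℝ B y (fundField α x₀ X y) u v + B y (fderiv ℝ (fundField α x₀ X) y u) v
        + B y u (fderiv ℝ (fundField α x₀ X) y v) = 0 := by
  have hcont : ContinuousAt (fun y : F ↦ (x₀, y)) y₀ := by fun_prop
  filter_upwards [hα1.eventually_nhds, hcont.eventually (contDiffAt_two_eventually hα),
    hcont.eventually hiso.eventually_nhds, contDiffAt_two_eventually hB] with y hy1 hαy hi hBy u v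
  have hy := hy1.self_of_nhds
  have hid : ∀ u, fderiv ℝ α (x₀, y) (0, u) = u := by
    intro u
    have a1 : HasFDerivAt (fun z ↦ α (x₀, z)) _ y :=
      fderiv_comp_right (hαy.differentiableAt (by simp))
    have a2 := a1.unique ((hasFDerivAt_id y).congr_of_eventuallyEq hy1)
    simpa using DFunLike.congr_fun a2 u
  have l1 := fderiv_comp_left (differentiableAt_fderiv hαy)
  have lu := l1.clm_apply (hasFDerivAt_const ((0, u) : E × F) x₀)
  have lv := l1.clm_apply (hasFDerivAt_const ((0, v) : E × F) x₀)
  have r1 : HasFDerivAt (fun x' ↦ α (x', y)) _ x₀ :=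
    fderiv_comp_left (hαy.differentiableAt (by simp))
  have r2 : HasFDerivAt B (fderiv ℝ B (α (x₀, y))) (α (x₀, y)) := by
    rw [hy]; exact (hBy.differentiableAt (by simp)).hasFDerivAt
  have t := ((r2.comp x₀ r1).clm_apply lu).clm_apply lv
  have c1 : ContinuousAt (fun x' : E ↦ (x', y)) x₀ := by fun_prop
  have u1 := t.unique ((hasFDerivAt_const (B y u v) x₀).congr_of_eventuallyEq
    ((c1.eventually hi).mono fun x hx ↦ hx u v))
  have u2 := DFunLike.congr_fun u1 X
  simp only [ContinuousLinearMap.comp_apply, ContinuousLinearMap.inl_apply,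
      ContinuousLinearMap.flip_apply, add_apply, Function.comp_apply, hid, hy,
      zero_apply, map_zero, zero_add] at u2
  rw [fderiv_fundField hαy, fderiv_fundField hαy, second_fderiv_symm hαy (0, u),
    second_fderiv_symm hαy (0, v), fundField]
  linarith

/-- Differentiate `μ(c(x, z), x) = μ(x, z)`, which says that `c` is conjugation, in `z` at `x₀` and
then in `x`. The two mixed second derivatives of `μ` form the bracket. -/
theorem hasFDerivAt_localAd {μ c : E × E → E} {x₀ : E}
    (hμ : ContDiffAt ℝ ∞ μ (x₀, x₀)) (hc : ContDiffAt ℝ ∞ c (x₀, x₀))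
    (hμ2 : ∀ᶠ x in 𝓝 x₀, μ (x, x₀) = x) (hμ1 : ∀ᶠ x in 𝓝 x₀, μ (x₀, x) = x)
    (hc1 : ∀ᶠ x in 𝓝 x₀, c (x, x₀) = x₀)
    (hconj : ∀ᶠ p in 𝓝 (x₀, x₀), μ (c p, p.1) = μ p) (Z : E) :
    ∃ D : E →L[ℝ] E, HasFDerivAt (fun x ↦ fderiv ℝ c (x, x₀) (0, Z)) D x₀ ∧
      ∀ X, D X = localBracket μ x₀ X Z := by
  have hμd : ContDiffAt ℝ 2 μ (x₀, x₀) := contDiffAt_two hμ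
  have hcd : ContDiffAt ℝ 2 c (x₀, x₀) := contDiffAt_two hc
  have hc0 := hc1.self_of_nhds
  have d1 := (fderiv_comp_left (differentiableAt_fderiv hcd)).clm_apply
    (hasFDerivAt_const ((0, Z) : E × E) x₀)
  refine ⟨_, d1, fun X ↦ ?_⟩
  -- The right translate by `x` of the conjugated vector is the left translate by `x` of `Z`.
  have step : ∀ᶠ x in 𝓝 x₀, fderiv ℝ μ (x₀, x) (fderiv ℝ c (x, x₀) (0, Z), 0)
      = fderiv ℝ μ (x, x₀) (0, Z) := by
    have c1 : ContinuousAt (fun x : E ↦ (x, x₀)) x₀ := by fun_prop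
    have c2 : ContinuousAt (fun x : E ↦ (x₀, x)) x₀ := by fun_prop
    filter_upwards [c2.eventually (hμd.eventually (by simp)),
      c1.eventually (hcd.eventually (by simp)), c1.eventually (hμd.eventually (by simp)),
      c1.eventually hconj.eventually_nhds, hc1] with x h1 h2 h3 h4 h5
    have g1 : HasFDerivAt (fun z ↦ c (x, z)) _ x₀ :=
      fderiv_comp_right (h2.differentiableAt (by simp))
    have g2 : HasFDerivAt (fun z ↦ μ (z, x)) _ (c (x, x₀)) :=
      fderiv_comp_left (f := μ) (by rw [h5]; exact h1.differentiableAt (by simp))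
    have g4 : HasFDerivAt (fun z ↦ μ (x, z)) _ x₀ :=
      fderiv_comp_right (h3.differentiableAt (by simp))
    have c5 : ContinuousAt (fun z : E ↦ (x, z)) x₀ := by fun_prop
    have g3 := g2.comp x₀ g1
    have g5 := g3.unique (g4.congr_of_eventuallyEq (c5.eventually h4))
    simpa [h5] using DFunLike.congr_fun g5 Z
  have l1 := (fderiv_comp_right (differentiableAt_fderiv hμd)).clm_apply
    (d1.prodMk (hasFDerivAt_const (0 : E) x₀))
  have r1 := (fderiv_comp_left (differentiableAt_fderiv hμd)).clm_apply
    (hasFDerivAt_const ((0, Z) : E × E) x₀)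
  have u1 := DFunLike.congr_fun (l1.unique (r1.congr_of_eventuallyEq step)) X
  have hcZ : fderiv ℝ c (x₀, x₀) (0, Z) = Z := by
    have g1 : HasFDerivAt (fun z ↦ c (x₀, z)) _ x₀ :=
      fderiv_comp_right (hcd.differentiableAt (by simp))
    have hz : ∀ᶠ z in 𝓝 x₀, c (x₀, z) = z := by
      have c5 : ContinuousAt (fun z : E ↦ (x₀, z)) x₀ := by fun_prop
      have c6 : Filter.Tendsto (fun z : E ↦ c (x₀, z)) (𝓝 x₀) (𝓝 x₀) := by
        have := hcd.continuousAt.comp_of_eq c5 rfl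
        simpa [ContinuousAt, Function.comp_def, hc0] using this
      filter_upwards [c5.eventually hconj, hμ1, c6.eventually hμ2] with z h1 h2 h3
      rw [h3, h2] at h1
      exact h1
    have a2 := g1.unique ((hasFDerivAt_id x₀).congr_of_eventuallyEq hz)
    simpa using DFunLike.congr_fun a2 Z
  have m1 : ∀ X, fderiv ℝ μ (x₀, x₀) (X, 0) = X := by
    intro X
    have a1 : HasFDerivAt (fun x ↦ μ (x, x₀)) _ x₀ :=
      fderiv_comp_left (hμd.differentiableAt (by simp))
    have a2 := a1.unique ((hasFDerivAt_id x₀).congr_of_eventuallyEq hμ2)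
    simpa using DFunLike.congr_fun a2 X
  simp only [ContinuousLinearMap.comp_apply, ContinuousLinearMap.inl_apply,
      ContinuousLinearMap.flip_apply, add_apply, ContinuousLinearMap.prod_apply,
      zero_apply, ContinuousLinearMap.inr_apply, m1, hcZ, map_zero, zero_add] at u1 ⊢
  rw [localBracket, second_fderiv_symm hμd (Z, 0), ← u1]
  abel

end LocalAction

/-! ### Tensor fields and derivatives in charts -/

section Coordinates

variable {F : Type*} [NormedAddCommGroup F] [NormedSpace ℝ F]
  {M : Type*} [TopologicalSpace M] [ChartedSpace F M]
  {F' : Type*} [NormedAddCommGroup F'] [NormedSpace ℝ F']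
  {M' : Type*} [TopologicalSpace M'] [ChartedSpace F' M']
  {F'' : Type*} [NormedAddCommGroup F''] [NormedSpace ℝ F'']
  {M'' : Type*} [TopologicalSpace M''] [ChartedSpace F'' M'']

/-- The derivative of a map between manifolds, as a linear map between the model spaces. -/
def modelDeriv (F : Type*) [NormedAddCommGroup F] [NormedSpace ℝ F]
    {M : Type*} [TopologicalSpace M] [ChartedSpace F M]
    (F' : Type*) [NormedAddCommGroup F'] [NormedSpace ℝ F']
    {M' : Type*} [TopologicalSpace M'] [ChartedSpace F' M'] (f : M → M') (p : M) : F →L[ℝ] F' :=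
  mfderiv 𝓘(ℝ, F) 𝓘(ℝ, F') f p

/-- The value of a field of bilinear forms, as a bilinear form on the model space. -/
def modelForm (B : BilinField F M) (p : M) : F →L[ℝ] F →L[ℝ] ℝ := B p

theorem modelDeriv_comp {f : M → M'} {g : M' → M''} {p : M}
    (hg : MDifferentiableAt 𝓘(ℝ, F') 𝓘(ℝ, F'') g (f p))
    (hf : MDifferentiableAt 𝓘(ℝ, F) 𝓘(ℝ, F') f p) :
    modelDeriv F F'' (g ∘ f) p = (modelDeriv F' F'' g (f p)).comp (modelDeriv F F' f p) :=
  mfderiv_comp p hg hf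

theorem modelDeriv_comp_apply {f : M → M'} {g : M' → M''} {p : M}
    (hg : MDifferentiableAt 𝓘(ℝ, F') 𝓘(ℝ, F'') g (f p))
    (hf : MDifferentiableAt 𝓘(ℝ, F) 𝓘(ℝ, F') f p) (v : F) :
    modelDeriv F F'' (g ∘ f) p v = modelDeriv F' F'' g (f p) (modelDeriv F F' f p v) := by
  rw [modelDeriv_comp hg hf]; rfl

theorem modelDeriv_eq_fderiv (f : F → F') (y : F) : modelDeriv F F' f y = fderiv ℝ f y :=
  mfderiv_eq_fderiv

theorem modelDeriv_id (p : M) : modelDeriv F F (id : M → M) p = ContinuousLinearMap.id ℝ F :=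
  mfderiv_id

theorem modelDeriv_congr {f g : M → M'} {p : M} (h : f =ᶠ[𝓝 p] g) :
    modelDeriv F F' f p = modelDeriv F F' g p :=
  h.mfderiv_eq

theorem modelDeriv_const (c : M') (p : M) : modelDeriv F F' (fun _ : M ↦ c) p = 0 :=
  mfderiv_const

theorem inChart_apply (B : BilinField F M) (p : M) (y u v : F) :
    inChart B p y u v = modelForm B ((extChartAt 𝓘(ℝ, F) p).symm y)
      (modelDeriv F F (extChartAt 𝓘(ℝ, F) p).symm y u)
      (modelDeriv F F (extChartAt 𝓘(ℝ, F) p).symm y v) := rfl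

variable [IsManifold 𝓘(ℝ, F) ∞ M]

theorem modelDeriv_extChartAt_self (p : M) :
    modelDeriv F F (extChartAt 𝓘(ℝ, F) p) p = ContinuousLinearMap.id ℝ F :=
  have : IsManifold 𝓘(ℝ, F) 1 M := .of_le (n := ∞) (by simp)
  mfderiv_extChartAt_self (I := 𝓘(ℝ, F)) (x := p)

/-- The trivialization of the tangent bundle at `p` is given by the derivative of the preferred
chart, and its inverse by the derivative of the inverse chart. -/
theorem inCoordinates_eq_inChart (B : BilinField F M) (p x : M)
    (hx : x ∈ (chartAt F p).source) :
    ContinuousLinearMap.inCoordinates F (fun p : M ↦ TangentSpace 𝓘(ℝ, F) p) (F →L[ℝ] ℝ)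
      (fun p : M ↦ TangentSpace 𝓘(ℝ, F) p →L[ℝ] ℝ) p x p x (B x)
      = inChart B p (extChartAt 𝓘(ℝ, F) p x) := by
  ext u v
  have : IsManifold 𝓘(ℝ, F) 1 M := .of_le (n := ∞) (by simp)
  have hx' : x ∈ (trivializationAt F (TangentSpace 𝓘(ℝ, F)) p).baseSet := hx
  have hx2 : x ∈ (extChartAt 𝓘(ℝ, F) p).source := by rwa [extChartAt_source]
  rw [inCoordinates_apply_eq₂ hx' hx' (Set.mem_univ _)]
  have hsymm : ∀ v : F, (trivializationAt F (TangentSpace 𝓘(ℝ, F)) p).symm x v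
      = modelDeriv F F (extChartAt 𝓘(ℝ, F) p).symm (extChartAt 𝓘(ℝ, F) p x) v := by
    intro v
    have h := TangentBundle.symmL_trivializationAt (I := 𝓘(ℝ, F)) (x₀ := p) (x := x) hx
    rw [modelWithCornersSelf_coe, Set.range_id, mfderivWithin_univ] at h
    rw [← Bundle.Trivialization.symmL_apply (R := ℝ)]
    · exact DFunLike.congr_fun (F := F →L[ℝ] F) h v
    · exact hx'
  have hlin : ∀ r : ℝ, (trivializationAt ℝ (Bundle.Trivial M ℝ) p).linearMapAt ℝ x r = r := by
    intro r
    simp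
  refine (hlin _).trans ?_
  rw [inChart_apply, (extChartAt 𝓘(ℝ, F) p).left_inv hx2]
  exact congrArg₂ (fun a b : F ↦ modelForm B x a b) (hsymm u) (hsymm v)

/-- Translates between the smoothness built into a Riemannian metric and that of its coefficients,
in both directions: for a given metric and for one to be constructed. -/
theorem contMDiffAt_iff_inChart (B : BilinField F M) (p : M) :
    ContMDiffAt 𝓘(ℝ, F) (𝓘(ℝ, F).prod 𝓘(ℝ, F →L[ℝ] F →L[ℝ] ℝ)) ∞
      (fun b ↦ Bundle.TotalSpace.mk' (F →L[ℝ] F →L[ℝ] ℝ)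
        (E := fun b : M ↦ TangentSpace 𝓘(ℝ, F) b →L[ℝ] TangentSpace 𝓘(ℝ, F) b →L[ℝ] ℝ) b (B b)) p
      ↔ ContDiffAt ℝ ∞ (inChart B p) (extChartAt 𝓘(ℝ, F) p p) := by
  rw [contMDiffAt_hom_bundle]
  have hsrc : (chartAt F p).source ∈ 𝓝 p := (chartAt F p).open_source.mem_nhds (mem_chart_source F p)
  have hcongr : (fun x ↦ ContinuousLinearMap.inCoordinates F (fun p : M ↦ TangentSpace 𝓘(ℝ, F) p)
      (F →L[ℝ] ℝ) (fun p : M ↦ TangentSpace 𝓘(ℝ, F) p →L[ℝ] ℝ) p x p x (B x))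
      =ᶠ[𝓝 p] fun x ↦ inChart B p (extChartAt 𝓘(ℝ, F) p x) := by
    filter_upwards [hsrc] with x hx using inCoordinates_eq_inChart B p x hx
  constructor
  · rintro ⟨-, h⟩
    have h2 : ContMDiffAt 𝓘(ℝ, F) 𝓘(ℝ, F →L[ℝ] F →L[ℝ] ℝ) ∞
        (fun x ↦ inChart B p (extChartAt 𝓘(ℝ, F) p x)) p := h.congr_of_eventuallyEq hcongr.symm
    have hs : ContMDiffAt 𝓘(ℝ, F) 𝓘(ℝ, F) ∞ (extChartAt 𝓘(ℝ, F) p).symm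
        (extChartAt 𝓘(ℝ, F) p p) :=
      (contMDiffOn_extChartAt_symm p).contMDiffAt (extChartAt_target_mem_nhds p)
    have h3 := h2.comp_of_eq hs (by simp)
    refine (contMDiffAt_iff_contDiffAt.1 h3).congr_of_eventuallyEq ?_
    filter_upwards [extChartAt_target_mem_nhds (I := 𝓘(ℝ, F)) p] with y hy
    rw [Function.comp_apply, (extChartAt 𝓘(ℝ, F) p).right_inv hy]
  · intro h
    refine ⟨contMDiffAt_id, ?_⟩
    have h2 := (contMDiffAt_iff_contDiffAt.2 h).comp p
      (contMDiffAt_extChartAt (I := 𝓘(ℝ, F)) (n := ∞))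
    exact h2.congr_of_eventuallyEq hcongr

theorem ricci_eq_flatRicci (g : RiemMetric F M) (p : M) (u v : F) :
    ricci g p u v = flatRicci (inChart g.inner p) (extChartAt 𝓘(ℝ, F) p p) u v := by
  have h := modelDeriv_extChartAt_self (F := F) p
  exact congrArg₂ (fun a b : F ↦ flatRicci (inChart g.inner p) (extChartAt 𝓘(ℝ, F) p p) a b)
    (DFunLike.congr_fun h u) (DFunLike.congr_fun h v)

end Coordinates

/-! ### Local sections and fibres of submersions -/

section Submersion

variable {E : Type*} [NormedAddCommGroup E] [NormedSpace ℝ E]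
  {N : Type*} [TopologicalSpace N] [ChartedSpace E N]
  {F : Type*} [NormedAddCommGroup F] [NormedSpace ℝ F]
  {M : Type*} [TopologicalSpace M] [ChartedSpace F M]

/-- In adapted charts a submersion is a projection `(u, k) ↦ u`, with section `u ↦ (u, k₀)`. -/
theorem Manifold.IsSubmersionAt.exists_local_section {f : N → M} {x : N}
    (hf : Manifold.IsSubmersionAt 𝓘(ℝ, E) 𝓘(ℝ, F) ∞ f x) :
    ∃ s : M → N, ContMDiffAt 𝓘(ℝ, F) 𝓘(ℝ, E) ∞ s (f x) ∧ s (f x) = x ∧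
      ∀ᶠ y in 𝓝 (f x), f (s y) = y := by
  set φ := hf.domChart.extend 𝓘(ℝ, E) with hφ
  set χ := hf.codChart.extend 𝓘(ℝ, F) with hχ
  have hw : ∀ z ∈ φ.target, χ (f (φ.symm z)) = (hf.equiv z).1 := fun z hz ↦ hf.writtenInCharts hz
  have hxs : x ∈ φ.source := by
    rw [hφ, OpenPartialHomeomorph.extend_source]; exact hf.mem_domChart_source
  have hfxs : f x ∈ χ.source := by
    rw [hχ, OpenPartialHomeomorph.extend_source]; exact hf.mem_codChart_source
  have hxt : φ x ∈ φ.target := φ.map_source hxs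
  have hφt : φ.target = hf.domChart.target := by
    rw [hφ, OpenPartialHomeomorph.extend_target]; simp
  have hφo : IsOpen φ.target := by
    rw [hφ]; exact OpenPartialHomeomorph.isOpen_extend_target _
  have hχs : ∀ᶠ y in 𝓝 (f x), y ∈ χ.source := by
    rw [hχ, OpenPartialHomeomorph.extend_source]
    exact hf.codChart.open_source.mem_nhds hf.mem_codChart_source
  have hfx : χ (f x) = (hf.equiv (φ x)).1 := by
    rw [← hw _ hxt, φ.left_inv hxs]
  -- The fibre coordinate is frozen at its value at `x`.
  let j : M → E := fun y ↦ hf.equiv.symm (χ y, (hf.equiv (φ x)).2)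
  have hj0 : j (f x) = φ x := by
    simp only [j, hfx]
    exact hf.equiv.symm_apply_apply _
  have hχd : ContMDiffAt 𝓘(ℝ, F) 𝓘(ℝ, F) ∞ χ (f x) :=
    contMDiffAt_of_mem_maximalAtlas hf.codChart_mem_maximalAtlas hf.mem_codChart_source
  have hjd : ContMDiffAt 𝓘(ℝ, F) 𝓘(ℝ, E) ∞ j (f x) := by
    have h1 : ContDiff ℝ ∞ (fun z : F ↦ hf.equiv.symm (z, (hf.equiv (φ x)).2)) :=
      hf.equiv.symm.contDiff.comp (contDiff_id.prodMk contDiff_const)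
    exact h1.contMDiff.contMDiffAt.comp (f x) hχd
  have hsd : ContMDiffAt 𝓘(ℝ, E) 𝓘(ℝ, E) ∞ φ.symm (φ x) :=
    (contMDiffOn_extend_symm hf.domChart_mem_maximalAtlas).contMDiffAt
      (by rw [modelWithCornersSelf_coe, Set.image_id, ← hφt]; exact hφo.mem_nhds hxt)
  refine ⟨fun y ↦ φ.symm (j y), hsd.comp_of_eq hjd hj0, ?_, ?_⟩
  · simp only [hj0]
    exact φ.left_inv hxs
  · have hjt : ∀ᶠ y in 𝓝 (f x), j y ∈ φ.target :=
      hjd.continuousAt.eventually (by rw [hj0]; exact hφo.mem_nhds hxt)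
    filter_upwards [hjt, hχs] with y hy hys
    have h2 : χ (f (φ.symm (j y))) = χ y := by
      rw [hw _ hy]
      simp [j]
    refine χ.injOn ?_ hys h2
    have : φ.symm (j y) ∈ φ.source := φ.map_target hy
    rw [hφ, OpenPartialHomeomorph.extend_source] at this
    rw [hχ, OpenPartialHomeomorph.extend_source]
    exact hf.source_subset_preimage_source this

theorem Manifold.IsSubmersionAt.surjective_modelDeriv {f : N → M} {x : N}
    (hf : Manifold.IsSubmersionAt 𝓘(ℝ, E) 𝓘(ℝ, F) ∞ f x) :
    Function.Surjective (modelDeriv E F f x) := by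
  obtain ⟨s, hs, hsx, hfs⟩ := hf.exists_local_section
  intro v
  have hfd : MDifferentiableAt 𝓘(ℝ, E) 𝓘(ℝ, F) f (s (f x)) := by
    rw [hsx]; exact hf.contMDiffAt.mdifferentiableAt (by simp)
  have h1 := modelDeriv_comp_apply hfd (hs.mdifferentiableAt (by simp)) v
  have h2 : f ∘ s =ᶠ[𝓝 (f x)] id := hfs
  rw [modelDeriv_congr h2, modelDeriv_id, hsx] at h1
  exact ⟨_, h1.symm⟩

/-- In adapted charts a kernel vector is tangent to the fibre direction, so a short segment along it
stays in the fibre. The scaling by `ε` does no harm, since the velocities in question form a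
subspace. -/
theorem Manifold.IsSubmersionAt.exists_curve_in_fibre {f : N → M} {x : N}
    (hf : Manifold.IsSubmersionAt 𝓘(ℝ, E) 𝓘(ℝ, F) ∞ f x) {v : E} (hv : modelDeriv E F f x v = 0) :
    ∃ (ε : ℝ) (γ : ℝ → N), ε ≠ 0 ∧ ContMDiff 𝓘(ℝ, ℝ) 𝓘(ℝ, E) ∞ γ ∧ γ 0 = x ∧
      (∀ t, f (γ t) = f x) ∧ modelDeriv ℝ E γ 0 1 = ε • v := by
  set φ := hf.domChart.extend 𝓘(ℝ, E) with hφ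
  set χ := hf.codChart.extend 𝓘(ℝ, F) with hχ
  have hw : ∀ z ∈ φ.target, χ (f (φ.symm z)) = (hf.equiv z).1 := fun z hz ↦ hf.writtenInCharts hz
  have hxs : x ∈ φ.source := by
    rw [hφ, OpenPartialHomeomorph.extend_source]; exact hf.mem_domChart_source
  have hfxs : f x ∈ χ.source := by
    rw [hχ, OpenPartialHomeomorph.extend_source]; exact hf.mem_codChart_source
  have hxt : φ x ∈ φ.target := φ.map_source hxs
  have hφt : φ.target = hf.domChart.target := by
    rw [hφ, OpenPartialHomeomorph.extend_target]; simp
  have hφo : IsOpen φ.target := by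
    rw [hφ]; exact OpenPartialHomeomorph.isOpen_extend_target _
  have hφsrc : ∀ᶠ y in 𝓝 x, y ∈ φ.source := by
    rw [hφ, OpenPartialHomeomorph.extend_source]
    exact hf.domChart.open_source.mem_nhds hf.mem_domChart_source
  have hφd : ContMDiffAt 𝓘(ℝ, E) 𝓘(ℝ, E) ∞ φ x :=
    contMDiffAt_of_mem_maximalAtlas hf.domChart_mem_maximalAtlas hf.mem_domChart_source
  have hχd : ContMDiffAt 𝓘(ℝ, F) 𝓘(ℝ, F) ∞ χ (f x) :=
    contMDiffAt_of_mem_maximalAtlas hf.codChart_mem_maximalAtlas hf.mem_codChart_source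
  have hsd : ContMDiffOn 𝓘(ℝ, E) 𝓘(ℝ, E) ∞ φ.symm φ.target := by
    have htgt : hf.domChart.target = 𝓘(ℝ, E) '' hf.domChart.target := by simp
    rw [hφt, htgt]
    exact contMDiffOn_extend_symm hf.domChart_mem_maximalAtlas
  set u : E := modelDeriv E E φ x v with hu
  have hu1 : (hf.equiv u).1 = 0 := by
    have e1 : χ ∘ f =ᶠ[𝓝 x] (fun z ↦ (hf.equiv z).1) ∘ φ := by
      filter_upwards [hφsrc] with y hy
      have := hw _ (φ.map_source hy)
      rwa [φ.left_inv hy] at this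
    have hl : HasFDerivAt (fun z ↦ (hf.equiv z).1)
        ((ContinuousLinearMap.fst ℝ F _).comp hf.equiv.toContinuousLinearMap) (φ x) :=
      ((ContinuousLinearMap.fst ℝ F _).comp hf.equiv.toContinuousLinearMap).hasFDerivAt
    have h1 := modelDeriv_comp_apply (hχd.mdifferentiableAt (by simp))
      (hf.contMDiffAt.mdifferentiableAt (by simp)) v
    have h2 := modelDeriv_comp_apply (g := fun z ↦ (hf.equiv z).1)
      hl.differentiableAt.mdifferentiableAt
      (hφd.mdifferentiableAt (by simp)) v
    rw [modelDeriv_congr e1, h2, hv, map_zero, modelDeriv_eq_fderiv, hl.fderiv] at h1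
    exact h1
  obtain ⟨δ, hδ, hball⟩ := Metric.isOpen_iff.1 hφo _ hxt
  have hpos : 0 < ‖u‖ + 1 := by positivity
  set ε : ℝ := δ / (‖u‖ + 1) with hε
  have hεpos : 0 < ε := by positivity
  -- The sine keeps the curve in the chart for all times, so that it is defined and smooth on all of
  -- `ℝ`; its derivative at `0` is `ε • u`.
  let c : ℝ → E := fun t ↦ φ x + (Real.sin t * ε) • u
  have hct : ∀ t, c t ∈ φ.target := by
    intro t
    apply hball
    rw [Metric.mem_ball, dist_eq_norm]
    simp only [c, add_sub_cancel_left, norm_smul, norm_mul, Real.norm_eq_abs, abs_of_pos hεpos]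
    calc |Real.sin t| * ε * ‖u‖ ≤ 1 * ε * ‖u‖ := by
          gcongr; exact Real.abs_sin_le_one t
      _ < ε * (‖u‖ + 1) := by nlinarith
      _ = δ := by rw [hε]; field_simp
  have hcd : ContDiff ℝ ∞ c :=
    contDiff_const.add ((Real.contDiff_sin.mul contDiff_const).smul contDiff_const)
  have hc0 : c 0 = φ x := by simp [c]
  refine ⟨ε, fun t ↦ φ.symm (c t), hεpos.ne', ?_, ?_, ?_, ?_⟩
  · exact hsd.comp_contMDiff hcd.contMDiff hct
  · simp only [hc0]
    exact φ.left_inv hxs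
  · intro t
    have h1 := hw _ (hct t)
    have h0 := hw _ hxt
    have h2 : χ (f (φ.symm (c t))) = χ (f x) := by
      have h3 : (hf.equiv (c t)).1 = (hf.equiv (φ x)).1 := by
        simp [c, hu1]
      rw [φ.left_inv hxs] at h0
      rw [h1, h0, h3]
    refine χ.injOn ?_ hfxs h2
    have : φ.symm (c t) ∈ φ.source := φ.map_target (hct t)
    rw [hφ, OpenPartialHomeomorph.extend_source] at this
    rw [hχ, OpenPartialHomeomorph.extend_source]
    exact hf.source_subset_preimage_source this
  · have hsd0 : MDifferentiableAt 𝓘(ℝ, E) 𝓘(ℝ, E) φ.symm (φ x) :=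
      (hsd.contMDiffAt (hφo.mem_nhds hxt)).mdifferentiableAt (by simp)
    have hcder : HasDerivAt c (ε • u) 0 := by
      have h := (((Real.hasDerivAt_sin 0).mul_const ε).smul_const u).const_add (φ x)
      rwa [Real.cos_zero, one_mul] at h
    have h1 := modelDeriv_comp_apply (F := ℝ) (g := φ.symm) (f := c) (p := (0 : ℝ))
      (by rw [hc0]; exact hsd0) hcder.differentiableAt.mdifferentiableAt 1
    have h2 : modelDeriv ℝ E c 0 1 = ε • u := by
      rw [modelDeriv_eq_fderiv]
      simpa using hcder.deriv
    have h3 := modelDeriv_comp_apply (g := φ.symm) (f := φ) (p := x) hsd0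
      (hφd.mdifferentiableAt (by simp)) v
    have e2 : φ.symm ∘ φ =ᶠ[𝓝 x] id := by
      filter_upwards [hφsrc] with y hy using φ.left_inv hy
    rw [modelDeriv_congr e2, modelDeriv_id] at h3
    rw [h2, hc0, map_smul, hu, ← h3] at h1
    exact h1

end Submersion

/-! ### Derivatives of chart changes -/

section Charts

variable {F : Type*} [NormedAddCommGroup F] [NormedSpace ℝ F]
  {M : Type*} [TopologicalSpace M] [ChartedSpace F M] [IsManifold 𝓘(ℝ, F) ∞ M]
  {F' : Type*} [NormedAddCommGroup F'] [NormedSpace ℝ F']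
  {M' : Type*} [TopologicalSpace M'] [ChartedSpace F' M'] [IsManifold 𝓘(ℝ, F') ∞ M']

theorem contMDiffAt_chart (p : M) {x : M} (hx : x ∈ (extChartAt 𝓘(ℝ, F) p).source) :
    ContMDiffAt 𝓘(ℝ, F) 𝓘(ℝ, F) ∞ (extChartAt 𝓘(ℝ, F) p) x :=
  contMDiffAt_extChartAt' (by rwa [extChartAt_source] at hx)

theorem contMDiffAt_chart_symm (p : M) {y : F} (hy : y ∈ (extChartAt 𝓘(ℝ, F) p).target) :
    ContMDiffAt 𝓘(ℝ, F) 𝓘(ℝ, F) ∞ (extChartAt 𝓘(ℝ, F) p).symm y :=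
  (contMDiffOn_extChartAt_symm p).contMDiffAt ((isOpen_extChartAt_target p).mem_nhds hy)

theorem modelDeriv_chart_comp_symm (p : M) {x : M} (hx : x ∈ (extChartAt 𝓘(ℝ, F) p).source)
    (v : F) : modelDeriv F F (extChartAt 𝓘(ℝ, F) p) x
      (modelDeriv F F (extChartAt 𝓘(ℝ, F) p).symm (extChartAt 𝓘(ℝ, F) p x) v) = v := by
  set φ := extChartAt 𝓘(ℝ, F) p
  have ht := φ.map_source hx
  have h := modelDeriv_comp_apply (f := φ.symm) (g := φ) (p := φ x)
    (by rw [φ.left_inv hx]; exact (contMDiffAt_chart p hx).mdifferentiableAt (by simp))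
    ((contMDiffAt_chart_symm p ht).mdifferentiableAt (by simp)) v
  have e : φ ∘ φ.symm =ᶠ[𝓝 (φ x)] id := by
    filter_upwards [(isOpen_extChartAt_target p).mem_nhds ht] with y hy using φ.right_inv hy
  rw [modelDeriv_congr e, modelDeriv_id, φ.left_inv hx] at h
  exact h.symm

theorem modelDeriv_symm_comp_chart (p : M) {x : M} (hx : x ∈ (extChartAt 𝓘(ℝ, F) p).source)
    (v : F) : modelDeriv F F (extChartAt 𝓘(ℝ, F) p).symm (extChartAt 𝓘(ℝ, F) p x)
      (modelDeriv F F (extChartAt 𝓘(ℝ, F) p) x v) = v := by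
  set φ := extChartAt 𝓘(ℝ, F) p
  have ht := φ.map_source hx
  have h := modelDeriv_comp_apply (f := φ) (g := φ.symm) (p := x)
    ((contMDiffAt_chart_symm p ht).mdifferentiableAt (by simp))
    ((contMDiffAt_chart p hx).mdifferentiableAt (by simp)) v
  have e : φ.symm ∘ φ =ᶠ[𝓝 x] id := by
    filter_upwards [extChartAt_source_mem_nhds' hx] with y hy using φ.left_inv hy
  rw [modelDeriv_congr e, modelDeriv_id] at h
  exact h.symm

theorem modelDeriv_symm_self (p : M) :
    modelDeriv F F (extChartAt 𝓘(ℝ, F) p).symm (extChartAt 𝓘(ℝ, F) p p)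
      = ContinuousLinearMap.id ℝ F := by
  ext v
  have h := modelDeriv_symm_comp_chart p (mem_extChartAt_source (I := 𝓘(ℝ, F)) p) v
  rwa [modelDeriv_extChartAt_self] at h

/-- The derivative of a map written in charts. -/
theorem fderiv_in_charts {f : M → M'} (p : M) (p' : M') {y : F}
    (hy : y ∈ (extChartAt 𝓘(ℝ, F) p).target)
    (hy' : f ((extChartAt 𝓘(ℝ, F) p).symm y) ∈ (extChartAt 𝓘(ℝ, F') p').source)
    (hf : MDifferentiableAt 𝓘(ℝ, F) 𝓘(ℝ, F') f ((extChartAt 𝓘(ℝ, F) p).symm y)) (v : F) :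
    fderiv ℝ (fun z ↦ extChartAt 𝓘(ℝ, F') p' (f ((extChartAt 𝓘(ℝ, F) p).symm z))) y v
      = modelDeriv F' F' (extChartAt 𝓘(ℝ, F') p') (f ((extChartAt 𝓘(ℝ, F) p).symm y))
        (modelDeriv F F' f ((extChartAt 𝓘(ℝ, F) p).symm y)
          (modelDeriv F F (extChartAt 𝓘(ℝ, F) p).symm y v)) := by
  have h1 := (contMDiffAt_chart_symm p hy).mdifferentiableAt (by simp)
  have h2 := (contMDiffAt_chart p' hy').mdifferentiableAt (by simp)
  have h3 := modelDeriv_comp_apply (f := f ∘ (extChartAt 𝓘(ℝ, F) p).symm) h2 (hf.comp y h1) v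
  rw [modelDeriv_comp_apply hf h1, modelDeriv_eq_fderiv] at h3
  exact h3

end Charts

/-! ### Multiplication, conjugation and bracket of a Lie group in the chart at the neutral element
-/

section LieGroupCoordinates

variable (E : Type*) [NormedAddCommGroup E] [NormedSpace ℝ E]
  (G : Type*) [TopologicalSpace G] [ChartedSpace E G] [Group G]

/-- The chart of the Lie group `G` at the neutral element. -/
abbrev oneChart : PartialEquiv G E := extChartAt 𝓘(ℝ, E) (1 : G)

/-- The coordinates of the neutral element. -/
abbrev oneCoord : E := oneChart E G 1

/-- The multiplication in coordinates. -/
def mulCoord (p : E × E) : E := oneChart E G ((oneChart E G).symm p.1 * (oneChart E G).symm p.2)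

/-- The conjugation in coordinates. -/
def conjCoord (p : E × E) : E :=
  oneChart E G ((oneChart E G).symm p.1 * (oneChart E G).symm p.2 * ((oneChart E G).symm p.1)⁻¹)

variable {E G}

theorem oneChart_symm_oneCoord : (oneChart E G).symm (oneCoord E G) = 1 :=
  (oneChart E G).left_inv (mem_extChartAt_source _)

theorem eventually_mem_oneChart_target :
    ∀ᶠ x in 𝓝 (oneCoord E G), x ∈ (oneChart E G).target :=
  extChartAt_target_mem_nhds (I := 𝓘(ℝ, E)) (1 : G)

theorem mulCoord_one_left : ∀ᶠ x in 𝓝 (oneCoord E G), mulCoord E G (oneCoord E G, x) = x := by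
  filter_upwards [eventually_mem_oneChart_target] with x hx
  simp only [mulCoord]
  rw [oneChart_symm_oneCoord, one_mul, (oneChart E G).right_inv hx]

theorem mulCoord_one_right : ∀ᶠ x in 𝓝 (oneCoord E G), mulCoord E G (x, oneCoord E G) = x := by
  filter_upwards [eventually_mem_oneChart_target] with x hx
  simp only [mulCoord]
  rw [oneChart_symm_oneCoord, mul_one, (oneChart E G).right_inv hx]

theorem conjCoord_one_right (x : E) : conjCoord E G (x, oneCoord E G) = oneCoord E G := by
  simp only [conjCoord]
  rw [oneChart_symm_oneCoord, mul_one, mul_inv_cancel]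

/-- The Lie bracket of the Lie algebra of `G`, on the model space. -/
def lieModel (E : Type*) [NormedAddCommGroup E] [NormedSpace ℝ E]
    (G : Type*) [TopologicalSpace G] [ChartedSpace E G] [Group G] (X Z : E) : E :=
  (⁅(show LieAlg E G from X), (show LieAlg E G from Z)⁆ : LieAlg E G)

/-- The left-invariant vector field with value `X` at the neutral element, in coordinates. -/
def leftField (E : Type*) [NormedAddCommGroup E] [NormedSpace ℝ E]
    (G : Type*) [TopologicalSpace G] [ChartedSpace E G] [Group G] (X : E) (y : E) : E :=
  VectorField.mpullbackWithin 𝓘(ℝ, E) 𝓘(ℝ, E) (oneChart E G).symm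
    (mulInvariantVectorField (show LieAlg E G from X)) (Set.range 𝓘(ℝ, E)) y

variable [LieGroup 𝓘(ℝ, E) ∞ G]

theorem contMDiffAt_oneChart_symm_comp {E' : Type*} [NormedAddCommGroup E'] [NormedSpace ℝ E']
    {f : E' → E} {p : E'} (hf : ContDiffAt ℝ ∞ f p) (hp : f p = oneCoord E G) :
    ContMDiffAt 𝓘(ℝ, E') 𝓘(ℝ, E) ∞ (fun q ↦ (oneChart E G).symm (f q)) p :=
  ((contMDiffAt_chart_symm (1 : G) (mem_extChartAt_target (1 : G))).comp_of_eq hf.contMDiffAt hp)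

theorem contDiffAt_mulCoord : ContDiffAt ℝ ∞ (mulCoord E G) (oneCoord E G, oneCoord E G) := by
  have h1 := contMDiffAt_oneChart_symm_comp (E := E) (G := G)
    (contDiffAt_fst (𝕜 := ℝ) (n := ∞) (p := (oneCoord E G, oneCoord E G))) rfl
  have h2 := contMDiffAt_oneChart_symm_comp (E := E) (G := G)
    (contDiffAt_snd (𝕜 := ℝ) (n := ∞) (p := (oneCoord E G, oneCoord E G))) rfl
  refine contMDiffAt_iff_contDiffAt.1
    ((contMDiffAt_extChartAt (I := 𝓘(ℝ, E)) (x := (1 : G))).comp_of_eq (h1.mul h2) ?_)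
  simp only
  rw [oneChart_symm_oneCoord, one_mul]

theorem contDiffAt_conjCoord : ContDiffAt ℝ ∞ (conjCoord E G) (oneCoord E G, oneCoord E G) := by
  have h1 := contMDiffAt_oneChart_symm_comp (E := E) (G := G)
    (contDiffAt_fst (𝕜 := ℝ) (n := ∞) (p := (oneCoord E G, oneCoord E G))) rfl
  have h2 := contMDiffAt_oneChart_symm_comp (E := E) (G := G)
    (contDiffAt_snd (𝕜 := ℝ) (n := ∞) (p := (oneCoord E G, oneCoord E G))) rfl
  refine contMDiffAt_iff_contDiffAt.1
    ((contMDiffAt_extChartAt (I := 𝓘(ℝ, E)) (x := (1 : G))).comp_of_eq ((h1.mul h2).mul h1.inv) ?_)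
  simp only
  rw [oneChart_symm_oneCoord, one_mul, one_mul, inv_one]

theorem oneChart_symm_conjCoord : ∀ᶠ p in 𝓝 (oneCoord E G, oneCoord E G),
    (oneChart E G).symm (conjCoord E G p)
      = (oneChart E G).symm p.1 * (oneChart E G).symm p.2 * ((oneChart E G).symm p.1)⁻¹ := by
  have h1 := contMDiffAt_oneChart_symm_comp (E := E) (G := G)
    (contDiffAt_fst (𝕜 := ℝ) (n := ∞) (p := (oneCoord E G, oneCoord E G))) rfl
  have h2 := contMDiffAt_oneChart_symm_comp (E := E) (G := G)
    (contDiffAt_snd (𝕜 := ℝ) (n := ∞) (p := (oneCoord E G, oneCoord E G))) rfl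
  have h3 : ContinuousAt (fun p : E × E ↦ (oneChart E G).symm p.1 * (oneChart E G).symm p.2
      * ((oneChart E G).symm p.1)⁻¹) (oneCoord E G, oneCoord E G) :=
    ((h1.mul h2).mul h1.inv).continuousAt
  have h4 := h3.eventually (p := fun x ↦ x ∈ (oneChart E G).source) (by
    simp only
    rw [oneChart_symm_oneCoord, one_mul, one_mul, inv_one]
    exact extChartAt_source_mem_nhds (1 : G))
  filter_upwards [h4] with p hp using (oneChart E G).left_inv hp

theorem oneChart_symm_mulCoord : ∀ᶠ p in 𝓝 (oneCoord E G, oneCoord E G),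
    (oneChart E G).symm (mulCoord E G p)
      = (oneChart E G).symm p.1 * (oneChart E G).symm p.2 := by
  have h1 := contMDiffAt_oneChart_symm_comp (E := E) (G := G)
    (contDiffAt_fst (𝕜 := ℝ) (n := ∞) (p := (oneCoord E G, oneCoord E G))) rfl
  have h2 := contMDiffAt_oneChart_symm_comp (E := E) (G := G)
    (contDiffAt_snd (𝕜 := ℝ) (n := ∞) (p := (oneCoord E G, oneCoord E G))) rfl
  have h3 : ContinuousAt (fun p : E × E ↦ (oneChart E G).symm p.1 * (oneChart E G).symm p.2)
      (oneCoord E G, oneCoord E G) := (h1.mul h2).continuousAt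
  have h4 := h3.eventually (p := fun x ↦ x ∈ (oneChart E G).source) (by
    simp only
    rw [oneChart_symm_oneCoord, one_mul]
    exact extChartAt_source_mem_nhds (1 : G))
  filter_upwards [h4] with p hp using (oneChart E G).left_inv hp

theorem mulCoord_conjCoord : ∀ᶠ p in 𝓝 (oneCoord E G, oneCoord E G),
    mulCoord E G (conjCoord E G p, p.1) = mulCoord E G p := by
  filter_upwards [oneChart_symm_conjCoord] with p hp
  simp only [mulCoord]
  rw [hp, inv_mul_cancel_right]

/-- The adjoint action as an endomorphism of the model space. -/
def AdModel (a : G) : E →L[ℝ] E := modelDeriv E E (fun x : G ↦ a * x * a⁻¹) 1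

theorem contMDiff_conj (a : G) : ContMDiff 𝓘(ℝ, E) 𝓘(ℝ, E) ∞ (fun x : G ↦ a * x * a⁻¹) :=
  (contMDiff_const.mul contMDiff_id).mul contMDiff_const

theorem AdModel_eq_fderiv (x : E) (Z : E)
    (hc : DifferentiableAt ℝ (conjCoord E G) (x, oneCoord E G)) :
    AdModel ((oneChart E G).symm x) Z = fderiv ℝ (conjCoord E G) (x, oneCoord E G) (0, Z) := by
  set a := (oneChart E G).symm x
  have h1 : a * (oneChart E G).symm (oneCoord E G) * a⁻¹ = 1 := by
    rw [oneChart_symm_oneCoord]; group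
  have h := fderiv_in_charts (f := fun z : G ↦ a * z * a⁻¹) (1 : G) (1 : G)
    (mem_extChartAt_target (1 : G)) (by rw [h1]; exact mem_extChartAt_source _)
    ((contMDiff_conj a).mdifferentiableAt (by simp)) Z
  have h2 := (fderiv_comp_right hc).fderiv
  have h3 := DFunLike.congr_fun h2 Z
  simp only [ContinuousLinearMap.comp_apply, ContinuousLinearMap.inr_apply] at h3
  rw [← h3]
  refine Eq.trans ?_ h.symm
  rw [modelDeriv_symm_self, ContinuousLinearMap.id_apply, oneChart_symm_oneCoord]
  simp only [mul_one, mul_inv_cancel]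
  rw [modelDeriv_extChartAt_self]
  rfl

/-- In the chart, the left-invariant field with value `X` is the derivative of the multiplication in
its second variable, in the direction `X`. The bracket of two such fields antisymmetrises the mixed
second derivative. -/
theorem lieModel_eq_localBracket (X Z : E) :
    lieModel E G X Z = localBracket (mulCoord E G) (oneCoord E G) X Z := by
  have hinv : ∀ X : E, leftField E G X
      =ᶠ[𝓝 (oneCoord E G)] fun y ↦ fderiv ℝ (mulCoord E G) (y, oneCoord E G) (0, X) := by
    intro X
    have c1 : ContinuousAt (fun x : E ↦ (x, oneCoord E G)) (oneCoord E G) := by fun_prop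
    filter_upwards [eventually_mem_oneChart_target,
      c1.eventually (contDiffAt_two_eventually contDiffAt_mulCoord)] with y hy hd
    have h1 : ((oneChart E G).symm y) * (oneChart E G).symm (oneCoord E G)
        = (oneChart E G).symm y := by
      rw [oneChart_symm_oneCoord, mul_one]
    have hsrc : (oneChart E G).symm y ∈ (oneChart E G).source := (oneChart E G).map_target hy
    have h := fderiv_in_charts (f := fun z : G ↦ (oneChart E G).symm y * z) (1 : G) (1 : G)
      (mem_extChartAt_target (1 : G)) (by rw [h1]; exact hsrc)
      ((contMDiff_mul_left).mdifferentiableAt (n := ∞) (by simp)) X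
    have h2 := (fderiv_comp_right (hd.differentiableAt (by simp))).fderiv
    have h3 := DFunLike.congr_fun h2 X
    simp only [ContinuousLinearMap.comp_apply, ContinuousLinearMap.inr_apply] at h3
    rw [← h3]
    refine Eq.trans ?_ h.symm
    rw [modelDeriv_symm_self, ContinuousLinearMap.id_apply, oneChart_symm_oneCoord, mul_one]
    rw [leftField, VectorField.mpullbackWithin_apply, modelWithCornersSelf_coe, Set.range_id,
      mfderivWithin_univ]
    have hA : (modelDeriv E E (oneChart E G).symm y).inverse
        = modelDeriv E E (oneChart E G) ((oneChart E G).symm y) := by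
      apply ContinuousLinearMap.inverse_eq
      · ext v
        have := modelDeriv_symm_comp_chart (1 : G) hsrc v
        rwa [(oneChart E G).right_inv hy] at this
      · ext v
        have := modelDeriv_chart_comp_symm (1 : G) hsrc v
        rwa [(oneChart E G).right_inv hy] at this
    exact DFunLike.congr_fun hA _
  have hd2 : ContDiffAt ℝ 2 (mulCoord E G) (oneCoord E G, oneCoord E G) :=
    contDiffAt_two contDiffAt_mulCoord
  have hval : ∀ X, fderiv ℝ (mulCoord E G) (oneCoord E G, oneCoord E G) (0, X) = X := by
    intro X
    have h2 := fderiv_comp_right (hd2.differentiableAt (by simp))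
    have h3 := h2.unique ((hasFDerivAt_id _).congr_of_eventuallyEq mulCoord_one_left)
    simpa using DFunLike.congr_fun h3 X
  have hder : ∀ X Z, fderiv ℝ (fun y ↦ fderiv ℝ (mulCoord E G) (y, oneCoord E G) (0, X))
      (oneCoord E G) Z
      = fderiv ℝ (fderiv ℝ (mulCoord E G)) (oneCoord E G, oneCoord E G) (Z, 0) (0, X) := by
    intro X Z
    have h1 := (fderiv_comp_left (differentiableAt_fderiv hd2)).clm_apply
      (hasFDerivAt_const ((0, X) : E × E) (oneCoord E G))
    rw [h1.fderiv]
    simp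
  have hb : lieModel E G X Z = ContinuousLinearMap.inverse (modelDeriv E E (oneChart E G) 1)
      (VectorField.lieBracketWithin ℝ (leftField E G X) (leftField E G Z)
        ((oneChart E G).symm ⁻¹' Set.univ ∩ Set.range 𝓘(ℝ, E)) (oneCoord E G)) :=
    VectorField.mlieBracketWithin_apply
  rw [hb, modelDeriv_extChartAt_self, ContinuousLinearMap.inverse_id, modelWithCornersSelf_coe,
    Set.range_id, Set.preimage_univ, Set.univ_inter, VectorField.lieBracketWithin_univ,
    Filter.EventuallyEq.lieBracket_vectorField_eq (hinv X) (hinv Z)]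
  rw [VectorField.lieBracket, hval, hval, hder, hder]
  rfl

/-- The differential of the adjoint representation is the Lie bracket. -/
theorem hasFDerivAt_AdModel (Z : E) : ∃ D : E →L[ℝ] E,
    HasFDerivAt (fun x ↦ AdModel ((oneChart E G).symm x) Z) D (oneCoord E G) ∧
      ∀ X, D X = lieModel E G X Z := by
  obtain ⟨D, hD, hDX⟩ := hasFDerivAt_localAd (μ := mulCoord E G) (c := conjCoord E G)
    contDiffAt_mulCoord contDiffAt_conjCoord mulCoord_one_right mulCoord_one_left
    (Filter.Eventually.of_forall conjCoord_one_right) mulCoord_conjCoord Z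
  refine ⟨D, hD.congr_of_eventuallyEq ?_, fun X ↦ by rw [hDX, lieModel_eq_localBracket]⟩
  have c1 : ContinuousAt (fun x : E ↦ (x, oneCoord E G)) (oneCoord E G) := by fun_prop
  filter_upwards [c1.eventually (contDiffAt_two_eventually contDiffAt_conjCoord)] with x hd
  exact AdModel_eq_fderiv x Z (hd.differentiableAt (by simp))

end LieGroupCoordinates

/-! ### The adjoint representation and invariant subspaces and forms -/

section AdjointAction

variable {E : Type*} [NormedAddCommGroup E] [NormedSpace ℝ E]
  {G : Type*} [TopologicalSpace G] [ChartedSpace E G] [Group G]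

theorem AdModel_one (X : E) : AdModel (1 : G) X = X := by
  have e : (fun x : G ↦ 1 * x * 1⁻¹) = id := by ext x; simp
  rw [AdModel, e, modelDeriv_id]
  rfl

variable [LieGroup 𝓘(ℝ, E) ∞ G]

theorem AdModel_mul (a b : G) (X : E) :
    AdModel (a * b) X = AdModel (E := E) a (AdModel b X) := by
  have e : (fun x : G ↦ a * b * x * (a * b)⁻¹) = (fun x ↦ a * x * a⁻¹) ∘ fun x ↦ b * x * b⁻¹ := by
    ext x; simp only [Function.comp_apply]; group
  have h := modelDeriv_comp_apply (f := fun x : G ↦ b * x * b⁻¹) (g := fun x : G ↦ a * x * a⁻¹)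
    (p := 1) ((contMDiff_conj (E := E) a).mdifferentiableAt (by simp))
    ((contMDiff_conj (E := E) b).mdifferentiableAt (by simp)) X
  rw [← e] at h
  simp only [mul_one, mul_inv_cancel] at h
  exact h

theorem AdModel_AdModel_inv (a : G) (X : E) : AdModel a (AdModel a⁻¹ X) = X := by
  rw [← AdModel_mul, mul_inv_cancel, AdModel_one]

/-- Differentiate `Ad a (Ad x Z) = Ad (a x a⁻¹) (Ad a Z)` in `x` at the neutral element. -/
theorem AdModel_lieModel (a : G) (X Z : E) :
    AdModel a (lieModel E G X Z) = lieModel E G (AdModel a X) (AdModel a Z) := by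
  obtain ⟨D, hD, hDX⟩ := hasFDerivAt_AdModel (E := E) (G := G) Z
  obtain ⟨D', hD', hDX'⟩ := hasFDerivAt_AdModel (E := E) (G := G) (AdModel a Z)
  let κ : E → E := fun x ↦ oneChart E G (a * (oneChart E G).symm x * a⁻¹)
  have h1 : a * (oneChart E G).symm (oneCoord E G) * a⁻¹ = 1 := by
    rw [oneChart_symm_oneCoord]; group
  have hκs : ContMDiffAt 𝓘(ℝ, E) 𝓘(ℝ, E) ∞ (fun x ↦ a * (oneChart E G).symm x * a⁻¹)
      (oneCoord E G) :=
    (contMDiff_conj a).contMDiffAt.comp _ (contMDiffAt_chart_symm (1 : G) (mem_extChartAt_target _))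
  have hκd : DifferentiableAt ℝ κ (oneCoord E G) := by
    have : ContMDiffAt 𝓘(ℝ, E) 𝓘(ℝ, E) ∞ κ (oneCoord E G) :=
      (contMDiffAt_extChartAt (I := 𝓘(ℝ, E)) (x := (1 : G))).comp_of_eq hκs h1
    exact (contMDiffAt_iff_contDiffAt.1 this).differentiableAt (by simp)
  have hκ0 : κ (oneCoord E G) = oneCoord E G := by simp only [κ, h1]
  have hκ' : ∀ X, fderiv ℝ κ (oneCoord E G) X = AdModel a X := by
    intro X
    have h := fderiv_in_charts (f := fun z : G ↦ a * z * a⁻¹) (1 : G) (1 : G)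
      (mem_extChartAt_target (1 : G)) (by rw [h1]; exact mem_extChartAt_source _)
      ((contMDiff_conj a).mdifferentiableAt (by simp)) X
    refine h.trans ?_
    rw [modelDeriv_symm_self, ContinuousLinearMap.id_apply, oneChart_symm_oneCoord]
    simp only [mul_one, mul_inv_cancel]
    rw [modelDeriv_extChartAt_self]
    rfl
  have hl := (AdModel a).hasFDerivAt.comp (oneCoord E G) hD
  have hr : HasFDerivAt ((fun x ↦ AdModel ((oneChart E G).symm x) (AdModel a Z)) ∘ κ) _
    (oneCoord E G) := HasFDerivAt.comp _ (by rw [hκ0]; exact hD') hκd.hasFDerivAt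
  have hsrc : ∀ᶠ x in 𝓝 (oneCoord E G), a * (oneChart E G).symm x * a⁻¹ ∈ (oneChart E G).source :=
    hκs.continuousAt.eventually (by simp only [h1]; exact extChartAt_source_mem_nhds (1 : G))
  have he : AdModel a ∘ (fun x ↦ AdModel ((oneChart E G).symm x) Z) =ᶠ[𝓝 (oneCoord E G)]
      (fun x ↦ AdModel ((oneChart E G).symm x) (AdModel a Z)) ∘ κ := by
    filter_upwards [hsrc] with x hx
    simp only [Function.comp_apply, κ]
    rw [(oneChart E G).left_inv hx, ← AdModel_mul, ← AdModel_mul]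
    congr 1
    group
  have := DFunLike.congr_fun (hl.unique (hr.congr_of_eventuallyEq he)) X
  simpa [hDX, hDX', hκ'] using this

/-- The chain rule for `hasFDerivAt_AdModel`, stated along curves because `subgroupLieAlgebra`
consists of velocities of curves. -/
theorem hasDerivAt_AdModel_curve {γ : ℝ → G} (hγ : ContMDiff 𝓘(ℝ, ℝ) 𝓘(ℝ, E) ∞ γ) (h0 : γ 0 = 1)
    (Z : E) : HasDerivAt (fun t ↦ AdModel (γ t) Z) (lieModel E G (modelDeriv ℝ E γ 0 1) Z) 0 := by
  obtain ⟨D, hD, hDX⟩ := hasFDerivAt_AdModel (E := E) (G := G) Z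
  have hψ := contMDiffAt_extChartAt (I := 𝓘(ℝ, E)) (n := ∞) (x := (1 : G))
  have hc : ContMDiffAt 𝓘(ℝ, ℝ) 𝓘(ℝ, E) ∞ (oneChart E G ∘ γ) 0 :=
    hψ.comp_of_eq hγ.contMDiffAt h0
  have hcd := (contMDiffAt_iff_contDiffAt.1 hc).differentiableAt (by simp)
  have hcv : fderiv ℝ (oneChart E G ∘ γ) 0 1 = modelDeriv ℝ E γ 0 1 := by
    have := modelDeriv_comp_apply (f := γ) (g := oneChart E G) (p := (0 : ℝ))
      (by rw [h0]; exact hψ.mdifferentiableAt (by simp)) (hγ.mdifferentiableAt (by simp)) 1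
    rw [modelDeriv_eq_fderiv, h0, modelDeriv_extChartAt_self] at this
    exact this
  have h1 : HasFDerivAt ((fun x ↦ AdModel ((oneChart E G).symm x) Z) ∘ (oneChart E G ∘ γ))
    (D.comp (fderiv ℝ (oneChart E G ∘ γ) 0)) 0 :=
    HasFDerivAt.comp _ (by rw [Function.comp_apply, h0]; exact hD) hcd.hasFDerivAt
  have h2 := h1.hasDerivAt
  rw [ContinuousLinearMap.comp_apply, hDX, hcv] at h2
  refine h2.congr_of_eventuallyEq ?_
  have hsrc : ∀ᶠ t in 𝓝 (0 : ℝ), γ t ∈ (oneChart E G).source :=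
    hγ.continuous.continuousAt.eventually (by rw [h0]; exact extChartAt_source_mem_nhds (1 : G))
  filter_upwards [hsrc] with t ht
  simp only [Function.comp_apply]
  rw [(oneChart E G).left_inv ht]

/-- The bracket is the limit of the difference quotients of `Ad (γ t) Y`; these lie in `V`, which is
closed, being finite-dimensional. -/
theorem lie_mem_of_isAdInvariant [FiniteDimensional ℝ E] {S : Subgroup G}
    {V : Submodule ℝ (LieAlg E G)} (hV : IsAdInvariant S V)
    {X Y : LieAlg E G} (hX : X ∈ subgroupLieAlgebra S) (hY : Y ∈ V) : ⁅X, Y⁆ ∈ V := by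
  obtain ⟨γ, hγ, h0, hS, rfl⟩ := hX
  have hd := hasDerivAt_AdModel_curve hγ h0 Y
  let V' : Submodule ℝ E := V
  have hcl : IsClosed (V' : Set E) := Submodule.closed_of_finiteDimensional V'
  have hslope := hd.tendsto_slope
  refine hcl.mem_of_tendsto hslope (Filter.Eventually.of_forall fun t ↦ ?_)
  rw [slope_def_module]
  refine V'.smul_mem _ (V'.sub_mem (hV _ (hS t) _ hY) ?_)
  exact hV _ (hS 0) _ hY

/-- Conjugate the curve by `a`. -/
theorem isAdInvariant_subgroupLieAlgebra (S : Subgroup G) :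
    IsAdInvariant (E := E) S (subgroupLieAlgebra S) := by
  rintro a ha _ ⟨γ, hγ, h0, hS, rfl⟩
  refine ⟨fun t ↦ a * γ t * a⁻¹, (contMDiff_conj a).comp hγ, by simp [h0],
    fun t ↦ S.mul_mem (S.mul_mem ha (hS t)) (S.inv_mem ha), ?_⟩
  have h := modelDeriv_comp_apply (f := γ) (g := fun x : G ↦ a * x * a⁻¹) (p := (0 : ℝ))
    ((contMDiff_conj (E := E) a).mdifferentiableAt (by simp)) (hγ.mdifferentiableAt (by simp)) 1
  rw [h0] at h
  exact h

/-- The derivative at the neutral element of the constant function `x ↦ Q (Ad x Y) (Ad x Z)`. -/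
theorem lieModel_skew [FiniteDimensional ℝ E] (Q : E →ₗ[ℝ] E →ₗ[ℝ] ℝ)
    (hQ : ∀ (a : G) X Y, Q (AdModel a X) (AdModel a Y) = Q X Y) (X Y Z : E) :
    Q (lieModel E G X Y) Z = -Q Y (lieModel E G X Z) := by
  let Qc : E →L[ℝ] E →L[ℝ] ℝ := LinearMap.toContinuousLinearMap
    ((LinearMap.toContinuousLinearMap : (E →ₗ[ℝ] ℝ) ≃ₗ[ℝ] (E →L[ℝ] ℝ)).toLinearMap ∘ₗ Q)
  obtain ⟨D, hD, hDX⟩ := hasFDerivAt_AdModel (E := E) (G := G) Y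
  obtain ⟨D', hD', hDX'⟩ := hasFDerivAt_AdModel (E := E) (G := G) Z
  have h1 := (Qc.hasFDerivAt.comp (oneCoord E G) hD).clm_apply hD'
  have he : (fun x ↦ (Qc ∘ fun x ↦ AdModel ((oneChart E G).symm x) Y) x
      (AdModel ((oneChart E G).symm x) Z)) = fun _ ↦ Q Y Z := by
    ext x
    exact hQ _ _ _
  rw [he] at h1
  have h2 := DFunLike.congr_fun (h1.unique (hasFDerivAt_const _ _)) X
  simp only [Function.comp_apply, add_apply, ContinuousLinearMap.comp_apply, zero_apply,
    ContinuousLinearMap.flip_apply, hDX, hDX', oneChart_symm_oneCoord, AdModel_one] at h2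
  have h3 : Q Y (lieModel E G X Z) + Q (lieModel E G X Y) Z = 0 := h2
  linarith

theorem IsAdInvariantScalarProduct.lie_left [FiniteDimensional ℝ E]
    {Q : LinearMap.BilinForm ℝ (LieAlg E G)} (hQ : IsAdInvariantScalarProduct Q)
    (X Y Z : LieAlg E G) : Q ⁅X, Y⁆ Z = -Q Y ⁅X, Z⁆ :=
  lieModel_skew (G := G) (show E →ₗ[ℝ] E →ₗ[ℝ] ℝ from Q) hQ.inv X Y Z

end AdjointAction

/-! ### The action of the group on the homogeneous space -/

section Homogeneous

variable {E : Type*} [NormedAddCommGroup E] [NormedSpace ℝ E]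
  {G : Type*} [TopologicalSpace G] [ChartedSpace E G] [Group G]
  {H : Subgroup G} {F : Type*} [NormedAddCommGroup F] [NormedSpace ℝ F]
  [ChartedSpace F (G ⧸ H)]

/-- The differential at the neutral element of the projection `G → G/H`. -/
def projDeriv (E : Type*) [NormedAddCommGroup E] [NormedSpace ℝ E]
    {G : Type*} [TopologicalSpace G] [ChartedSpace E G] [Group G] (H : Subgroup G)
    (F : Type*) [NormedAddCommGroup F] [NormedSpace ℝ F] [ChartedSpace F (G ⧸ H)] : E →L[ℝ] F :=
  modelDeriv E F (fun x : G ↦ (x : G ⧸ H)) 1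

theorem surjective_projDeriv
    (hproj : Manifold.IsSubmersion 𝓘(ℝ, E) 𝓘(ℝ, F) ∞ (fun x : G ↦ (x : G ⧸ H))) :
    Function.Surjective (projDeriv E H F) :=
  (hproj.isSubmersionAt 1).surjective_modelDeriv

/-- The differential of the action of `a` on `G/H`. -/
def actDeriv (F : Type*) [NormedAddCommGroup F] [NormedSpace ℝ F]
    {G : Type*} [TopologicalSpace G] [Group G] {H : Subgroup G} [ChartedSpace F (G ⧸ H)]
    (a : G) (p : G ⧸ H) : F →L[ℝ] F :=
  modelDeriv F F (fun x : G ⧸ H ↦ a • x) p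

theorem actDeriv_one (p : G ⧸ H) (v : F) : actDeriv F (1 : G) p v = v := by
  have e : (fun x : G ⧸ H ↦ (1 : G) • x) = id := by ext x; simp
  rw [actDeriv, e, modelDeriv_id]
  rfl

variable [LieGroup 𝓘(ℝ, E) ∞ G]

/-- With a local section `s` of the projection, `f x • g x` is the class of `f x * s (g x)`. This
gives joint smoothness of the action. -/
theorem contMDiffAt_smul_quotient
    (hproj : Manifold.IsSubmersion 𝓘(ℝ, E) 𝓘(ℝ, F) ∞ (fun x : G ↦ (x : G ⧸ H)))
    {E' : Type*} [NormedAddCommGroup E'] [NormedSpace ℝ E']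
    {N : Type*} [TopologicalSpace N] [ChartedSpace E' N] {f : N → G} {g : N → G ⧸ H} {n : N}
    (hf : ContMDiffAt 𝓘(ℝ, E') 𝓘(ℝ, E) ∞ f n) (hg : ContMDiffAt 𝓘(ℝ, E') 𝓘(ℝ, F) ∞ g n) :
    ContMDiffAt 𝓘(ℝ, E') 𝓘(ℝ, F) ∞ (fun x ↦ f x • g x) n := by
  obtain ⟨b, hb⟩ := QuotientGroup.mk_surjective (g n)
  obtain ⟨s, hs, hsb, hps⟩ := (hproj.isSubmersionAt b).exists_local_section
  rw [hb] at hs hps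
  have h1 : ContMDiffAt 𝓘(ℝ, E') 𝓘(ℝ, F) ∞ (fun x ↦ ((f x * s (g x) : G) : G ⧸ H)) n :=
    hproj.contMDiff.contMDiffAt.comp n (hf.mul (hs.comp n hg))
  refine h1.congr_of_eventuallyEq ?_
  filter_upwards [hg.continuousAt.eventually hps] with x hx
  conv_lhs => rw [← hx]
  rfl

/-- A curve in `H` projects to a constant; conversely, a kernel vector is up to scale the velocity
of a curve in the fibre over the base point, which is `H`. -/
theorem mem_subgroupLieAlgebra_iff_projDeriv
    (hproj : Manifold.IsSubmersion 𝓘(ℝ, E) 𝓘(ℝ, F) ∞ (fun x : G ↦ (x : G ⧸ H)))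
    (X : LieAlg E G) : X ∈ subgroupLieAlgebra H ↔ projDeriv E H F X = 0 := by
  constructor
  · rintro ⟨γ, hγ, h0, hS, rfl⟩
    have h := modelDeriv_comp_apply (f := γ) (g := fun x : G ↦ (x : G ⧸ H)) (p := (0 : ℝ))
      (hproj.contMDiff.mdifferentiableAt (by simp)) (hγ.mdifferentiableAt (by simp)) 1
    have e : (fun x : G ↦ (x : G ⧸ H)) ∘ γ = fun _ ↦ ((1 : G) : G ⧸ H) := by
      ext t
      exact (QuotientGroup.eq.2 (by simpa using hS t)).symm
    rw [e, modelDeriv_const, h0] at h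
    exact h.symm
  · intro hX
    obtain ⟨ε, γ, hε, hγ, h0, hf, hd⟩ := (hproj.isSubmersionAt 1).exists_curve_in_fibre hX
    have hmem : ∀ t, γ t ∈ H := fun t ↦ by
      have := QuotientGroup.eq.1 (hf t).symm
      simpa using this
    have h1 : (ε • X : LieAlg E G) ∈ subgroupLieAlgebra H := ⟨γ, hγ, h0, hmem, hd⟩
    have h2 := (subgroupLieAlgebra H).smul_mem ε⁻¹ h1
    rwa [smul_smul, inv_mul_cancel₀ hε, one_smul] at h2

theorem contMDiff_smul_quotient
    (hproj : Manifold.IsSubmersion 𝓘(ℝ, E) 𝓘(ℝ, F) ∞ (fun x : G ↦ (x : G ⧸ H))) (a : G) :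
    ContMDiff 𝓘(ℝ, F) 𝓘(ℝ, F) ∞ (fun x : G ⧸ H ↦ a • x) := fun _ ↦
  contMDiffAt_smul_quotient hproj contMDiffAt_const contMDiffAt_id

theorem actDeriv_mul
    (hproj : Manifold.IsSubmersion 𝓘(ℝ, E) 𝓘(ℝ, F) ∞ (fun x : G ↦ (x : G ⧸ H))) (a b : G)
    (p : G ⧸ H) (v : F) : actDeriv F (a * b) p v = actDeriv F a (b • p) (actDeriv F b p v) := by
  have e : (fun x : G ⧸ H ↦ (a * b) • x) = (fun x ↦ a • x) ∘ fun x ↦ b • x := by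
    ext x; simp only [Function.comp_apply, mul_smul]
  rw [actDeriv, e]
  exact modelDeriv_comp_apply ((contMDiff_smul_quotient hproj a).mdifferentiableAt (by simp))
    ((contMDiff_smul_quotient hproj b).mdifferentiableAt (by simp)) v

/-- For `a ∈ H` the classes of `a x a⁻¹` and `a x` coincide, so the projection intertwines
conjugation by `a` with the action of `a`. -/
theorem projDeriv_AdModel
    (hproj : Manifold.IsSubmersion 𝓘(ℝ, E) 𝓘(ℝ, F) ∞ (fun x : G ↦ (x : G ⧸ H))) {a : G}
    (ha : a ∈ H) (X : E) :
    projDeriv E H F (AdModel a X) = actDeriv F a ((1 : G) : G ⧸ H) (projDeriv E H F X) := by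
  have e : (fun x : G ↦ (x : G ⧸ H)) ∘ (fun x ↦ a * x * a⁻¹)
      = (fun x : G ⧸ H ↦ a • x) ∘ fun x : G ↦ (x : G ⧸ H) := by
    ext x
    simp only [Function.comp_apply]
    exact (QuotientGroup.eq.2 (by simpa [mul_assoc] using ha) :
      ((a * x * a⁻¹ : G) : G ⧸ H) = ((a * x : G) : G ⧸ H))
  have h1 := modelDeriv_comp_apply (f := fun x : G ↦ a * x * a⁻¹) (g := fun x : G ↦ (x : G ⧸ H))
    (p := 1) (hproj.contMDiff.mdifferentiableAt (by simp))
    ((contMDiff_conj (E := E) a).mdifferentiableAt (by simp)) X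
  have h2 := modelDeriv_comp_apply (f := fun x : G ↦ (x : G ⧸ H)) (g := fun x : G ⧸ H ↦ a • x)
    (p := 1) ((contMDiff_smul_quotient hproj a).mdifferentiableAt (by simp))
    (hproj.contMDiff.mdifferentiableAt (by simp)) X
  rw [e, h2] at h1
  simp only [mul_one, mul_inv_cancel] at h1
  exact h1.symm

end Homogeneous

/-! ### Fundamental fields near an arbitrary point and the Ricci curvature -/

section HomogeneousRicci

variable {E : Type*} [NormedAddCommGroup E] [NormedSpace ℝ E]
  {G : Type*} [TopologicalSpace G] [ChartedSpace E G] [Group G]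
  {H : Subgroup G} {F : Type*} [NormedAddCommGroup F] [NormedSpace ℝ F]
  [ChartedSpace F (G ⧸ H)]

/-- The base point of `G/H`. -/
abbrev basePt (H : Subgroup G) : G ⧸ H := ((1 : G) : G ⧸ H)

theorem IsInvariantField.modelForm_eq {B : BilinField F (G ⧸ H)} (hB : IsInvariantField G B)
    (a : G) (p : G ⧸ H) (u v : F) :
    modelForm B (a • p) (actDeriv F a p u) (actDeriv F a p v) = modelForm B p u v :=
  hB a p u v

/-- The action of the Lie group `G` on `G/H`, conjugated by `a`, in coordinates at `a • o`. -/
def actCoord (E : Type*) [NormedAddCommGroup E] [NormedSpace ℝ E] [ChartedSpace E G]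
    (H : Subgroup G) (F : Type*) [NormedAddCommGroup F] [NormedSpace ℝ F]
    [ChartedSpace F (G ⧸ H)] (a : G) (p : E × F) : F :=
  extChartAt 𝓘(ℝ, F) (a • basePt H) ((a * (oneChart E G).symm p.1 * a⁻¹) •
    (extChartAt 𝓘(ℝ, F) (a • basePt H)).symm p.2)

theorem fundField_add {E F : Type*} [NormedAddCommGroup E] [NormedSpace ℝ E]
    [NormedAddCommGroup F] [NormedSpace ℝ F] (α : E × F → F) (x₀ X Y : E) :
    fundField α x₀ (X + Y) = fundField α x₀ X + fundField α x₀ Y := by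
  ext y
  have h : ((X + Y, 0) : E × F) = (X, 0) + (Y, 0) := by simp
  simp only [fundField, h, map_add, Pi.add_apply]

theorem fundField_smul {E F : Type*} [NormedAddCommGroup E] [NormedSpace ℝ E]
    [NormedAddCommGroup F] [NormedSpace ℝ F] (α : E × F → F) (x₀ : E) (c : ℝ) (X : E) :
    fundField α x₀ (c • X) = c • fundField α x₀ X := by
  ext y
  have h : ((c • X, 0) : E × F) = c • (X, 0) := by simp
  simp only [fundField, h, map_smul, Pi.smul_apply]

/-- The fundamental vector fields of the action in coordinates at `a • o`. -/
def actField (E : Type*) [NormedAddCommGroup E] [NormedSpace ℝ E] [ChartedSpace E G]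
    (H : Subgroup G) (F : Type*) [NormedAddCommGroup F] [NormedSpace ℝ F]
    [ChartedSpace F (G ⧸ H)] (a : G) : LieAlg E G →ₗ[ℝ] F → F where
  toFun X := fundField (actCoord E H F a) (oneCoord E G) X
  map_add' X Y := fundField_add (E := E) _ _ X Y
  map_smul' c X := fundField_smul (E := E) _ _ c X

theorem actCoord_aux_base (a : G) : (a * (oneChart E G).symm (oneCoord E G) * a⁻¹) •
      (extChartAt 𝓘(ℝ, F) (a • basePt H)).symm
        (extChartAt 𝓘(ℝ, F) (a • basePt H) (a • basePt H)) = a • basePt H := by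
  rw [oneChart_symm_oneCoord, extChartAt_to_inv]
  simp

theorem actCoord_one (a : G) :
    ∀ᶠ y in 𝓝 (extChartAt 𝓘(ℝ, F) (a • basePt H) (a • basePt H)),
      actCoord E H F a (oneCoord E G, y) = y := by
  filter_upwards [extChartAt_target_mem_nhds (I := 𝓘(ℝ, F)) (a • basePt H)] with y hy
  simp only [actCoord]
  rw [oneChart_symm_oneCoord]
  simp only [mul_one, mul_inv_cancel, one_smul]
  exact (extChartAt 𝓘(ℝ, F) (a • basePt H)).right_inv hy

variable [LieGroup 𝓘(ℝ, E) ∞ G] [IsManifold 𝓘(ℝ, F) ∞ (G ⧸ H)]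

theorem contMDiffAt_actCoord_aux
    (hproj : Manifold.IsSubmersion 𝓘(ℝ, E) 𝓘(ℝ, F) ∞ (fun x : G ↦ (x : G ⧸ H))) (a : G) :
    ContMDiffAt 𝓘(ℝ, E × F) 𝓘(ℝ, F) ∞ (fun p : E × F ↦ (a * (oneChart E G).symm p.1 * a⁻¹) •
      (extChartAt 𝓘(ℝ, F) (a • basePt H)).symm p.2)
      (oneCoord E G, extChartAt 𝓘(ℝ, F) (a • basePt H) (a • basePt H)) := by
  refine contMDiffAt_smul_quotient hproj ?_ ?_
  · exact (contMDiff_conj a).contMDiffAt.comp _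
      (contMDiffAt_oneChart_symm_comp (f := Prod.fst) contDiffAt_fst rfl)
  · exact (contMDiffAt_chart_symm _ (mem_extChartAt_target _)).comp_of_eq
      (contDiffAt_snd (𝕜 := ℝ) (n := ∞)).contMDiffAt rfl

theorem contDiffAt_actCoord
    (hproj : Manifold.IsSubmersion 𝓘(ℝ, E) 𝓘(ℝ, F) ∞ (fun x : G ↦ (x : G ⧸ H))) (a : G) :
    ContDiffAt ℝ ∞ (actCoord E H F a)
      (oneCoord E G, extChartAt 𝓘(ℝ, F) (a • basePt H) (a • basePt H)) :=
  contMDiffAt_iff_contDiffAt.1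
    ((contMDiffAt_extChartAt (I := 𝓘(ℝ, F)) (x := a • basePt H)).comp_of_eq
      (contMDiffAt_actCoord_aux hproj a) (actCoord_aux_base a))

theorem eventually_actCoord_source
    (hproj : Manifold.IsSubmersion 𝓘(ℝ, E) 𝓘(ℝ, F) ∞ (fun x : G ↦ (x : G ⧸ H))) (a : G) :
    ∀ᶠ p : E × F in 𝓝 (oneCoord E G, extChartAt 𝓘(ℝ, F) (a • basePt H) (a • basePt H)),
      (a * (oneChart E G).symm p.1 * a⁻¹) • (extChartAt 𝓘(ℝ, F) (a • basePt H)).symm p.2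
        ∈ (extChartAt 𝓘(ℝ, F) (a • basePt H)).source :=
  (contMDiffAt_actCoord_aux hproj a).continuousAt.eventually
    (by simp only [actCoord_aux_base]; exact extChartAt_source_mem_nhds _)

/-- Conjugation by `a` is a homomorphism, so the conjugated action is still an action of the same
local group. -/
theorem actCoord_mulCoord
    (hproj : Manifold.IsSubmersion 𝓘(ℝ, E) 𝓘(ℝ, F) ∞ (fun x : G ↦ (x : G ⧸ H))) (a : G) :
    ∀ᶠ p : (E × E) × F in 𝓝 ((oneCoord E G, oneCoord E G),
        extChartAt 𝓘(ℝ, F) (a • basePt H) (a • basePt H)),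
      actCoord E H F a (mulCoord E G p.1, p.2)
        = actCoord E H F a (p.1.1, actCoord E H F a (p.1.2, p.2)) := by
  have c1 : ContinuousAt (fun p : (E × E) × F ↦ p.1) ((oneCoord E G, oneCoord E G),
        extChartAt 𝓘(ℝ, F) (a • basePt H) (a • basePt H)) := by fun_prop
  have c2 : ContinuousAt (fun p : (E × E) × F ↦ (p.1.2, p.2)) ((oneCoord E G, oneCoord E G),
        extChartAt 𝓘(ℝ, F) (a • basePt H) (a • basePt H)) := by fun_prop
  filter_upwards [c1.eventually (oneChart_symm_mulCoord (E := E) (G := G)),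
    c2.eventually (eventually_actCoord_source hproj a)] with p h1 h2
  have e1 : actCoord E H F a (mulCoord E G p.1, p.2)
      = extChartAt 𝓘(ℝ, F) (a • basePt H) ((a * (oneChart E G).symm (mulCoord E G p.1) * a⁻¹) •
        (extChartAt 𝓘(ℝ, F) (a • basePt H)).symm p.2) := rfl
  have e2 : actCoord E H F a (p.1.1, actCoord E H F a (p.1.2, p.2))
      = extChartAt 𝓘(ℝ, F) (a • basePt H) ((a * (oneChart E G).symm p.1.1 * a⁻¹) •
        (extChartAt 𝓘(ℝ, F) (a • basePt H)).symm (extChartAt 𝓘(ℝ, F) (a • basePt H)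
          ((a * (oneChart E G).symm p.1.2 * a⁻¹) •
            (extChartAt 𝓘(ℝ, F) (a • basePt H)).symm p.2))) := rfl
  rw [e1, e2, (extChartAt 𝓘(ℝ, F) (a • basePt H)).left_inv h2, h1, ← mul_smul]
  congr 2
  group

theorem fderiv_actCoord_right
    (hproj : Manifold.IsSubmersion 𝓘(ℝ, E) 𝓘(ℝ, F) ∞ (fun x : G ↦ (x : G ⧸ H))) (a : G) :
    ∀ᶠ p : E × F in 𝓝 (oneCoord E G, extChartAt 𝓘(ℝ, F) (a • basePt H) (a • basePt H)),
      ∀ u, fderiv ℝ (actCoord E H F a) p (0, u)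
        = modelDeriv F F (extChartAt 𝓘(ℝ, F) (a • basePt H))
            ((a * (oneChart E G).symm p.1 * a⁻¹) •
              (extChartAt 𝓘(ℝ, F) (a • basePt H)).symm p.2)
          (actDeriv F (a * (oneChart E G).symm p.1 * a⁻¹)
            ((extChartAt 𝓘(ℝ, F) (a • basePt H)).symm p.2)
            (modelDeriv F F (extChartAt 𝓘(ℝ, F) (a • basePt H)).symm p.2 u)) := by
  have c2 : ContinuousAt (fun p : E × F ↦ p.2) (oneCoord E G,
        extChartAt 𝓘(ℝ, F) (a • basePt H) (a • basePt H)) := by fun_prop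
  filter_upwards [eventually_actCoord_source hproj a,
    c2.eventually (extChartAt_target_mem_nhds (I := 𝓘(ℝ, F)) (a • basePt H)),
    contDiffAt_two_eventually (contDiffAt_actCoord hproj a)] with p h1 h2 h3 u
  have h := fderiv_in_charts (f := fun x : G ⧸ H ↦ (a * (oneChart E G).symm p.1 * a⁻¹) • x)
    (a • basePt H) (a • basePt H) h2 h1
    ((contMDiff_smul_quotient hproj _).mdifferentiableAt (by simp)) u
  have h4 := DFunLike.congr_fun (fderiv_comp_right (x := p.1) (y := p.2)
    (h3.differentiableAt (by simp))).fderiv u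
  simp only [ContinuousLinearMap.comp_apply, ContinuousLinearMap.inr_apply] at h4
  exact h4.symm.trans h

/-- Since `(a z a⁻¹) • (a • o) = a • (z • o)`, the conjugated fundamental fields at `a • o` are the
translates by `a` of the fundamental vectors at `o`. This is the purpose of the conjugation: inner
products of these fields do not depend on `a`. -/
theorem fundField_actCoord_base
    (hproj : Manifold.IsSubmersion 𝓘(ℝ, E) 𝓘(ℝ, F) ∞ (fun x : G ↦ (x : G ⧸ H))) (a : G)
    (X : E) :
    fundField (actCoord E H F a) (oneCoord E G)
        X (extChartAt 𝓘(ℝ, F) (a • basePt H) (a • basePt H))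
      = actDeriv F a (basePt H) (projDeriv E H F X) := by
  have hd : MDifferentiableAt 𝓘(ℝ, E) 𝓘(ℝ, F) (fun x : G ↦ (x : G ⧸ H)) 1 :=
    hproj.contMDiff.mdifferentiableAt (by simp)
  have hd2 : MDifferentiableAt 𝓘(ℝ, F) 𝓘(ℝ, F) (fun x : G ⧸ H ↦ a • x) (basePt H) :=
    (contMDiff_smul_quotient hproj a).mdifferentiableAt (by simp)
  have hd3 : MDifferentiableAt 𝓘(ℝ, E) 𝓘(ℝ, F) (fun x : G ↦ a • (x : G ⧸ H)) 1 :=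
    hd2.comp (1 : G) hd
  have h := fderiv_in_charts (f := fun x : G ↦ a • (x : G ⧸ H)) (1 : G) (a • basePt H)
    (y := oneCoord E G) (F' := F)
    (mem_extChartAt_target (1 : G))
    (by rw [oneChart_symm_oneCoord]; exact mem_extChartAt_source _)
    (by rw [oneChart_symm_oneCoord]; exact hd3) X
  rw [oneChart_symm_oneCoord, modelDeriv_extChartAt_self, modelDeriv_symm_self] at h
  have h4 := DFunLike.congr_fun (fderiv_comp_left (x := oneCoord E G)
    (y := extChartAt 𝓘(ℝ, F) (a • basePt H) (a • basePt H))
    ((contDiffAt_actCoord hproj a).differentiableAt (by simp))).fderiv X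
  simp only [ContinuousLinearMap.comp_apply, ContinuousLinearMap.inl_apply] at h4
  have h5 : (fun z ↦ actCoord E H F a (z, extChartAt 𝓘(ℝ, F) (a • basePt H) (a • basePt H)))
      = fun z ↦ extChartAt 𝓘(ℝ, F) (a • basePt H) (a • (((oneChart E G).symm z : G) : G ⧸ H)) := by
    ext z
    simp only [actCoord]
    rw [extChartAt_to_inv, smul_smul, inv_mul_cancel_right, mul_smul]
    congr 2
    exact congrArg (QuotientGroup.mk (s := H)) (mul_one _)
  rw [h5] at h4
  exact h4.symm.trans (h.trans (modelDeriv_comp_apply hd2 hd X))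

theorem actField_base
    (hproj : Manifold.IsSubmersion 𝓘(ℝ, E) 𝓘(ℝ, F) ∞ (fun x : G ↦ (x : G ⧸ H))) (a : G)
    (X : LieAlg E G) :
    actField E H F a X (extChartAt 𝓘(ℝ, F) (a • basePt H) (a • basePt H))
      = actDeriv F a (basePt H) (projDeriv E H F X) :=
  fundField_actCoord_base hproj a X

theorem inChart_base (B : BilinField F (G ⧸ H)) (p : G ⧸ H) (u v : F) :
    inChart B p (extChartAt 𝓘(ℝ, F) p p) u v = modelForm B p u v := by
  rw [inChart_apply, extChartAt_to_inv, modelDeriv_symm_self]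
  rfl

theorem inChart_actField_base
    (hproj : Manifold.IsSubmersion 𝓘(ℝ, E) 𝓘(ℝ, F) ∞ (fun x : G ↦ (x : G ⧸ H)))
    {B : BilinField F (G ⧸ H)} (hB : IsInvariantField G B) (a : G) (X Y : LieAlg E G) :
    inChart B (a • basePt H) (extChartAt 𝓘(ℝ, F) (a • basePt H) (a • basePt H))
      (actField E H F a X (extChartAt 𝓘(ℝ, F) (a • basePt H) (a • basePt H)))
      (actField E H F a Y (extChartAt 𝓘(ℝ, F) (a • basePt H) (a • basePt H)))
      = atBasePoint B X Y := by
  rw [inChart_base, actField_base hproj, actField_base hproj, hB.modelForm_eq]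
  rfl

/-- Invariance of `g` is the isometry identity of `killing_fundField`, once the derivatives of the
chart and of its inverse cancel. -/
theorem killing_actCoord
    (hproj : Manifold.IsSubmersion 𝓘(ℝ, E) 𝓘(ℝ, F) ∞ (fun x : G ↦ (x : G ⧸ H)))
    {g : RiemMetric F (G ⧸ H)} (hg : IsInvariantField G g.inner) (a : G) (X : E) :
    ∀ᶠ y in 𝓝 (extChartAt 𝓘(ℝ, F) (a • basePt H) (a • basePt H)), ∀ u v,
      fderiv ℝ (inChart g.inner (a • basePt H)) y
          (fundField (actCoord E H F a) (oneCoord E G) X y) u v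
        + inChart g.inner (a • basePt H) y
          (fderiv ℝ (fundField (actCoord E H F a) (oneCoord E G) X) y u) v
        + inChart g.inner (a • basePt H) y u
          (fderiv ℝ (fundField (actCoord E H F a) (oneCoord E G) X) y v) = 0 := by
  refine killing_fundField (contDiffAt_actCoord hproj a)
    ((contMDiffAt_iff_inChart g.inner (a • basePt H)).1 g.contMDiff.contMDiffAt)
    (actCoord_one a) ?_ X
  filter_upwards [eventually_actCoord_source hproj a, fderiv_actCoord_right hproj a]
    with p h1 h2 u v
  rw [h2, h2, inChart_apply, inChart_apply]
  have e : actCoord E H F a p = extChartAt 𝓘(ℝ, F) (a • basePt H)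
    ((a * (oneChart E G).symm p.1 * a⁻¹) •
      (extChartAt 𝓘(ℝ, F) (a • basePt H)).symm p.2) := rfl
  rw [e, modelDeriv_symm_comp_chart _ h1, modelDeriv_symm_comp_chart _ h1,
    (extChartAt 𝓘(ℝ, F) (a • basePt H)).left_inv h1, hg.modelForm_eq]

theorem bracket_actCoord [FiniteDimensional ℝ E] [CompleteSpace E]
    [LieGroup 𝓘(ℝ, E) (minSmoothness ℝ 3) G]
    (hproj : Manifold.IsSubmersion 𝓘(ℝ, E) 𝓘(ℝ, F) ∞ (fun x : G ↦ (x : G ⧸ H))) (a : G)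
    (X Z : E) :
    ∀ᶠ y in 𝓝 (extChartAt 𝓘(ℝ, F) (a • basePt H) (a • basePt H)),
      fderiv ℝ (fundField (actCoord E H F a) (oneCoord E G) X) y
          (fundField (actCoord E H F a) (oneCoord E G) Z y)
        - fderiv ℝ (fundField (actCoord E H F a) (oneCoord E G) Z) y
          (fundField (actCoord E H F a) (oneCoord E G) X y)
      = fundField (actCoord E H F a) (oneCoord E G) (lieModel E G X Z) y := by
  rw [lieModel_eq_localBracket]
  exact bracket_fundField (contDiffAt_actCoord hproj a) contDiffAt_mulCoord (actCoord_one a)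
    mulCoord_one_left mulCoord_one_right (actCoord_mulCoord hproj a) X Z

theorem isKillingAlgebraAt_actField [FiniteDimensional ℝ E] [CompleteSpace E]
    [LieGroup 𝓘(ℝ, E) (minSmoothness ℝ 3) G]
    (hproj : Manifold.IsSubmersion 𝓘(ℝ, E) 𝓘(ℝ, F) ∞ (fun x : G ↦ (x : G ⧸ H)))
    {g : RiemMetric F (G ⧸ H)} (hg : IsInvariantField G g.inner) (a : G) :
    IsKillingAlgebraAt (inChart g.inner (a • basePt H))
      (extChartAt 𝓘(ℝ, F) (a • basePt H) (a • basePt H)) (actField E H F a) := by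
  refine ⟨(contMDiffAt_iff_inChart g.inner (a • basePt H)).1 g.contMDiff.contMDiffAt, ?_, ?_, ?_, ?_, ?_⟩
  · exact Filter.Eventually.of_forall fun y u v ↦ g.symm _ _ _
  · intro u hu
    rw [inChart_base]
    exact g.pos _ _ hu
  · intro X
    exact contDiffAt_fundField (contDiffAt_actCoord hproj a) _
  · exact killing_actCoord hproj hg a
  · exact bracket_actCoord hproj a

/-- The Ricci curvature of an invariant metric on a homogeneous space. -/
theorem two_mul_ricci_homogeneous [FiniteDimensional ℝ E] [CompleteSpace E]
    [FiniteDimensional ℝ F] [LieGroup 𝓘(ℝ, E) (minSmoothness ℝ 3) G]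
    (hproj : Manifold.IsSubmersion 𝓘(ℝ, E) 𝓘(ℝ, F) ∞ (fun x : G ↦ (x : G ⧸ H)))
    {g : RiemMetric F (G ⧸ H)} (hg : IsInvariantField G g.inner)
    {ι : Type*} [Fintype ι] {e : ι → LieAlg E G} {l : ι → ℝ} (hl : ∀ i, 0 < l i)
    {b : LieAlg E G → LieAlg E G → ℝ} (hb : ∀ X Y, b X Y = atBasePoint g.inner X Y)
    (he : ∀ i j, i ≠ j → b (e i) (e j) = 0) (hel : ∀ i, b (e i) (e i) = l i)
    (hspan : ⊤ ≤ Submodule.span ℝ (Set.range fun i ↦ projDeriv E H F (e i)))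
    (huni : ∀ i j, b ⁅e i, e j⁆ (e i) = 0) (a : G) (Y Z : LieAlg E G) :
    2 * ricci g (a • basePt H) (actDeriv F a (basePt H) (projDeriv E H F Y))
        (actDeriv F a (basePt H) (projDeriv E H F Z))
      = ∑ i, (l i)⁻¹ * (b ⁅e i, ⁅Z, e i⁆⁆ Y - b ⁅Y, ⁅Z, e i⁆⁆ (e i) - b ⁅Z, e i⁆ ⁅Y, e i⁆)
        + ∑ i, ∑ j, (l i)⁻¹ * (l j)⁻¹ * 2⁻¹ *
          ((b ⁅e i, Z⁆ (e j) + b ⁅e i, e j⁆ Z + b ⁅Z, e j⁆ (e i)) *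
            (b ⁅Y, e i⁆ (e j) + b ⁅Y, e j⁆ (e i) + b ⁅e i, e j⁆ Y)) := by
  have hb' : ∀ X Y, b X Y = inChart g.inner (a • basePt H)
      (extChartAt 𝓘(ℝ, F) (a • basePt H) (a • basePt H))
      (actField E H F a X (extChartAt 𝓘(ℝ, F) (a • basePt H) (a • basePt H)))
      (actField E H F a Y (extChartAt 𝓘(ℝ, F) (a • basePt H) (a • basePt H))) := fun X Y ↦ by
    rw [inChart_actField_base hproj hg, hb]
  have hsurj : Function.Surjective (actDeriv F a (basePt H)) := fun v ↦ by
    refine ⟨actDeriv F a⁻¹ (a • basePt H) v, ?_⟩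
    have h := actDeriv_mul hproj a a⁻¹ (a • basePt H) v
    rw [mul_inv_cancel, actDeriv_one, inv_smul_smul] at h
    exact h.symm
  have hspan' : ⊤ ≤ Submodule.span ℝ (Set.range fun i ↦
      actField E H F a (e i) (extChartAt 𝓘(ℝ, F) (a • basePt H) (a • basePt H))) := by
    have e1 : (Set.range fun i ↦
        actField E H F a (e i) (extChartAt 𝓘(ℝ, F) (a • basePt H) (a • basePt H)))
        = (actDeriv F a (basePt H)).toLinearMap '' Set.range fun i ↦ projDeriv E H F (e i) := by
      rw [← Set.range_comp]
      congr 1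
      ext i
      exact actField_base hproj a (e i)
    rw [e1, ← Submodule.map_span, top_le_iff.1 hspan, Submodule.map_top]
    exact (LinearMap.range_eq_top.2 hsurj).ge
  rw [← actField_base hproj, ← actField_base hproj, ricci_eq_flatRicci]
  exact (isKillingAlgebraAt_actField hproj hg a).two_mul_flatRicci hl
    (fun i j hij ↦ by rw [← hb', he i j hij]) (fun i ↦ by rw [← hb', hel]) hspan'
    (fun i j ↦ by rw [← hb', huni]) hb' Y Z

end HomogeneousRicci

/-! ### Construction of invariant metrics from forms at the base point -/

section ExistenceOfInvariantMetric

theorem exists_pos_mul_sq_norm_le {F : Type*} [NormedAddCommGroup F] [NormedSpace ℝ F]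
    [FiniteDimensional ℝ F] (b : F →L[ℝ] F →L[ℝ] ℝ) (hb : ∀ v, v ≠ 0 → 0 < b v v) :
    ∃ c, 0 < c ∧ ∀ v, c * ‖v‖ ^ 2 ≤ b v v := by
  have hproper : ProperSpace F := FiniteDimensional.proper ℝ F
  have hcont : Continuous fun v ↦ b v v := by fun_prop
  rcases (Metric.sphere (0 : F) 1).eq_empty_or_nonempty with he | hne
  · refine ⟨1, one_pos, fun v ↦ ?_⟩
    have hv : v = 0 := by
      by_contra hv
      have hmem : ‖v‖⁻¹ • v ∈ Metric.sphere (0 : F) 1 := by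
        rw [mem_sphere_zero_iff_norm, norm_smul, norm_inv, norm_norm,
          inv_mul_cancel₀ (norm_ne_zero_iff.2 hv)]
      rw [he] at hmem
      exact hmem
    simp [hv]
  · obtain ⟨u, hu, hmin⟩ := (isCompact_sphere (0 : F) 1).exists_isMinOn hne hcont.continuousOn
    refine ⟨b u u, hb u (fun h ↦ by simp [h] at hu), fun v ↦ ?_⟩
    rcases eq_or_ne v 0 with rfl | hv
    · simp
    · have hn : 0 < ‖v‖ := norm_pos_iff.2 hv
      have hmem : ‖v‖⁻¹ • v ∈ Metric.sphere (0 : F) 1 := by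
        rw [mem_sphere_zero_iff_norm, norm_smul, norm_inv, norm_norm, inv_mul_cancel₀ hn.ne']
      have h := hmin hmem
      simp only [Set.mem_ofPred_eq, map_smul, smul_apply, smul_eq_mul] at h
      calc b u u * ‖v‖ ^ 2 ≤ (‖v‖⁻¹ * (‖v‖⁻¹ * b v v)) * ‖v‖ ^ 2 := by gcongr
        _ = b v v := by field_simp

/-- Supplies the boundedness of unit balls that is part of the structure of a Riemannian metric. -/
theorem isVonNBounded_of_pos {F : Type*} [NormedAddCommGroup F] [NormedSpace ℝ F]
    [FiniteDimensional ℝ F] (b : F →L[ℝ] F →L[ℝ] ℝ) (hb : ∀ v, v ≠ 0 → 0 < b v v) :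
    Bornology.IsVonNBounded ℝ {v : F | b v v < 1} := by
  obtain ⟨c, hc, h⟩ := exists_pos_mul_sq_norm_le b hb
  rw [NormedSpace.isVonNBounded_iff, isBounded_iff_forall_norm_le]
  refine ⟨c⁻¹ + 1, fun v hv ↦ ?_⟩
  have h1 : c * ‖v‖ ^ 2 < 1 := (h v).trans_lt hv
  have h2 : ‖v‖ ^ 2 < c⁻¹ := by
    rwa [← one_div, lt_div_iff₀' hc]
  nlinarith [sq_nonneg (‖v‖ - 1)]

variable {E : Type*} [NormedAddCommGroup E] [NormedSpace ℝ E]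
  {G : Type*} [TopologicalSpace G] [ChartedSpace E G] [Group G]
  {H : Subgroup G} {F : Type*} [NormedAddCommGroup F] [NormedSpace ℝ F]
  [ChartedSpace F (G ⧸ H)]

/-- The bilinear form `b`, given at the base point, transported over `G/H`. -/
def invariantForm (b : F →L[ℝ] F →L[ℝ] ℝ) (p : G ⧸ H) : F →L[ℝ] F →L[ℝ] ℝ :=
  b.bilinearComp (actDeriv F p.out⁻¹ p) (actDeriv F p.out⁻¹ p)

variable [LieGroup 𝓘(ℝ, E) ∞ G]

theorem inv_smul_eq_basePt {G : Type*} [Group G] {H : Subgroup G} {a : G} {p : G ⧸ H}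
    (hap : (a : G ⧸ H) = p) : a⁻¹ • p = basePt H := by
  rw [← hap]
  exact congrArg (QuotientGroup.mk (s := H)) (inv_mul_cancel a)

/-- Two representatives of `p` differ by an element of `H`, under which `b` is invariant. Hence the
arbitrary choice `p.out` may be replaced by a smooth local section. -/
theorem invariantForm_eq
    (hproj : Manifold.IsSubmersion 𝓘(ℝ, E) 𝓘(ℝ, F) ∞ (fun x : G ↦ (x : G ⧸ H)))
    {b : F →L[ℝ] F →L[ℝ] ℝ}
    (hb : ∀ a ∈ H, ∀ u v, b (actDeriv F a (basePt H) u) (actDeriv F a (basePt H) v) = b u v)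
    {a : G} {p : G ⧸ H} (hap : (a : G ⧸ H) = p) (u v : F) :
    invariantForm b p u v = b (actDeriv F a⁻¹ p u) (actDeriv F a⁻¹ p v) := by
  have hmem : p.out⁻¹ * a ∈ H := QuotientGroup.eq.1 (by rw [hap]; exact p.out_eq)
  have hbase : a⁻¹ • p = basePt H := inv_smul_eq_basePt hap
  have h1 : ∀ w, actDeriv F p.out⁻¹ p w
      = actDeriv F (p.out⁻¹ * a) (basePt H) (actDeriv F a⁻¹ p w) := fun w ↦ by
    have h := actDeriv_mul hproj (p.out⁻¹ * a) a⁻¹ p w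
    rwa [hbase, mul_inv_cancel_right] at h
  simp only [invariantForm, ContinuousLinearMap.bilinearComp_apply]
  rw [h1, h1, hb _ hmem]

theorem invariantForm_base
    (hproj : Manifold.IsSubmersion 𝓘(ℝ, E) 𝓘(ℝ, F) ∞ (fun x : G ↦ (x : G ⧸ H)))
    {b : F →L[ℝ] F →L[ℝ] ℝ}
    (hb : ∀ a ∈ H, ∀ u v, b (actDeriv F a (basePt H) u) (actDeriv F a (basePt H) v) = b u v)
    (u v : F) : invariantForm b (basePt H) u v = b u v := by
  rw [invariantForm_eq hproj hb (a := 1) rfl, inv_one, actDeriv_one, actDeriv_one]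

theorem isInvariantField_invariantForm
    (hproj : Manifold.IsSubmersion 𝓘(ℝ, E) 𝓘(ℝ, F) ∞ (fun x : G ↦ (x : G ⧸ H)))
    {b : F →L[ℝ] F →L[ℝ] ℝ}
    (hb : ∀ a ∈ H, ∀ u v, b (actDeriv F a (basePt H) u) (actDeriv F a (basePt H) v) = b u v)
    (a : G) (p : G ⧸ H) (u v : F) :
    invariantForm b (a • p) (actDeriv F a p u) (actDeriv F a p v) = invariantForm b p u v := by
  have h1 : ((a * p.out : G) : G ⧸ H) = a • p := by
    conv_rhs => rw [← p.out_eq]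
    rfl
  rw [invariantForm_eq hproj hb h1, ← actDeriv_mul hproj, ← actDeriv_mul hproj,
    mul_inv_rev, inv_mul_cancel_right]
  rfl

theorem invariantForm_pos
    (hproj : Manifold.IsSubmersion 𝓘(ℝ, E) 𝓘(ℝ, F) ∞ (fun x : G ↦ (x : G ⧸ H)))
    {b : F →L[ℝ] F →L[ℝ] ℝ} (hpos : ∀ v, v ≠ 0 → 0 < b v v) (p : G ⧸ H) (v : F) (hv : v ≠ 0) :
    0 < invariantForm b p v v := by
  refine hpos _ fun h ↦ hv ?_
  replace h : actDeriv F p.out⁻¹ p v = 0 := h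
  have h1 := actDeriv_mul hproj p.out p.out⁻¹ p v
  rwa [mul_inv_cancel, actDeriv_one, h, map_zero] at h1

variable [IsManifold 𝓘(ℝ, F) ∞ (G ⧸ H)]

/-- With a local section `s`, the form at `x` is the pull-back of `b` under the derivative of the
action of `(s x)⁻¹`. The coefficients of that derivative are smooth in `x` because the action is
jointly smooth. -/
theorem contDiffAt_inChart_invariantForm
    (hproj : Manifold.IsSubmersion 𝓘(ℝ, E) 𝓘(ℝ, F) ∞ (fun x : G ↦ (x : G ⧸ H)))
    {b : F →L[ℝ] F →L[ℝ] ℝ}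
    (hb : ∀ a ∈ H, ∀ u v, b (actDeriv F a (basePt H) u) (actDeriv F a (basePt H) v) = b u v)
    (p : G ⧸ H) :
    ContDiffAt ℝ ∞ (inChart (invariantForm b : BilinField F (G ⧸ H)) p)
      (extChartAt 𝓘(ℝ, F) p p) := by
  obtain ⟨a, rfl⟩ := QuotientGroup.mk_surjective p
  obtain ⟨s, hs, hsa, hps⟩ := (hproj.isSubmersionAt a).exists_local_section
  set p : G ⧸ H := (a : G ⧸ H) with hp
  set φ := extChartAt 𝓘(ℝ, F) p with hφ
  set ψ := extChartAt 𝓘(ℝ, F) (basePt H) with hψ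
  have hφs : ContMDiffAt 𝓘(ℝ, F) 𝓘(ℝ, F) ∞ φ.symm (φ p) :=
    contMDiffAt_chart_symm p (mem_extChartAt_target p)
  have hφp : φ.symm (φ p) = p := extChartAt_to_inv p
  have hs' : ContMDiffAt 𝓘(ℝ, F) 𝓘(ℝ, E) ∞ (fun y ↦ s (φ.symm y)) (φ p) :=
    ContMDiffAt.comp_of_eq (g := s) hs hφs hφp
  have hbase : (s p)⁻¹ • p = basePt H := inv_smul_eq_basePt (by rw [hsa])
  have hΦ0 : ContMDiffAt 𝓘(ℝ, F × F) 𝓘(ℝ, F) ∞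
      (fun z : F × F ↦ (s (φ.symm z.1))⁻¹ • φ.symm z.2) (φ p, φ p) := by
    refine contMDiffAt_smul_quotient hproj ?_ ?_
    · exact ContMDiffAt.inv (hs'.comp_of_eq (contDiffAt_fst (𝕜 := ℝ) (n := ∞)).contMDiffAt rfl)
    · exact hφs.comp_of_eq (contDiffAt_snd (𝕜 := ℝ) (n := ∞)).contMDiffAt rfl
  -- Two separate variables: the group element depends on the first and stays fixed while
  -- differentiating in the second; the derivative is then taken on the diagonal.
  set Φ : F × F → F := fun z ↦ ψ ((s (φ.symm z.1))⁻¹ • φ.symm z.2) with hΦdef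
  have hΦ : ContDiffAt ℝ ∞ Φ (φ p, φ p) :=
    contMDiffAt_iff_contDiffAt.1
      ((contMDiffAt_extChartAt (I := 𝓘(ℝ, F)) (x := basePt H)).comp_of_eq hΦ0
        (by simp only [hφp, hbase]))
  have hA : ContDiffAt ℝ ∞
      (fun y ↦ (fderiv ℝ Φ (y, y)).comp (ContinuousLinearMap.inr ℝ F F)) (φ p) := by
    have h1 : ContDiffAt ℝ ∞ (fderiv ℝ Φ) (φ p, φ p) := hΦ.fderiv_right (m := ∞) (by simp)
    have h2 : ContDiffAt ℝ ∞ (fun y ↦ fderiv ℝ Φ (y, y)) (φ p) :=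
      ContDiffAt.comp (f := fun y ↦ (y, y)) (φ p) h1 (contDiffAt_id.prodMk contDiffAt_id)
    exact h2.clm_comp contDiffAt_const
  have hflip : ContDiff ℝ ∞ (fun c : F →L[ℝ] F →L[ℝ] ℝ ↦ c.flip) :=
    (ContinuousLinearMap.flipₗᵢ ℝ F F ℝ).toContinuousLinearEquiv.contDiff
  have hB : ContDiffAt ℝ ∞ (fun y ↦ b.bilinearComp
      ((fderiv ℝ Φ (y, y)).comp (ContinuousLinearMap.inr ℝ F F))
      ((fderiv ℝ Φ (y, y)).comp (ContinuousLinearMap.inr ℝ F F))) (φ p) := by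
    have h1 := hflip.contDiffAt.comp (φ p) ((contDiffAt_const (c := b)).clm_comp hA)
    exact hflip.contDiffAt.comp (φ p) (h1.clm_comp hA)
  refine hB.congr_of_eventuallyEq ?_
  have c1 : ContinuousAt (fun y : F ↦ (y, y)) (φ p) := by fun_prop
  filter_upwards [extChartAt_target_mem_nhds (I := 𝓘(ℝ, F)) p,
    hφs.continuousAt.eventually (p := fun x ↦ ((s x : G) : G ⧸ H) = x) (by rw [hφp]; exact hps),
    c1.eventually (contDiffAt_two_eventually hΦ)] with y hy hsy hΦy
  have hbase' : (s (φ.symm y))⁻¹ • φ.symm y = basePt H := inv_smul_eq_basePt hsy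
  have key : ∀ u, fderiv ℝ Φ (y, y) (0, u)
      = actDeriv F (s (φ.symm y))⁻¹ (φ.symm y) (modelDeriv F F φ.symm y u) := fun u ↦ by
    have h := fderiv_in_charts (f := fun x : G ⧸ H ↦ (s (φ.symm y))⁻¹ • x) (F' := F) p (basePt H) hy
      (by simp only [← hφ]; rw [hbase']; exact mem_extChartAt_source _)
      ((contMDiff_smul_quotient hproj _).mdifferentiableAt (by simp)) u
    simp only [← hφ] at h
    rw [hbase', modelDeriv_extChartAt_self] at h
    have h4 := DFunLike.congr_fun (fderiv_comp_right (x := y) (y := y)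
      (hΦy.differentiableAt (by simp))).fderiv u
    simp only [ContinuousLinearMap.comp_apply, ContinuousLinearMap.inr_apply] at h4
    exact h4.symm.trans h
  ext u v
  refine (invariantForm_eq hproj hb hsy (modelDeriv F F φ.symm y u)
    (modelDeriv F F φ.symm y v)).trans ?_
  simp only [ContinuousLinearMap.bilinearComp_apply, ContinuousLinearMap.comp_apply,
    ContinuousLinearMap.inr_apply, key]

/-- The invariant Riemannian metric on `G/H` with a prescribed value at the base point. -/
def invariantMetric [FiniteDimensional ℝ F]
    (hproj : Manifold.IsSubmersion 𝓘(ℝ, E) 𝓘(ℝ, F) ∞ (fun x : G ↦ (x : G ⧸ H)))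
    {b : F →L[ℝ] F →L[ℝ] ℝ}
    (hb : ∀ a ∈ H, ∀ u v, b (actDeriv F a (basePt H) u) (actDeriv F a (basePt H) v) = b u v)
    (hsymm : ∀ u v, b u v = b v u) (hpos : ∀ v, v ≠ 0 → 0 < b v v) : RiemMetric F (G ⧸ H) where
  inner := invariantForm b
  symm _ _ _ := hsymm _ _
  pos := invariantForm_pos hproj hpos
  isVonNBounded p := isVonNBounded_of_pos (invariantForm b p) (invariantForm_pos hproj hpos p)
  contMDiff p := (contMDiffAt_iff_inChart _ p).2 (contDiffAt_inChart_invariantForm hproj hb p)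

/-- An `Ad(H)`-invariant form on the Lie algebra of `G` that descends to a scalar product on the
tangent space of `G/H` is the value at the base point of an invariant metric. -/
theorem exists_invariantMetric [FiniteDimensional ℝ F]
    (hproj : Manifold.IsSubmersion 𝓘(ℝ, E) 𝓘(ℝ, F) ∞ (fun x : G ↦ (x : G ⧸ H)))
    (β : LinearMap.BilinForm ℝ (LieAlg E G)) (hsymm : ∀ X Y, β X Y = β Y X)
    (hker : ∀ X ∈ subgroupLieAlgebra H, ∀ Y, β X Y = 0)
    (hpos : ∀ X, X ∉ subgroupLieAlgebra H → 0 < β X X)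
    (hinv : ∀ a ∈ H, ∀ X Y, β (Ad a X) (Ad a Y) = β X Y) :
    ∃ g : RiemMetric F (G ⧸ H), IsInvariantField G g.inner ∧
      ∀ X Y, atBasePoint g.inner X Y = β X Y := by
  -- A linear right inverse of the projection transports `β` to the tangent space; `hdesc` shows
  -- that the choice is immaterial, because `β` vanishes on the Lie algebra of `H`.
  obtain ⟨σ, hσ⟩ := (projDeriv E H F).toLinearMap.exists_rightInverse_of_surjective
    (LinearMap.range_eq_top.2 (surjective_projDeriv hproj))
  have hσ' : ∀ u, projDeriv E H F (σ u) = u := fun u ↦ LinearMap.congr_fun hσ u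
  have hdesc : ∀ X X' Y Y' : LieAlg E G, projDeriv E H F X = projDeriv E H F X' →
      projDeriv E H F Y = projDeriv E H F Y' → β X Y = β X' Y' := by
    intro X X' Y Y' h1 h2
    have h3 : X - X' ∈ subgroupLieAlgebra H :=
      (mem_subgroupLieAlgebra_iff_projDeriv hproj _).2
        ((map_sub (projDeriv E H F) X X').trans (sub_eq_zero.2 h1))
    have h4 : Y - Y' ∈ subgroupLieAlgebra H :=
      (mem_subgroupLieAlgebra_iff_projDeriv hproj _).2
        ((map_sub (projDeriv E H F) Y Y').trans (sub_eq_zero.2 h2))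
    have h5 := hker _ h3 Y
    have h6 := hker _ h4 X'
    rw [hsymm] at h6
    simp only [map_sub, LinearMap.sub_apply] at h5 h6
    linarith
  let b0 : LinearMap.BilinForm ℝ F := LinearMap.compl₁₂ (β : E →ₗ[ℝ] E →ₗ[ℝ] ℝ) σ σ
  let b : F →L[ℝ] F →L[ℝ] ℝ :=
    LinearMap.toContinuousLinearMap (LinearMap.toContinuousLinearMap.toLinearMap ∘ₗ b0)
  have hb : ∀ u v, b u v = β (σ u : E) (σ v : E) := fun u v ↦ rfl
  have hbX : ∀ X Y : LieAlg E G, b (projDeriv E H F X) (projDeriv E H F Y) = β X Y := fun X Y ↦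
    hdesc _ _ _ _ (hσ' _) (hσ' _)
  have hbinv : ∀ a ∈ H, ∀ u v,
      b (actDeriv F a (basePt H) u) (actDeriv F a (basePt H) v) = b u v := by
    intro a ha u v
    conv_lhs => rw [← hσ' u, ← hσ' v]
    rw [← projDeriv_AdModel hproj ha, ← projDeriv_AdModel hproj ha]
    exact (hbX _ _).trans (hinv a ha _ _)
  have hbpos : ∀ v, v ≠ 0 → 0 < b v v := by
    intro v hv
    refine hpos _ fun h ↦ hv ?_
    rw [← hσ' v]
    exact (mem_subgroupLieAlgebra_iff_projDeriv hproj _).1 h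
  refine ⟨invariantMetric hproj hbinv (fun u v ↦ hsymm _ _) hbpos,
    isInvariantField_invariantForm hproj hbinv, fun X Y ↦ ?_⟩
  exact (invariantForm_base hproj hbinv _ _).trans (hbX X Y)

end ExistenceOfInvariantMetric

/-! ### Ricci curvature of a diagonal metric in terms of structure constants -/

section StructureConstants

variable {L : Type*} [LieRing L] [LieAlgebra ℝ L] {Q : LinearMap.BilinForm ℝ L}

/-- Together with `lie_form_swap` this makes `Q ⁅X, Y⁆ Z` totally antisymmetric, hence the structure
constants symmetric in their indices. -/
theorem lie_form_cyclic (hs : ∀ X Y, Q X Y = Q Y X) (hinv : ∀ X Y Z : L, Q ⁅X, Y⁆ Z = -Q Y ⁅X, Z⁆)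
    (X Y Z : L) : Q ⁅X, Y⁆ Z = Q ⁅Y, Z⁆ X := by
  rw [← lie_skew X Y, map_neg, LinearMap.neg_apply, hinv Y X Z, neg_neg, hs]

theorem lie_form_swap (X Y Z : L) : Q ⁅X, Y⁆ Z = -Q ⁅Y, X⁆ Z := by
  rw [← lie_skew X Y, map_neg, LinearMap.neg_apply]

variable {ι κ : Type*} [Fintype ι] [Fintype κ] {f : ι → L} {w : κ → L} {x : ι → ℝ}
  {b : L → L → ℝ}

theorem diagonal_form_apply [DecidableEq ι]
    (hf : ∀ i j, Q (f i) (f j) = if i = j then 1 else 0)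
    (hb : ∀ X Y, b X Y = ∑ a, x a * (Q X (f a) * Q Y (f a))) (X : L) (c : ι) :
    b X (f c) = x c * Q X (f c) ∧ b (f c) X = x c * Q X (f c) := by
  simp [hb, hf]

/-- The Ricci curvature of a diagonal invariant metric, on elements of the basis, in terms of the
structure constants. -/
theorem ricci_sum_basis [DecidableEq ι] (hs : ∀ X Y, Q X Y = Q Y X)
    (hinv : ∀ X Y Z : L, Q ⁅X, Y⁆ Z = -Q Y ⁅X, Z⁆)
    (hf : ∀ i j, Q (f i) (f j) = if i = j then 1 else 0)
    (hb : ∀ X Y, b X Y = ∑ a, x a * (Q X (f a) * Q Y (f a))) (c c' : ι) :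
    ∑ i, (x i)⁻¹ * (b ⁅f i, ⁅f c', f i⁆⁆ (f c) - b ⁅f c, ⁅f c', f i⁆⁆ (f i)
          - b ⁅f c', f i⁆ ⁅f c, f i⁆)
        + ∑ i, ∑ j, (x i)⁻¹ * (x j)⁻¹ * 2⁻¹ *
          ((b ⁅f i, f c'⁆ (f j) + b ⁅f i, f j⁆ (f c') + b ⁅f c', f j⁆ (f i)) *
            (b ⁅f c, f i⁆ (f j) + b ⁅f c, f j⁆ (f i) + b ⁅f i, f j⁆ (f c)))
      = ∑ i, (x i)⁻¹ * ((x c + x i) * Q ⁅f c', f i⁆ ⁅f c, f i⁆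
          - ∑ j, x j * (Q ⁅f i, f c'⁆ (f j) * Q ⁅f i, f c⁆ (f j)))
        + ∑ i, ∑ j, (x i)⁻¹ * (x j)⁻¹ * 2⁻¹ * ((x i + x j - x c') * (x i - x j - x c) *
            (Q ⁅f i, f c'⁆ (f j) * Q ⁅f i, f c⁆ (f j))) := by
  have hbf : ∀ X c, b X (f c) = x c * Q X (f c) := fun X c ↦ (diagonal_form_apply hf hb X c).1
  have cyc : ∀ i j k, Q ⁅f i, f j⁆ (f k) = -Q ⁅f k, f j⁆ (f i) := fun i j k ↦ by
    rw [lie_form_cyclic hs hinv, lie_form_swap]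
  have h1 : ∀ i c c', Q ⁅f i, ⁅f c', f i⁆⁆ (f c) = Q ⁅f c', f i⁆ ⁅f c, f i⁆ := fun i c c' ↦ by
    rw [hinv, ← lie_skew (f c) (f i), map_neg]
  congr 1
  · refine Finset.sum_congr rfl fun i _ ↦ ?_
    congr 1
    rw [hbf, hbf, h1, hinv (f c), hb]
    have h2 : ∀ j, Q ⁅f c', f i⁆ (f j) * Q ⁅f c, f i⁆ (f j)
        = Q ⁅f i, f c'⁆ (f j) * Q ⁅f i, f c⁆ (f j) := fun j ↦ by
      rw [lie_form_swap (f c'), lie_form_swap (f c), neg_mul_neg]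
    simp only [h2]
    ring
  · refine Finset.sum_congr rfl fun i _ ↦ Finset.sum_congr rfl fun j _ ↦ ?_
    congr 1
    simp only [hbf]
    have e1 : ∀ c, Q ⁅f c, f j⁆ (f i) = Q ⁅f i, f c⁆ (f j) := fun c ↦
      (lie_form_cyclic hs hinv (f i) (f c) (f j)).symm
    have e2 : ∀ c, Q ⁅f i, f j⁆ (f c) = -Q ⁅f i, f c⁆ (f j) := fun c ↦ by
      rw [← e1, cyc]
    rw [e1, e1, e2, e2, lie_form_swap (f c) (f i)]
    ring

/-- Split `|[f_c, f_i]|²` by Parseval into its components in `𝔥` and in `𝔪`. The `𝔥`-components are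
the numbers `Q ⁅w j, f c⁆ (f i)`, whose squares add up to the Casimir term; the `𝔪`-components join
the remaining sums. -/
theorem ricci_sum_diagonal (hs : ∀ X Y, Q X Y = Q Y X)
    (hinv : ∀ X Y Z : L, Q ⁅X, Y⁆ Z = -Q Y ⁅X, Z⁆) (hx : ∀ i, 0 < x i)
    (hpars : ∀ X, Q X X = ∑ j, Q X (w j) ^ 2 + ∑ i, Q X (f i) ^ 2)
    (hww : ∀ j c k, Q ⁅w j, f c⁆ (w k) = 0) (hwx : ∀ j c i, x i ≠ x c → Q ⁅w j, f c⁆ (f i) = 0)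
    (c : ι) :
    ∑ i, (x i)⁻¹ * ((x c + x i) * Q ⁅f c, f i⁆ ⁅f c, f i⁆
          - ∑ j, x j * (Q ⁅f i, f c⁆ (f j) * Q ⁅f i, f c⁆ (f j)))
        + ∑ i, ∑ j, (x i)⁻¹ * (x j)⁻¹ * 2⁻¹ * ((x i + x j - x c) * (x i - x j - x c) *
            (Q ⁅f i, f c⁆ (f j) * Q ⁅f i, f c⁆ (f j)))
      = 2 * Q (-∑ j, ⁅w j, ⁅w j, f c⁆⁆) (f c)
        + ∑ i, ∑ j, ((x c + x i - x j) / x i + ((x i - x c) ^ 2 - x j ^ 2) / (2 * x i * x j)) *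
            Q ⁅f i, f c⁆ (f j) ^ 2 := by
  have hcas : Q (-∑ j, ⁅w j, ⁅w j, f c⁆⁆) (f c) = ∑ j, ∑ i, Q ⁅w j, f c⁆ (f i) ^ 2 := by
    rw [map_neg, map_sum, LinearMap.neg_apply, LinearMap.sum_apply, ← Finset.sum_neg_distrib]
    refine Finset.sum_congr rfl fun j _ ↦ ?_
    rw [hinv, neg_neg, hpars]
    simp [hww]
  have hnorm : ∀ i, (x i)⁻¹ * ((x c + x i) * Q ⁅f c, f i⁆ ⁅f c, f i⁆)
      = 2 * ∑ j, Q ⁅w j, f c⁆ (f i) ^ 2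
        + (x i)⁻¹ * ((x c + x i) * ∑ j, Q ⁅f i, f c⁆ (f j) ^ 2) := by
    intro i
    have h1 : ∑ j, Q ⁅f c, f i⁆ (w j) ^ 2 = ∑ j, Q ⁅w j, f c⁆ (f i) ^ 2 :=
      Finset.sum_congr rfl fun j _ ↦ by
        rw [lie_form_cyclic hs hinv (f c), lie_form_cyclic hs hinv (f i)]
    have h2 : ∑ j, Q ⁅f c, f i⁆ (f j) ^ 2 = ∑ j, Q ⁅f i, f c⁆ (f j) ^ 2 :=
      Finset.sum_congr rfl fun j _ ↦ by rw [lie_form_swap, neg_sq]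
    rw [hpars, h1, h2]
    -- If `x i = x c`, the coefficient of the `𝔥`-part is exactly `2`; otherwise the `𝔥`-part is
    -- zero, as the isotropy representation does not mix summands.
    by_cases h : x i = x c
    · rw [h]
      have := (hx c).ne'
      field_simp
      ring
    · simp [hwx _ c i h]
  simp only [mul_sub (x _)⁻¹, Finset.sum_sub_distrib, hnorm, Finset.sum_add_distrib, hcas]
  rw [Finset.sum_comm (f := fun j i ↦ Q ⁅w j, f c⁆ (f i) ^ 2), ← Finset.mul_sum]
  have hfin : ∀ i j, ((x c + x i - x j) / x i + ((x i - x c) ^ 2 - x j ^ 2) / (2 * x i * x j)) *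
        Q ⁅f i, f c⁆ (f j) ^ 2
      = (x i)⁻¹ * ((x c + x i) * Q ⁅f i, f c⁆ (f j) ^ 2)
        - (x i)⁻¹ * (x j * (Q ⁅f i, f c⁆ (f j) * Q ⁅f i, f c⁆ (f j)))
        + (x i)⁻¹ * (x j)⁻¹ * 2⁻¹ * ((x i + x j - x c) * (x i - x j - x c) *
            (Q ⁅f i, f c⁆ (f j) * Q ⁅f i, f c⁆ (f j))) := fun i j ↦ by
    have := (hx i).ne'
    have := (hx j).ne'
    field_simp
    ring
  simp only [hfin, Finset.sum_add_distrib, Finset.sum_sub_distrib, Finset.mul_sum]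
  abel

end StructureConstants

/-! ### Summation over the two summands -/

section TwoSummands

variable {L : Type*} [LieRing L] [LieAlgebra ℝ L] {Q : LinearMap.BilinForm ℝ L}
  {d₁ d₂ : ℕ} {e₁ : Fin d₁ → L} {e₂ : Fin d₂ → L} {x₁ x₂ : ℝ}

/-- As `[𝔪₁, 𝔪₁]` has no component in `𝔪₂`, antisymmetry leaves only `i, j` both in the first or
both in the second summand, with coefficients `1/2` and `(x₁/x₂)²/2`. -/
theorem sum_coeff_left (hs : ∀ X Y, Q X Y = Q Y X)
    (hinv : ∀ X Y Z : L, Q ⁅X, Y⁆ Z = -Q Y ⁅X, Z⁆) (h₁ : 0 < x₁) (h₂ : 0 < x₂)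
    (h112 : ∀ i j k, Q ⁅e₁ i, e₁ j⁆ (e₂ k) = 0) :
    ∑ c, ∑ i, ∑ j, ((x₁ + Sum.elim (fun _ ↦ x₁) (fun _ ↦ x₂) i
            - Sum.elim (fun _ ↦ x₁) (fun _ ↦ x₂) j) / Sum.elim (fun _ ↦ x₁) (fun _ ↦ x₂) i
          + ((Sum.elim (fun _ ↦ x₁) (fun _ ↦ x₂) i - x₁) ^ 2
            - Sum.elim (fun _ ↦ x₁) (fun _ ↦ x₂) j ^ 2)
            / (2 * Sum.elim (fun _ ↦ x₁) (fun _ ↦ x₂) i * Sum.elim (fun _ ↦ x₁) (fun _ ↦ x₂) j)) *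
            Q ⁅Sum.elim e₁ e₂ i, e₁ c⁆ (Sum.elim e₁ e₂ j) ^ 2
      = 2⁻¹ * ∑ i, ∑ j, ∑ k, Q ⁅e₁ i, e₁ j⁆ (e₁ k) ^ 2
        + 2⁻¹ * (x₁ / x₂) ^ 2 * ∑ i, ∑ j, ∑ k, Q ⁅e₂ i, e₂ j⁆ (e₁ k) ^ 2 := by
  have hz : ∀ i j k, Q ⁅e₂ k, e₁ i⁆ (e₁ j) = 0 := fun i j k ↦ by
    rw [lie_form_cyclic hs hinv, h112]
  have c1 : (x₁ + x₁ - x₁) / x₁ + ((x₁ - x₁) ^ 2 - x₁ ^ 2) / (2 * x₁ * x₁) = 2⁻¹ := by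
    field_simp; ring
  have c2 : (x₁ + x₂ - x₂) / x₂ + ((x₂ - x₁) ^ 2 - x₂ ^ 2) / (2 * x₂ * x₂)
      = 2⁻¹ * (x₁ / x₂) ^ 2 := by
    field_simp; ring
  simp only [Fintype.sum_sum_type, Sum.elim_inl, Sum.elim_inr, h112, hz, c1, c2,
    ← Finset.mul_sum, Finset.sum_add_distrib]
  simp only [ne_eq, OfNat.ofNat_ne_zero, not_false_eq_true, zero_pow, mul_zero,
    Finset.sum_const_zero, add_zero, zero_add]
  congr 2
  · exact Finset.sum_comm
  · calc ∑ c, ∑ i, ∑ j, Q ⁅e₂ i, e₁ c⁆ (e₂ j) ^ 2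
        = ∑ c, ∑ j, ∑ i, Q ⁅e₂ j, e₂ i⁆ (e₁ c) ^ 2 := by
          refine Finset.sum_congr rfl fun c _ ↦ Finset.sum_comm.trans ?_
          simp only [lie_form_cyclic hs hinv (e₂ _) (e₂ _) (e₁ _)]
      _ = ∑ j, ∑ c, ∑ i, Q ⁅e₂ j, e₂ i⁆ (e₁ c) ^ 2 := Finset.sum_comm
      _ = _ := Finset.sum_congr rfl fun j _ ↦ Finset.sum_comm

/-- Three index patterns survive. The two mixed ones both sum to `γ₂₂¹`, and their coefficients
`(x₁/x₂)/2` and `2 - (3/2)(x₁/x₂)` add up to `2 - x₁/x₂`. -/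
theorem sum_coeff_right (hs : ∀ X Y, Q X Y = Q Y X)
    (hinv : ∀ X Y Z : L, Q ⁅X, Y⁆ Z = -Q Y ⁅X, Z⁆) (h₁ : 0 < x₁) (h₂ : 0 < x₂)
    (h112 : ∀ i j k, Q ⁅e₁ i, e₁ j⁆ (e₂ k) = 0) :
    ∑ c, ∑ i, ∑ j, ((x₂ + Sum.elim (fun _ ↦ x₁) (fun _ ↦ x₂) i
            - Sum.elim (fun _ ↦ x₁) (fun _ ↦ x₂) j) / Sum.elim (fun _ ↦ x₁) (fun _ ↦ x₂) i
          + ((Sum.elim (fun _ ↦ x₁) (fun _ ↦ x₂) i - x₂) ^ 2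
            - Sum.elim (fun _ ↦ x₁) (fun _ ↦ x₂) j ^ 2)
            / (2 * Sum.elim (fun _ ↦ x₁) (fun _ ↦ x₂) i * Sum.elim (fun _ ↦ x₁) (fun _ ↦ x₂) j)) *
            Q ⁅Sum.elim e₁ e₂ i, e₂ c⁆ (Sum.elim e₁ e₂ j) ^ 2
      = 2⁻¹ * ∑ i, ∑ j, ∑ k, Q ⁅e₂ i, e₂ j⁆ (e₂ k) ^ 2
        + (2 - x₁ / x₂) * ∑ i, ∑ j, ∑ k, Q ⁅e₂ i, e₂ j⁆ (e₁ k) ^ 2 := by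
  have hz : ∀ i j k, Q ⁅e₁ i, e₂ k⁆ (e₁ j) = 0 := fun i j k ↦ by
    rw [lie_form_cyclic hs hinv, lie_form_cyclic hs hinv, h112]
  have c1 : (x₂ + x₂ - x₂) / x₂ + ((x₂ - x₂) ^ 2 - x₂ ^ 2) / (2 * x₂ * x₂) = 2⁻¹ := by
    field_simp; ring
  have c2 : (x₂ + x₁ - x₂) / x₁ + ((x₁ - x₂) ^ 2 - x₂ ^ 2) / (2 * x₁ * x₂)
      = 2⁻¹ * (x₁ / x₂) := by
    field_simp; ring
  have c3 : (x₂ + x₂ - x₁) / x₂ + ((x₂ - x₂) ^ 2 - x₁ ^ 2) / (2 * x₂ * x₁)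
      = 2 - 3 * 2⁻¹ * (x₁ / x₂) := by
    field_simp; ring
  simp only [Fintype.sum_sum_type, Sum.elim_inl, Sum.elim_inr, hz, c1, c2, c3,
    ← Finset.mul_sum, Finset.sum_add_distrib]
  simp only [ne_eq, OfNat.ofNat_ne_zero, not_false_eq_true, zero_pow, mul_zero,
    Finset.sum_const_zero, zero_add]
  have e1 : ∑ c, ∑ i, ∑ j, Q ⁅e₂ i, e₂ c⁆ (e₁ j) ^ 2 = ∑ i, ∑ j, ∑ k, Q ⁅e₂ i, e₂ j⁆ (e₁ k) ^ 2 :=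
    Finset.sum_comm
  have e2 : ∑ c, ∑ i, ∑ j, Q ⁅e₂ i, e₂ c⁆ (e₂ j) ^ 2 = ∑ i, ∑ j, ∑ k, Q ⁅e₂ i, e₂ j⁆ (e₂ k) ^ 2 :=
    Finset.sum_comm
  have e3 : ∑ c, ∑ i, ∑ j, Q ⁅e₁ i, e₂ c⁆ (e₂ j) ^ 2
      = ∑ i, ∑ j, ∑ k, Q ⁅e₂ i, e₂ j⁆ (e₁ k) ^ 2 := by
    refine Finset.sum_congr rfl fun c _ ↦ ?_
    rw [Finset.sum_comm]
    simp only [lie_form_cyclic hs hinv (e₁ _) (e₂ _) (e₂ _)]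
  rw [e1, e2, e3]
  ring

end TwoSummands

/-! ### Orthonormal bases of subspaces of the Lie algebra -/

section OrthonormalBases

variable {E : Type*} [NormedAddCommGroup E] [NormedSpace ℝ E]
  {G : Type*} [TopologicalSpace G] [ChartedSpace E G] [Group G]
  {Q : LinearMap.BilinForm ℝ (LieAlg E G)} {V : Submodule ℝ (LieAlg E G)}
  {d : ℕ} {e : Fin d → LieAlg E G}

namespace IsOrthonormalBasisOf

theorem mem (he : IsOrthonormalBasisOf Q V e) (i : Fin d) : e i ∈ V :=
  he.span ▸ Submodule.subset_span ⟨i, rfl⟩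

theorem eq_sum (he : IsOrthonormalBasisOf Q V e) {X : LieAlg E G} (hX : X ∈ V) :
    X = ∑ i, Q X (e i) • e i := by
  rw [← he.span, Submodule.mem_span_range_iff_exists_fun] at hX
  obtain ⟨c, rfl⟩ := hX
  simp [map_sum, LinearMap.sum_apply, he.orthonormal]

theorem apply_sum (he : IsOrthonormalBasisOf Q V e) (c : Fin d → ℝ) (j : Fin d) :
    Q (∑ i, c i • e i) (e j) = c j := by
  simp [map_sum, LinearMap.sum_apply, he.orthonormal]

theorem ext_iff_left (he : IsOrthonormalBasisOf Q V e) {β β' : LinearMap.BilinForm ℝ (LieAlg E G)}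
    {X : LieAlg E G} (h : ∀ i, β X (e i) = β' X (e i)) {Y : LieAlg E G} (hY : Y ∈ V) :
    β X Y = β' X Y := by
  rw [he.eq_sum hY]
  simp [map_sum, h]

theorem parseval (he : IsOrthonormalBasisOf Q V e) {X : LieAlg E G} (hX : X ∈ V)
    (Y : LieAlg E G) : Q X Y = ∑ i, Q X (e i) * Q (e i) Y := by
  conv_lhs => rw [he.eq_sum hX]
  simp [map_sum, LinearMap.sum_apply]

theorem nonempty (he : IsOrthonormalBasisOf Q V e) (hV : V ≠ ⊥) : Nonempty (Fin d) := by
  by_contra h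
  rw [not_nonempty_iff] at h
  exact hV (by rw [← he.span, Set.range_eq_empty, Submodule.span_empty])

/-- The trace of a bilinear form does not depend on the orthonormal basis. -/
theorem sum_apply_eq {d' : ℕ} {e' : Fin d' → LieAlg E G} (hs : ∀ X Y, Q X Y = Q Y X)
    (he : IsOrthonormalBasisOf Q V e) (he' : IsOrthonormalBasisOf Q V e')
    (β : LinearMap.BilinForm ℝ (LieAlg E G)) :
    ∑ i, β (e i) (e i) = ∑ i, β (e' i) (e' i) := by
  have h1 : ∀ i, β (e i) (e i) = ∑ j, Q (e i) (e' j) * β (e' j) (e i) := fun i ↦ by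
    conv_lhs => enter [1]; rw [he'.eq_sum (he.mem i)]
    simp [map_sum, LinearMap.sum_apply]
  have h2 : ∀ j, β (e' j) (e' j) = ∑ i, Q (e i) (e' j) * β (e' j) (e i) := fun j ↦ by
    conv_lhs => enter [2]; rw [he.eq_sum (he'.mem j)]
    simp [map_sum, hs (e' j)]
  simp only [h1, h2]
  exact Finset.sum_comm

end IsOrthonormalBasisOf

end OrthonormalBases

/-! ### Schur's lemma for real invariant forms -/

section Schur

variable {E : Type*} [NormedAddCommGroup E] [NormedSpace ℝ E]
  {G : Type*} [TopologicalSpace G] [ChartedSpace E G] [Group G] [LieGroup 𝓘(ℝ, E) ∞ G]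
  {Q : LinearMap.BilinForm ℝ (LieAlg E G)} {S : Subgroup G} {V W : Submodule ℝ (LieAlg E G)}
  {d d' : ℕ} {e : Fin d → LieAlg E G} {e' : Fin d' → LieAlg E G}

theorem Ad_Ad_inv (a : G) (X : LieAlg E G) : Ad a (Ad a⁻¹ X) = X :=
  AdModel_AdModel_inv (E := E) a X

theorem Ad_lie (a : G) (X Y : LieAlg E G) : Ad a ⁅X, Y⁆ = ⁅Ad a X, Ad a Y⁆ :=
  AdModel_lieModel (E := E) a X Y

theorem IsOrthonormalBasisOf.Ad (hQ : IsAdInvariantScalarProduct Q) (hV : IsAdInvariant S V)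
    (he : IsOrthonormalBasisOf Q V e) {a : G} (ha : a ∈ S) :
    IsOrthonormalBasisOf Q V fun i ↦ Ad a (e i) where
  orthonormal i j := by rw [hQ.inv, he.orthonormal]
  span := by
    have h : (Set.range fun i ↦ _root_.Ad a (e i))
        = (_root_.Ad (E := E) a).toLinearMap '' Set.range e := by
      rw [← Set.range_comp]; rfl
    rw [h, ← Submodule.map_span, he.span]
    refine le_antisymm ?_ fun X hX ↦ ?_
    · rintro _ ⟨X, hX, rfl⟩
      exact hV a ha X hX
    · exact ⟨_root_.Ad a⁻¹ X, hV _ (S.inv_mem ha) X hX, Ad_Ad_inv a X⟩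

/-- An `Ad(S)`-invariant bilinear form that is symmetric on the irreducible subspace `V` is
a multiple of `Q` there. -/
theorem IsAdIrreducible.exists_form_eq (hV : IsAdIrreducible S V)
    (hQ : IsAdInvariantScalarProduct Q) (he : IsOrthonormalBasisOf Q V e)
    (β : LinearMap.BilinForm ℝ (LieAlg E G)) (hβs : ∀ X ∈ V, ∀ Y ∈ V, β X Y = β Y X)
    (hβ : ∀ a ∈ S, ∀ X ∈ V, ∀ Y ∈ V, β (Ad a X) (Ad a Y) = β X Y) :
    ∃ c : ℝ, ∀ X ∈ V, ∀ Y ∈ V, β X Y = c * Q X Y := by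
  obtain ⟨i₀⟩ := he.nonempty hV.ne_bot
  let A : Matrix (Fin d) (Fin d) ℝ := Matrix.of fun i j ↦ β (e i) (e j)
  have hA : A.IsHermitian := by
    ext i j
    simp [A, hβs _ (he.mem i) _ (he.mem j)]
  -- A symmetric real matrix has a real eigenvector, so no complexification is needed.
  let v := hA.eigenvectorBasis i₀
  have hv : A.mulVec v = hA.eigenvalues i₀ • v := hA.mulVec_eigenvectorBasis i₀
  set c := hA.eigenvalues i₀
  have hv0 : v ≠ 0 := hA.eigenvectorBasis.orthonormal.ne_zero i₀
  let X₀ : LieAlg E G := ∑ i, v i • e i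
  have hX₀ : X₀ ∈ V := V.sum_mem fun i _ ↦ V.smul_mem _ (he.mem i)
  -- The eigenspace of `β` relative to `Q`. It is invariant and contains `X₀ ≠ 0`, so irreducibility
  -- makes it all of `V`.
  let U : Submodule ℝ (LieAlg E G) :=
    { carrier := {X | X ∈ V ∧ ∀ Y ∈ V, β X Y = c * Q X Y}
      zero_mem' := ⟨V.zero_mem, fun Y _ ↦ by simp⟩
      add_mem' := fun {X X'} h h' ↦ ⟨V.add_mem h.1 h'.1, fun Y hY ↦ by
        rw [map_add, map_add, LinearMap.add_apply, LinearMap.add_apply, h.2 Y hY, h'.2 Y hY,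
          mul_add]⟩
      smul_mem' := fun r X h ↦ ⟨V.smul_mem r h.1, fun Y hY ↦ by
        rw [map_smul, map_smul, LinearMap.smul_apply, LinearMap.smul_apply, h.2 Y hY, smul_eq_mul,
          smul_eq_mul]
        ring⟩ }
  have hX₀U : X₀ ∈ U := by
    refine ⟨hX₀, fun Y hY ↦ he.ext_iff_left (β' := c • Q) (fun j ↦ ?_) hY⟩
    have h1 : β X₀ (e j) = A.mulVec v j := by
      simp only [X₀, A, map_sum, map_smul, LinearMap.sum_apply, LinearMap.smul_apply,
        Matrix.mulVec, dotProduct, Matrix.of_apply, smul_eq_mul]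
      exact Finset.sum_congr rfl fun i _ ↦ by rw [hβs _ (he.mem i) _ (he.mem j), mul_comm]
    rw [h1, hv, LinearMap.smul_apply, LinearMap.smul_apply, he.apply_sum]
    rfl
  have hUinv : IsAdInvariant S U := fun a ha X hX ↦ by
    refine ⟨hV.invariant a ha X hX.1, fun Y hY ↦ ?_⟩
    have hY' := hV.invariant _ (S.inv_mem ha) Y hY
    rw [← Ad_Ad_inv a Y, hβ a ha X hX.1 _ hY', hQ.inv, hX.2 _ hY']
  rcases hV.eq_bot_or_eq U (fun X hX ↦ hX.1) hUinv with hU | hU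
  · refine absurd ?_ hv0
    have hz : X₀ = 0 := by rwa [hU, Submodule.mem_bot] at hX₀U
    ext j
    rw [← he.apply_sum (fun i ↦ v i) j]
    change Q X₀ (e j) = 0
    rw [hz, map_zero, LinearMap.zero_apply]
  · refine ⟨c, fun X hX Y hY ↦ ?_⟩
    rw [← hU] at hX
    exact hX.2 Y hY

/-- An `Ad(S)`-invariant bilinear form pairs inequivalent irreducible subspaces trivially. -/
theorem IsAdIrreducible.form_eq_zero (hV : IsAdIrreducible S V) (hW : IsAdIrreducible S W)
    (hVW : ¬ AdEquivalent S V W) (hQ : IsAdInvariantScalarProduct Q)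
    (he : IsOrthonormalBasisOf Q W e) (β : LinearMap.BilinForm ℝ (LieAlg E G))
    (hβ : ∀ a ∈ S, ∀ X Y, β (Ad a X) (Ad a Y) = β X Y) :
    ∀ X ∈ V, ∀ Y ∈ W, β X Y = 0 := by
  -- The map into `W` that represents `β` through `Q`. It commutes with `Ad(S)`, so if it were
  -- nonzero on `V`, irreducibility of `V` and `W` would make it an equivalence.
  let φ : LieAlg E G →ₗ[ℝ] LieAlg E G := ∑ i, (β.flip (e i)).smulRight (e i)
  have hφ : ∀ X, φ X = ∑ i, β X (e i) • e i := fun X ↦ by simp [φ, LinearMap.sum_apply]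
  have hφW : ∀ X, φ X ∈ W := fun X ↦ by
    rw [hφ]
    exact W.sum_mem fun i _ ↦ W.smul_mem _ (he.mem i)
  have hQφ : ∀ X, ∀ Y ∈ W, Q (φ X) Y = β X Y := fun X Y hY ↦ by
    have h : Q (φ X) Y = (Q ∘ₗ φ) X Y := rfl
    rw [h]
    refine he.ext_iff_left (fun j ↦ ?_) hY
    rw [LinearMap.comp_apply, hφ, he.apply_sum]
  have hext : ∀ X ∈ W, ∀ X' ∈ W, (∀ Y ∈ W, Q X Y = Q X' Y) → X = X' := by
    intro X hX X' hX' h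
    by_contra hne
    have h1 := hQ.pos (X - X') (sub_ne_zero.2 hne)
    have h2 := h (X - X') (W.sub_mem hX hX')
    rw [LinearMap.map_sub₂, h2, sub_self] at h1
    exact lt_irrefl _ h1
  have hequiv : ∀ a ∈ S, ∀ X, φ (Ad a X) = Ad a (φ X) := by
    intro a ha X
    refine hext _ (hφW _) _ (hW.invariant a ha _ (hφW X)) fun Y hY ↦ ?_
    have hY' := hW.invariant _ (S.inv_mem ha) Y hY
    rw [hQφ _ Y hY, ← Ad_Ad_inv a Y, hβ a ha, hQ.inv, hQφ _ _ hY']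
  have hker : IsAdInvariant S (V ⊓ LinearMap.ker φ) := fun a ha X hX ↦
    ⟨hV.invariant a ha X hX.1, LinearMap.mem_ker.2 (by
      rw [hequiv a ha, LinearMap.mem_ker.1 hX.2, map_zero])⟩
  have hran : IsAdInvariant S (V.map φ) := by
    rintro a ha _ ⟨X, hX, rfl⟩
    exact ⟨Ad a X, hV.invariant a ha X hX, hequiv a ha X⟩
  have hzero : (∀ X ∈ V, φ X = 0) → ∀ X ∈ V, ∀ Y ∈ W, β X Y = 0 := fun h X hX Y hY ↦ by
    rw [← hQφ X Y hY, h X hX, map_zero, LinearMap.zero_apply]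
  rcases hV.eq_bot_or_eq _ inf_le_left hker with h1 | h1
  swap
  · exact hzero fun X hX ↦ LinearMap.mem_ker.1 (h1.ge hX).2
  rcases hW.eq_bot_or_eq _ (by rintro _ ⟨X, _, rfl⟩; exact hφW X) hran with h2 | h2
  · exact hzero fun X hX ↦ (Submodule.mem_bot ℝ).1 (h2 ▸ Submodule.mem_map_of_mem hX)
  refine absurd ?_ hVW
  let ψ : V →ₗ[ℝ] W := (φ.domRestrict V).codRestrict W fun X ↦ hφW X
  have hψ : Function.Bijective ψ := by
    constructor
    · rw [← LinearMap.ker_eq_bot, LinearMap.ker_eq_bot']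
      intro X hX
      have h3 : (X : LieAlg E G) ∈ V ⊓ LinearMap.ker φ :=
        ⟨X.2, LinearMap.mem_ker.2 (congrArg Subtype.val hX)⟩
      rw [h1, Submodule.mem_bot] at h3
      exact Subtype.ext h3
    · rintro ⟨Y, hY⟩
      obtain ⟨X, hX, rfl⟩ := h2.ge hY
      exact ⟨⟨X, hX⟩, rfl⟩
  refine ⟨LinearEquiv.ofBijective ψ hψ, fun a ha X Y hXY ↦ ?_⟩
  change φ (Y : LieAlg E G) = Ad a (φ X)
  rw [hXY, hequiv a ha]

end Schur

/-! ### Invariant forms on the sum of two inequivalent irreducible summands -/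

section Splitting

variable {E : Type*} [NormedAddCommGroup E] [NormedSpace ℝ E]
  {G : Type*} [TopologicalSpace G] [ChartedSpace E G] [Group G]
  {d₁ d₂ q : ℕ}

/-- The form `z₁ Q|m₁ + z₂ Q|m₂`, in terms of orthonormal bases of `m₁` and `m₂`. -/
def diagForm (Q : LinearMap.BilinForm ℝ (LieAlg E G)) (e₁ : Fin d₁ → LieAlg E G)
    (e₂ : Fin d₂ → LieAlg E G) (z₁ z₂ : ℝ) : LinearMap.BilinForm ℝ (LieAlg E G) :=
  LinearMap.mk₂ ℝ (fun X Y ↦ ∑ i, Sum.elim (fun _ ↦ z₁) (fun _ ↦ z₂) i *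
      (Q X (Sum.elim e₁ e₂ i) * Q Y (Sum.elim e₁ e₂ i)))
    (fun X X' Y ↦ by
      simp only [map_add, LinearMap.add_apply, ← Finset.sum_add_distrib]
      exact Finset.sum_congr rfl fun i _ ↦ by ring)
    (fun c X Y ↦ by
      simp only [map_smul, LinearMap.smul_apply, smul_eq_mul, Finset.mul_sum]
      exact Finset.sum_congr rfl fun i _ ↦ by ring)
    (fun X X' Y ↦ by
      simp only [map_add, LinearMap.add_apply, ← Finset.sum_add_distrib]
      exact Finset.sum_congr rfl fun i _ ↦ by ring)
    (fun c X Y ↦ by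
      simp only [map_smul, LinearMap.smul_apply, smul_eq_mul, Finset.mul_sum]
      exact Finset.sum_congr rfl fun i _ ↦ by ring)

theorem diagForm_apply (Q : LinearMap.BilinForm ℝ (LieAlg E G)) (e₁ : Fin d₁ → LieAlg E G)
    (e₂ : Fin d₂ → LieAlg E G) (z₁ z₂ : ℝ) (X Y : LieAlg E G) :
    diagForm Q e₁ e₂ z₁ z₂ X Y = ∑ i, Sum.elim (fun _ ↦ z₁) (fun _ ↦ z₂) i *
      (Q X (Sum.elim e₁ e₂ i) * Q Y (Sum.elim e₁ e₂ i)) := rfl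

theorem diagForm_symm (Q : LinearMap.BilinForm ℝ (LieAlg E G)) (e₁ : Fin d₁ → LieAlg E G)
    (e₂ : Fin d₂ → LieAlg E G) (z₁ z₂ : ℝ) (X Y : LieAlg E G) :
    diagForm Q e₁ e₂ z₁ z₂ X Y = diagForm Q e₁ e₂ z₁ z₂ Y X := by
  simp only [diagForm_apply, mul_comm (Q X _)]

variable [LieGroup 𝓘(ℝ, E) ∞ G]

/-- The Lie algebra of `G` is the orthogonal sum of the Lie algebra of `H` and two inequivalent
irreducible summands `m₁`, `m₂`, such that `[m₁, m₁]` is orthogonal to `m₂`. -/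
structure IsTwoSummandSplitting (Q : LinearMap.BilinForm ℝ (LieAlg E G)) (H : Subgroup G)
    (m₁ m₂ : Submodule ℝ (LieAlg E G)) (e₁ : Fin d₁ → LieAlg E G) (e₂ : Fin d₂ → LieAlg E G)
    (w : Fin q → LieAlg E G) : Prop where
  scalar : IsAdInvariantScalarProduct Q
  sup_eq : m₁ ⊔ m₂ = Q.orthogonal (subgroupLieAlgebra H)
  perp : ∀ X ∈ m₁, ∀ Y ∈ m₂, Q X Y = 0
  irr₁ : IsAdIrreducible H m₁
  irr₂ : IsAdIrreducible H m₂
  inequiv : ¬ AdEquivalent H m₁ m₂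
  basis₁ : IsOrthonormalBasisOf Q m₁ e₁
  basis₂ : IsOrthonormalBasisOf Q m₂ e₂
  basis : IsOrthonormalBasisOf Q (subgroupLieAlgebra H) w
  lie₁ : ∀ X ∈ m₁, ∀ Y ∈ m₁, ∀ Z ∈ m₂, Q ⁅X, Y⁆ Z = 0

namespace IsTwoSummandSplitting

variable {Q : LinearMap.BilinForm ℝ (LieAlg E G)} {H : Subgroup G}
  {m₁ m₂ : Submodule ℝ (LieAlg E G)} {e₁ : Fin d₁ → LieAlg E G} {e₂ : Fin d₂ → LieAlg E G}
  {w : Fin q → LieAlg E G}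

theorem orth₁ (h : IsTwoSummandSplitting Q H m₁ m₂ e₁ e₂ w) {X Y : LieAlg E G}
    (hX : X ∈ subgroupLieAlgebra H) (hY : Y ∈ m₁) : Q X Y = 0 :=
  LinearMap.BilinForm.mem_orthogonal_iff.1 (h.sup_eq ▸ Submodule.mem_sup_left hY) X hX

theorem orth₂ (h : IsTwoSummandSplitting Q H m₁ m₂ e₁ e₂ w) {X Y : LieAlg E G}
    (hX : X ∈ subgroupLieAlgebra H) (hY : Y ∈ m₂) : Q X Y = 0 :=
  LinearMap.BilinForm.mem_orthogonal_iff.1 (h.sup_eq ▸ Submodule.mem_sup_right hY) X hX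

/-- Subtract the `Q`-orthogonal projection to the Lie algebra of `H`; the rest lies in the
orthogonal complement. -/
theorem exists_eq_add (h : IsTwoSummandSplitting Q H m₁ m₂ e₁ e₂ w) (X : LieAlg E G) :
    ∃ X₀ ∈ subgroupLieAlgebra H, ∃ X₁ ∈ m₁, ∃ X₂ ∈ m₂, X = X₀ + X₁ + X₂ := by
  have h0 : ∑ j, Q X (w j) • w j ∈ subgroupLieAlgebra H :=
    Submodule.sum_mem _ fun j _ ↦ Submodule.smul_mem _ _ (h.basis.mem j)
  have h1 : X - ∑ j, Q X (w j) • w j ∈ m₁ ⊔ m₂ := by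
    rw [h.sup_eq, LinearMap.BilinForm.mem_orthogonal_iff]
    intro Y hY
    change Q Y _ = 0
    rw [h.scalar.symm, LinearMap.map_sub₂, sub_eq_zero]
    rw [h.basis.eq_sum hY, map_sum, map_sum]
    simp only [map_smul, h.basis.apply_sum]
  obtain ⟨X₁, hX₁, X₂, hX₂, h12⟩ := Submodule.mem_sup.1 h1
  exact ⟨_, h0, X₁, hX₁, X₂, hX₂, by rw [add_assoc, h12, add_sub_cancel]⟩

theorem apply_add (h : IsTwoSummandSplitting Q H m₁ m₂ e₁ e₂ w)
    {X₀ X₁ X₂ Y₀ Y₁ Y₂ : LieAlg E G} (hX₀ : X₀ ∈ subgroupLieAlgebra H)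
    (hX₁ : X₁ ∈ m₁) (hX₂ : X₂ ∈ m₂) (hY₀ : Y₀ ∈ subgroupLieAlgebra H) (hY₁ : Y₁ ∈ m₁)
    (hY₂ : Y₂ ∈ m₂) : Q (X₀ + X₁ + X₂) (Y₀ + Y₁ + Y₂) = Q X₀ Y₀ + Q X₁ Y₁ + Q X₂ Y₂ := by
  simp only [map_add, LinearMap.add_apply]
  rw [h.orth₁ hX₀ hY₁, h.orth₂ hX₀ hY₂, h.perp _ hX₁ _ hY₂, h.scalar.symm X₁ Y₀,
    h.orth₁ hY₀ hX₁, h.scalar.symm X₂ Y₀, h.orth₂ hY₀ hX₂, h.scalar.symm X₂ Y₁,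
    h.perp _ hY₁ _ hX₂]
  ring

theorem diagForm_add (h : IsTwoSummandSplitting Q H m₁ m₂ e₁ e₂ w) (z₁ z₂ : ℝ)
    {X₀ X₁ X₂ Y₀ Y₁ Y₂ : LieAlg E G} (hX₀ : X₀ ∈ subgroupLieAlgebra H)
    (hX₁ : X₁ ∈ m₁) (hX₂ : X₂ ∈ m₂) (hY₀ : Y₀ ∈ subgroupLieAlgebra H) (hY₁ : Y₁ ∈ m₁)
    (hY₂ : Y₂ ∈ m₂) : diagForm Q e₁ e₂ z₁ z₂ (X₀ + X₁ + X₂) (Y₀ + Y₁ + Y₂)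
      = z₁ * Q X₁ Y₁ + z₂ * Q X₂ Y₂ := by
  have z0 := (subgroupLieAlgebra H : Submodule ℝ (LieAlg E G)).zero_mem
  have a₁ : ∀ {X₀ X₁ X₂ : LieAlg E G}, X₀ ∈ subgroupLieAlgebra H → X₁ ∈ m₁ → X₂ ∈ m₂ → ∀ i,
      Q (X₀ + X₁ + X₂) (e₁ i) = Q X₁ (e₁ i) := fun hX₀ hX₁ hX₂ i ↦ by
    simpa using h.apply_add hX₀ hX₁ hX₂ z0 (h.basis₁.mem i) m₂.zero_mem
  have a₂ : ∀ {X₀ X₁ X₂ : LieAlg E G}, X₀ ∈ subgroupLieAlgebra H → X₁ ∈ m₁ → X₂ ∈ m₂ → ∀ i,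
      Q (X₀ + X₁ + X₂) (e₂ i) = Q X₂ (e₂ i) := fun hX₀ hX₁ hX₂ i ↦ by
    simpa using h.apply_add hX₀ hX₁ hX₂ z0 m₁.zero_mem (h.basis₂.mem i)
  rw [diagForm_apply, Fintype.sum_sum_type]
  simp only [Sum.elim_inl, Sum.elim_inr]
  simp only [a₁ hX₀ hX₁ hX₂, a₁ hY₀ hY₁ hY₂, a₂ hX₀ hX₁ hX₂, a₂ hY₀ hY₁ hY₂, ← Finset.mul_sum]
  rw [h.basis₁.parseval hX₁ Y₁, h.basis₂.parseval hX₂ Y₂]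
  simp only [h.scalar.symm Y₁, h.scalar.symm Y₂]

theorem diagForm_left (h : IsTwoSummandSplitting Q H m₁ m₂ e₁ e₂ w) (z₁ z₂ : ℝ)
    {X Y : LieAlg E G} (hX : X ∈ m₁) (hY : Y ∈ m₁) :
    diagForm Q e₁ e₂ z₁ z₂ X Y = z₁ * Q X Y := by
  have z0 := (subgroupLieAlgebra H : Submodule ℝ (LieAlg E G)).zero_mem
  simpa using h.diagForm_add z₁ z₂ z0 hX m₂.zero_mem z0 hY m₂.zero_mem

theorem diagForm_right (h : IsTwoSummandSplitting Q H m₁ m₂ e₁ e₂ w) (z₁ z₂ : ℝ)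
    {X Y : LieAlg E G} (hX : X ∈ m₂) (hY : Y ∈ m₂) :
    diagForm Q e₁ e₂ z₁ z₂ X Y = z₂ * Q X Y := by
  have z0 := (subgroupLieAlgebra H : Submodule ℝ (LieAlg E G)).zero_mem
  simpa using h.diagForm_add z₁ z₂ z0 m₁.zero_mem hX z0 m₁.zero_mem hY

theorem diagForm_inj (h : IsTwoSummandSplitting Q H m₁ m₂ e₁ e₂ w) {z₁ z₂ z₁' z₂' : ℝ}
    (hz : ∀ X Y, diagForm Q e₁ e₂ z₁ z₂ X Y = diagForm Q e₁ e₂ z₁' z₂' X Y) :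
    z₁ = z₁' ∧ z₂ = z₂' := by
  obtain ⟨i⟩ := h.basis₁.nonempty h.irr₁.ne_bot
  obtain ⟨j⟩ := h.basis₂.nonempty h.irr₂.ne_bot
  have h1 := hz (e₁ i) (e₁ i)
  have h2 := hz (e₂ j) (e₂ j)
  rw [h.diagForm_left _ _ (h.basis₁.mem i) (h.basis₁.mem i),
    h.diagForm_left _ _ (h.basis₁.mem i) (h.basis₁.mem i), h.basis₁.orthonormal] at h1
  rw [h.diagForm_right _ _ (h.basis₂.mem j) (h.basis₂.mem j),
    h.diagForm_right _ _ (h.basis₂.mem j) (h.basis₂.mem j), h.basis₂.orthonormal] at h2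
  simpa using And.intro h1 h2

/-- The `Ad(H)`-invariant forms on the tangent space of `G/H`. -/
theorem exists_eq_diagForm (h : IsTwoSummandSplitting Q H m₁ m₂ e₁ e₂ w)
    (β : LinearMap.BilinForm ℝ (LieAlg E G))
    (hβ : ∀ a ∈ H, ∀ X Y, β (Ad a X) (Ad a Y) = β X Y)
    (hl : ∀ X ∈ subgroupLieAlgebra H, ∀ Y, β X Y = 0)
    (hr : ∀ X ∈ subgroupLieAlgebra H, ∀ Y, β Y X = 0)
    (hs₁ : ∀ X ∈ m₁, ∀ Y ∈ m₁, β X Y = β Y X) (hs₂ : ∀ X ∈ m₂, ∀ Y ∈ m₂, β X Y = β Y X) :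
    ∃ z₁ z₂ : ℝ, ∀ X Y, β X Y = diagForm Q e₁ e₂ z₁ z₂ X Y := by
  obtain ⟨z₁, hz₁⟩ := h.irr₁.exists_form_eq h.scalar h.basis₁ β hs₁ fun a ha X _ Y _ ↦ hβ a ha X Y
  obtain ⟨z₂, hz₂⟩ := h.irr₂.exists_form_eq h.scalar h.basis₂ β hs₂ fun a ha X _ Y _ ↦ hβ a ha X Y
  -- Symmetry of `β` is known only within each summand, so the off-diagonal blocks are removed
  -- separately, the second one through `β.flip`.
  have h12 := h.irr₁.form_eq_zero h.irr₂ h.inequiv h.scalar h.basis₂ β hβ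
  have h21 := h.irr₁.form_eq_zero h.irr₂ h.inequiv h.scalar h.basis₂ β.flip
    fun a ha X Y ↦ hβ a ha Y X
  refine ⟨z₁, z₂, fun X Y ↦ ?_⟩
  obtain ⟨X₀, hX₀, X₁, hX₁, X₂, hX₂, rfl⟩ := h.exists_eq_add X
  obtain ⟨Y₀, hY₀, Y₁, hY₁, Y₂, hY₂, rfl⟩ := h.exists_eq_add Y
  rw [h.diagForm_add z₁ z₂ hX₀ hX₁ hX₂ hY₀ hY₁ hY₂]
  have h21' : β X₂ Y₁ = 0 := h21 _ hY₁ _ hX₂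
  simp only [map_add, LinearMap.add_apply]
  rw [hl _ hX₀, hl _ hX₀, hl _ hX₀, hr _ hY₀, hr _ hY₀, hz₁ _ hX₁ _ hY₁, hz₂ _ hX₂ _ hY₂,
    h12 _ hX₁ _ hY₂, h21']
  ring

theorem diagForm_Ad (h : IsTwoSummandSplitting Q H m₁ m₂ e₁ e₂ w) (z₁ z₂ : ℝ) {a : G}
    (ha : a ∈ H) (X Y : LieAlg E G) :
    diagForm Q e₁ e₂ z₁ z₂ (Ad a X) (Ad a Y) = diagForm Q e₁ e₂ z₁ z₂ X Y := by
  obtain ⟨X₀, hX₀, X₁, hX₁, X₂, hX₂, rfl⟩ := h.exists_eq_add X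
  obtain ⟨Y₀, hY₀, Y₁, hY₁, Y₂, hY₂, rfl⟩ := h.exists_eq_add Y
  have h0 := isAdInvariant_subgroupLieAlgebra (E := E) H
  rw [h.diagForm_add z₁ z₂ hX₀ hX₁ hX₂ hY₀ hY₁ hY₂]
  rw [map_add (Ad a), map_add (Ad a), map_add (Ad a), map_add (Ad a),
    h.diagForm_add z₁ z₂ (h0 a ha _ hX₀) (h.irr₁.invariant a ha _ hX₁)
    (h.irr₂.invariant a ha _ hX₂) (h0 a ha _ hY₀) (h.irr₁.invariant a ha _ hY₁)
    (h.irr₂.invariant a ha _ hY₂), h.scalar.inv, h.scalar.inv]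

theorem diagForm_of_mem (h : IsTwoSummandSplitting Q H m₁ m₂ e₁ e₂ w) (z₁ z₂ : ℝ)
    {X : LieAlg E G} (hX : X ∈ subgroupLieAlgebra H) (Y : LieAlg E G) :
    diagForm Q e₁ e₂ z₁ z₂ X Y = 0 := by
  obtain ⟨Y₀, hY₀, Y₁, hY₁, Y₂, hY₂, rfl⟩ := h.exists_eq_add Y
  simpa using h.diagForm_add z₁ z₂ hX m₁.zero_mem m₂.zero_mem hY₀ hY₁ hY₂

theorem nonneg_apply (h : IsTwoSummandSplitting Q H m₁ m₂ e₁ e₂ w) (X : LieAlg E G) :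
    0 ≤ Q X X := by
  rcases eq_or_ne X 0 with rfl | hX
  · simp
  · exact (h.scalar.pos X hX).le

theorem diagForm_pos (h : IsTwoSummandSplitting Q H m₁ m₂ e₁ e₂ w) {z₁ z₂ : ℝ}
    (hz₁ : 0 < z₁) (hz₂ : 0 < z₂) {X : LieAlg E G} (hX : X ∉ subgroupLieAlgebra H) :
    0 < diagForm Q e₁ e₂ z₁ z₂ X X := by
  obtain ⟨X₀, hX₀, X₁, hX₁, X₂, hX₂, rfl⟩ := h.exists_eq_add X
  rw [h.diagForm_add z₁ z₂ hX₀ hX₁ hX₂ hX₀ hX₁ hX₂]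
  have h1 := h.nonneg_apply X₁
  have h2 := h.nonneg_apply X₂
  by_cases h3 : X₁ = 0
  · by_cases h4 : X₂ = 0
    · simp [h3, h4, hX₀] at hX
    · have := h.scalar.pos X₂ h4
      positivity
  · have := h.scalar.pos X₁ h3
    positivity

theorem orthonormal (h : IsTwoSummandSplitting Q H m₁ m₂ e₁ e₂ w) (i j : Fin d₁ ⊕ Fin d₂) :
    Q (Sum.elim e₁ e₂ i) (Sum.elim e₁ e₂ j) = if i = j then 1 else 0 := by
  rcases i with i | i <;> rcases j with j | j
  · simp [h.basis₁.orthonormal]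
  · simp [h.perp _ (h.basis₁.mem i) _ (h.basis₂.mem j)]
  · simp [h.scalar.symm (e₂ i), h.perp _ (h.basis₁.mem j) _ (h.basis₂.mem i)]
  · simp [h.basis₂.orthonormal]

theorem parseval (h : IsTwoSummandSplitting Q H m₁ m₂ e₁ e₂ w) (X : LieAlg E G) :
    Q X X = ∑ j, Q X (w j) ^ 2 + ∑ i, Q X (Sum.elim e₁ e₂ i) ^ 2 := by
  have h1 : diagForm Q e₁ e₂ 1 1 X X = ∑ i, Q X (Sum.elim e₁ e₂ i) ^ 2 := by
    rw [diagForm_apply]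
    refine Finset.sum_congr rfl fun i _ ↦ ?_
    rcases i with i | i <;> simp [sq]
  obtain ⟨X₀, hX₀, X₁, hX₁, X₂, hX₂, rfl⟩ := h.exists_eq_add X
  rw [← h1, h.diagForm_add 1 1 hX₀ hX₁ hX₂ hX₀ hX₁ hX₂, h.apply_add hX₀ hX₁ hX₂ hX₀ hX₁ hX₂]
  have h2 : ∀ j, Q (X₀ + X₁ + X₂) (w j) = Q X₀ (w j) := fun j ↦ by
    simpa using h.apply_add hX₀ hX₁ hX₂ (h.basis.mem j) m₁.zero_mem m₂.zero_mem
  simp only [h2]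
  rw [h.basis.parseval hX₀ X₀]
  simp only [h.scalar.symm (w _), sq]
  ring

end IsTwoSummandSplitting

end Splitting

/-! ### Bilinearity of the Ricci curvature -/

section RicciBilinear

variable {F : Type*} [NormedAddCommGroup F] [NormedSpace ℝ F]

theorem curvatureMap_add_left (B : F → F →L[ℝ] F →L[ℝ] ℝ) (y v v' w : F) :
    curvatureMap B y (v + v') w = curvatureMap B y v w + curvatureMap B y v' w := by
  ext u
  simp only [curvatureMap_apply, map_add, add_apply]
  abel

theorem curvatureMap_smul_left (B : F → F →L[ℝ] F →L[ℝ] ℝ) (y : F) (c : ℝ) (v w : F) :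
    curvatureMap B y (c • v) w = c • curvatureMap B y v w := by
  ext u
  simp only [curvatureMap_apply, map_smul, smul_apply, smul_add, smul_sub]

theorem curvatureMap_add_right (B : F → F →L[ℝ] F →L[ℝ] ℝ) (y v w w' : F) :
    curvatureMap B y v (w + w') = curvatureMap B y v w + curvatureMap B y v w' := by
  ext u
  simp only [curvatureMap_apply, map_add, add_apply]
  abel

theorem curvatureMap_smul_right (B : F → F →L[ℝ] F →L[ℝ] ℝ) (y : F) (c : ℝ) (v w : F) :
    curvatureMap B y v (c • w) = c • curvatureMap B y v w := by
  ext u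
  simp only [curvatureMap_apply, map_smul, smul_apply, smul_add, smul_sub]

/-- The Ricci curvature as a bilinear map. -/
def flatRicciForm (B : F → F →L[ℝ] F →L[ℝ] ℝ) (y : F) : F →ₗ[ℝ] F →ₗ[ℝ] ℝ :=
  LinearMap.mk₂ ℝ (flatRicci B y)
    (fun v v' w ↦ by
      rw [flatRicci, curvatureMap_add_left, ContinuousLinearMap.toLinearMap_add, map_add]; rfl)
    (fun c v w ↦ by
      rw [flatRicci, curvatureMap_smul_left, ContinuousLinearMap.toLinearMap_smul, map_smul]; rfl)
    (fun v w w' ↦ by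
      rw [flatRicci, curvatureMap_add_right, ContinuousLinearMap.toLinearMap_add, map_add]; rfl)
    (fun c v w ↦ by
      rw [flatRicci, curvatureMap_smul_right, ContinuousLinearMap.toLinearMap_smul, map_smul]; rfl)

end RicciBilinear

/-! ### Invariant tensor fields and their values at the base point -/

section InvariantFields

variable {E : Type*} [NormedAddCommGroup E] [NormedSpace ℝ E]
  {G : Type*} [TopologicalSpace G] [ChartedSpace E G] [Group G]
  {H : Subgroup G} {F : Type*} [NormedAddCommGroup F] [NormedSpace ℝ F]
  [ChartedSpace F (G ⧸ H)]

/-- The pull-back to the Lie algebra of `G` of a bilinear form on the tangent space of `G/H` at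
the base point. -/
def pullForm (E : Type*) [NormedAddCommGroup E] [NormedSpace ℝ E] [ChartedSpace E G]
    (b : F →ₗ[ℝ] F →ₗ[ℝ] ℝ) : LinearMap.BilinForm ℝ (LieAlg E G) :=
  (b.compl₁₂ (projDeriv E H F).toLinearMap (projDeriv E H F).toLinearMap : E →ₗ[ℝ] E →ₗ[ℝ] ℝ)

/-- The value at the base point of a field of bilinear forms, as a form on the Lie algebra. -/
def baseForm (E : Type*) [NormedAddCommGroup E] [NormedSpace ℝ E] [ChartedSpace E G]
    (B : BilinField F (G ⧸ H)) : LinearMap.BilinForm ℝ (LieAlg E G) :=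
  pullForm (H := H) E (ContinuousLinearMap.coeLM ℝ ∘ₗ (modelForm B (basePt H)).toLinearMap)

/-- The Ricci curvature of a metric on `G/H` at the base point, as a form on the Lie algebra. -/
def ricciForm (E : Type*) [NormedAddCommGroup E] [NormedSpace ℝ E] [ChartedSpace E G]
    [IsManifold 𝓘(ℝ, F) ∞ (G ⧸ H)]
    (g : RiemMetric F (G ⧸ H)) : LinearMap.BilinForm ℝ (LieAlg E G) :=
  pullForm (H := H) E (flatRicciForm (inChart g.inner (basePt H))
    (extChartAt 𝓘(ℝ, F) (basePt H) (basePt H)))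

theorem ricciForm_apply [IsManifold 𝓘(ℝ, F) ∞ (G ⧸ H)]
    (g : RiemMetric F (G ⧸ H)) (X Y : LieAlg E G) :
    ricciForm E g X Y = ricci g (basePt H) (projDeriv E H F X) (projDeriv E H F Y) := by
  rw [ricci_eq_flatRicci]
  rfl

variable [LieGroup 𝓘(ℝ, E) ∞ G]

theorem pullForm_of_mem_left
    (hproj : Manifold.IsSubmersion 𝓘(ℝ, E) 𝓘(ℝ, F) ∞ (fun x : G ↦ (x : G ⧸ H)))
    (b : F →ₗ[ℝ] F →ₗ[ℝ] ℝ) {X : LieAlg E G} (hX : X ∈ subgroupLieAlgebra H) (Y : LieAlg E G) :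
    pullForm (H := H) E b X Y = 0 := by
  have h : pullForm (H := H) E b X Y = b (projDeriv E H F X) (projDeriv E H F Y) := rfl
  rw [h, (mem_subgroupLieAlgebra_iff_projDeriv hproj X).1 hX, map_zero, LinearMap.zero_apply]

theorem pullForm_of_mem_right
    (hproj : Manifold.IsSubmersion 𝓘(ℝ, E) 𝓘(ℝ, F) ∞ (fun x : G ↦ (x : G ⧸ H)))
    (b : F →ₗ[ℝ] F →ₗ[ℝ] ℝ) {X : LieAlg E G} (hX : X ∈ subgroupLieAlgebra H) (Y : LieAlg E G) :
    pullForm (H := H) E b Y X = 0 := by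
  have h : pullForm (H := H) E b Y X = b (projDeriv E H F Y) (projDeriv E H F X) := rfl
  rw [h, (mem_subgroupLieAlgebra_iff_projDeriv hproj X).1 hX, map_zero]

theorem smul_basePt_of_mem {G : Type*} [Group G] {H : Subgroup G} {a : G} (ha : a ∈ H) :
    a • basePt H = basePt H :=
  QuotientGroup.eq.2 (by simpa using ha)

theorem modelForm_projDeriv_AdModel
    (hproj : Manifold.IsSubmersion 𝓘(ℝ, E) 𝓘(ℝ, F) ∞ (fun x : G ↦ (x : G ⧸ H)))
    {B : BilinField F (G ⧸ H)} (hB : IsInvariantField G B) {a : G} (ha : a ∈ H) (X Y : E) :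
    modelForm B (basePt H) (projDeriv E H F (AdModel a X)) (projDeriv E H F (AdModel a Y))
      = modelForm B (basePt H) (projDeriv E H F X) (projDeriv E H F Y) := by
  have h := hB.modelForm_eq a (basePt H) (projDeriv E H F X) (projDeriv E H F Y)
  rwa [smul_basePt_of_mem ha, ← projDeriv_AdModel hproj ha, ← projDeriv_AdModel hproj ha] at h

theorem baseForm_Ad
    (hproj : Manifold.IsSubmersion 𝓘(ℝ, E) 𝓘(ℝ, F) ∞ (fun x : G ↦ (x : G ⧸ H)))
    {B : BilinField F (G ⧸ H)} (hB : IsInvariantField G B) {a : G} (ha : a ∈ H)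
    (X Y : LieAlg E G) : baseForm E B (Ad a X) (Ad a Y) = baseForm E B X Y :=
  modelForm_projDeriv_AdModel (E := E) hproj hB ha X Y

theorem exists_eq_smul_basePt {G : Type*} [Group G] {H : Subgroup G} (p : G ⧸ H) :
    ∃ a : G, a • basePt H = p := by
  obtain ⟨a, rfl⟩ := QuotientGroup.mk_surjective p
  exact ⟨a, congrArg (QuotientGroup.mk (s := H)) (mul_one a)⟩

theorem surjective_actDeriv
    (hproj : Manifold.IsSubmersion 𝓘(ℝ, E) 𝓘(ℝ, F) ∞ (fun x : G ↦ (x : G ⧸ H))) (a : G)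
    (p : G ⧸ H) : Function.Surjective (actDeriv F a p) := fun v ↦ by
  refine ⟨actDeriv F a⁻¹ (a • p) v, ?_⟩
  have h := actDeriv_mul hproj a a⁻¹ (a • p) v
  rw [mul_inv_cancel, actDeriv_one, inv_smul_smul] at h
  exact h.symm

theorem exists_eq_actDeriv_projDeriv
    (hproj : Manifold.IsSubmersion 𝓘(ℝ, E) 𝓘(ℝ, F) ∞ (fun x : G ↦ (x : G ⧸ H))) (a : G) (u : F) :
    ∃ X : E, actDeriv F a (basePt H) (projDeriv E H F X) = u := by
  obtain ⟨v, rfl⟩ := surjective_actDeriv hproj a (basePt H) u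
  obtain ⟨X, rfl⟩ := surjective_projDeriv hproj v
  exact ⟨X, rfl⟩

/-- By transitivity every tangent vector is the translate of a vector at the base point, so an
invariant field is determined by its value there. -/
theorem IsInvariantField.eq_mul_of_baseForm
    (hproj : Manifold.IsSubmersion 𝓘(ℝ, E) 𝓘(ℝ, F) ∞ (fun x : G ↦ (x : G ⧸ H)))
    {B B' : BilinField F (G ⧸ H)} (hB : IsInvariantField G B) (hB' : IsInvariantField G B') {t : ℝ}
    (h : ∀ X Y, baseForm E B' X Y = t * baseForm E B X Y) (p : G ⧸ H) (u v : F) :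
    modelForm B' p u v = t * modelForm B p u v := by
  obtain ⟨a, rfl⟩ := exists_eq_smul_basePt p
  obtain ⟨X, rfl⟩ := exists_eq_actDeriv_projDeriv hproj a u
  obtain ⟨Y, rfl⟩ := exists_eq_actDeriv_projDeriv hproj a v
  rw [hB.modelForm_eq, hB'.modelForm_eq]
  exact h X Y

end InvariantFields

/-! ### The Casimir operator of the isotropy representation -/

section Casimir

variable {E : Type*} [NormedAddCommGroup E] [NormedSpace ℝ E] [CompleteSpace E]
  {G : Type*} [TopologicalSpace G] [ChartedSpace E G] [Group G]
  [LieGroup 𝓘(ℝ, E) (minSmoothness ℝ 3) G]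
  {Q : LinearMap.BilinForm ℝ (LieAlg E G)} {S : Subgroup G} {V : Submodule ℝ (LieAlg E G)}
  {d q : ℕ} {e : Fin d → LieAlg E G} {w : Fin q → LieAlg E G}

/-- The form `Q([U, X], [U', Y])` in `U` and `U'`. -/
def lieForm (Q : LinearMap.BilinForm ℝ (LieAlg E G)) (X Y : LieAlg E G) :
    LinearMap.BilinForm ℝ (LieAlg E G) :=
  LinearMap.mk₂ ℝ (fun U U' ↦ Q ⁅U, X⁆ ⁅U', Y⁆) (fun _ _ _ ↦ by simp) (fun _ _ _ ↦ by simp)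
    (fun _ _ _ ↦ by simp) (fun _ _ _ ↦ by simp)

/-- The form `∑ Q([w_j, X], [w_j, Y])` in `X` and `Y`. -/
def casimirForm (Q : LinearMap.BilinForm ℝ (LieAlg E G)) (w : Fin q → LieAlg E G) :
    LinearMap.BilinForm ℝ (LieAlg E G) :=
  LinearMap.mk₂ ℝ (fun X Y ↦ ∑ j, Q ⁅w j, X⁆ ⁅w j, Y⁆)
    (fun _ _ _ ↦ by simp [Finset.sum_add_distrib]) (fun _ _ _ ↦ by simp [Finset.mul_sum])
    (fun _ _ _ ↦ by simp [Finset.sum_add_distrib]) (fun _ _ _ ↦ by simp [Finset.mul_sum])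

theorem casimirForm_apply (Q : LinearMap.BilinForm ℝ (LieAlg E G)) (w : Fin q → LieAlg E G)
    (X Y : LieAlg E G) : casimirForm Q w X Y = ∑ j, Q ⁅w j, X⁆ ⁅w j, Y⁆ := rfl

variable [LieGroup 𝓘(ℝ, E) ∞ G]

/-- Each `ad w_j` is skew for `Q`. In this form the operator is visibly symmetric and positive
semidefinite. -/
theorem form_casimir [FiniteDimensional ℝ E] (hQ : IsAdInvariantScalarProduct Q) (X Y : LieAlg E G) :
    Q (casimir w X) Y = casimirForm Q w X Y := by
  rw [casimir, LinearMap.map_neg₂, map_sum, LinearMap.sum_apply, casimirForm_apply,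
    ← Finset.sum_neg_distrib]
  exact Finset.sum_congr rfl fun j _ ↦ by rw [hQ.lie_left, neg_neg]

/-- `Ad a` carries the orthonormal basis `w` of the Lie algebra of `S` to another one, and the trace
of a form does not depend on the basis. -/
theorem casimirForm_Ad (hQ : IsAdInvariantScalarProduct Q)
    (hw : IsOrthonormalBasisOf Q (subgroupLieAlgebra S) w) {a : G} (ha : a ∈ S)
    (X Y : LieAlg E G) : casimirForm Q w (Ad a X) (Ad a Y) = casimirForm Q w X Y := by
  have h := hw.sum_apply_eq hQ.symm (hw.Ad hQ (isAdInvariant_subgroupLieAlgebra S) ha)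
    (lieForm Q (Ad a X) (Ad a Y))
  refine h.trans (Finset.sum_congr rfl fun j _ ↦ ?_)
  change Q ⁅Ad a (w j), Ad a X⁆ ⁅Ad a (w j), Ad a Y⁆ = _
  rw [← Ad_lie, ← Ad_lie, hQ.inv]

/-- Schur's lemma for `casimirForm`; the constant is a sum of squared lengths at a unit vector,
hence nonnegative. -/
theorem IsAdIrreducible.exists_casimir_eq [FiniteDimensional ℝ E] (hV : IsAdIrreducible S V)
    (hQ : IsAdInvariantScalarProduct Q) (he : IsOrthonormalBasisOf Q V e)
    (hw : IsOrthonormalBasisOf Q (subgroupLieAlgebra S) w) :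
    ∃ ζ : ℝ, 0 ≤ ζ ∧ ∀ X ∈ V, casimir w X = ζ • X := by
  obtain ⟨ζ, hζ⟩ := hV.exists_form_eq hQ he (casimirForm Q w)
    (fun X _ Y _ ↦ by simp only [casimirForm_apply, hQ.symm ⁅_, X⁆])
    (fun a ha X _ Y _ ↦ casimirForm_Ad hQ hw ha X Y)
  refine ⟨ζ, ?_, fun X hX ↦ ?_⟩
  · obtain ⟨i⟩ := he.nonempty hV.ne_bot
    have h1 := hζ _ (he.mem i) _ (he.mem i)
    rw [he.orthonormal, if_pos rfl, mul_one, casimirForm_apply] at h1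
    rw [← h1]
    refine Finset.sum_nonneg fun j _ ↦ ?_
    rcases eq_or_ne ⁅w j, e i⁆ 0 with h0 | h0
    · rw [h0]; simp
    · exact (hQ.pos _ h0).le
  · have hmem : casimir w X ∈ V := V.neg_mem (V.sum_mem fun j _ ↦
      lie_mem_of_isAdInvariant hV.invariant (hw.mem j)
        (lie_mem_of_isAdInvariant hV.invariant (hw.mem j) hX))
    rw [he.eq_sum hmem]
    conv_rhs => rw [he.eq_sum hX, Finset.smul_sum]
    refine Finset.sum_congr rfl fun i _ ↦ ?_
    rw [form_casimir hQ, hζ X hX _ (he.mem i), mul_smul]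

end Casimir

theorem IsOrthonormalBasisOf.form_comm {E : Type*} [NormedAddCommGroup E] [NormedSpace ℝ E]
    {G : Type*} [TopologicalSpace G] [ChartedSpace E G] [Group G]
    {Q : LinearMap.BilinForm ℝ (LieAlg E G)} {V : Submodule ℝ (LieAlg E G)}
    {d : ℕ} {e : Fin d → LieAlg E G} (he : IsOrthonormalBasisOf Q V e)
    {β : LinearMap.BilinForm ℝ (LieAlg E G)} (h : ∀ i j, β (e i) (e j) = β (e j) (e i)) :
    ∀ X ∈ V, ∀ Y ∈ V, β X Y = β Y X := fun _ hX _ hY ↦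
  he.ext_iff_left (β' := β.flip)
    (fun i ↦ (he.ext_iff_left (β := β) (β' := β.flip) (fun j ↦ h i j) hX).symm) hY

/-! ### Ricci curvature of an invariant metric with two summands -/

section RicciOfSplitting

variable {E : Type*} [NormedAddCommGroup E] [NormedSpace ℝ E]
  {G : Type*} [TopologicalSpace G] [ChartedSpace E G] [Group G] [LieGroup 𝓘(ℝ, E) ∞ G]
  {d₁ d₂ q : ℕ} {Q : LinearMap.BilinForm ℝ (LieAlg E G)} {H : Subgroup G}
  {m₁ m₂ : Submodule ℝ (LieAlg E G)} {e₁ : Fin d₁ → LieAlg E G} {e₂ : Fin d₂ → LieAlg E G}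
  {w : Fin q → LieAlg E G}
  {F : Type*} [NormedAddCommGroup F] [NormedSpace ℝ F] [ChartedSpace F (G ⧸ H)]

namespace IsTwoSummandSplitting

theorem span_projDeriv (h : IsTwoSummandSplitting Q H m₁ m₂ e₁ e₂ w)
    (hproj : Manifold.IsSubmersion 𝓘(ℝ, E) 𝓘(ℝ, F) ∞ (fun x : G ↦ (x : G ⧸ H))) :
    ⊤ ≤ Submodule.span ℝ (Set.range fun i ↦ projDeriv E H F (Sum.elim e₁ e₂ i)) := by
  intro u _
  obtain ⟨X, rfl⟩ := surjective_projDeriv hproj u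
  obtain ⟨X₀, hX₀, X₁, hX₁, X₂, hX₂, hX⟩ := h.exists_eq_add X
  let π : LieAlg E G →ₗ[ℝ] F := (projDeriv E H F).toLinearMap
  have h0 : π X₀ = 0 := (mem_subgroupLieAlgebra_iff_projDeriv hproj X₀).1 hX₀
  have h1 : π X = π X₁ + π X₂ := by rw [hX, map_add, map_add, h0, zero_add]
  change π X ∈ _
  rw [h1, h.basis₁.eq_sum hX₁, h.basis₂.eq_sum hX₂, map_sum, map_sum]
  refine Submodule.add_mem _ (Submodule.sum_mem _ fun i _ ↦ ?_)
    (Submodule.sum_mem _ fun i _ ↦ ?_) <;> rw [map_smul]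
  · exact Submodule.smul_mem _ _ (Submodule.subset_span ⟨Sum.inl i, rfl⟩)
  · exact Submodule.smul_mem _ _ (Submodule.subset_span ⟨Sum.inr i, rfl⟩)

variable [FiniteDimensional ℝ E]

theorem lie_mem₁ (h : IsTwoSummandSplitting Q H m₁ m₂ e₁ e₂ w) (j : Fin q) (c : Fin d₁) :
    ⁅w j, e₁ c⁆ ∈ m₁ :=
  lie_mem_of_isAdInvariant h.irr₁.invariant (h.basis.mem j) (h.basis₁.mem c)

theorem lie_mem₂ (h : IsTwoSummandSplitting Q H m₁ m₂ e₁ e₂ w) (j : Fin q) (c : Fin d₂) :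
    ⁅w j, e₂ c⁆ ∈ m₂ :=
  lie_mem_of_isAdInvariant h.irr₂.invariant (h.basis.mem j) (h.basis₂.mem c)

theorem lie_apply_isotropy (h : IsTwoSummandSplitting Q H m₁ m₂ e₁ e₂ w) (j : Fin q)
    (c : Fin d₁ ⊕ Fin d₂) (k : Fin q) : Q ⁅w j, Sum.elim e₁ e₂ c⁆ (w k) = 0 := by
  rw [h.scalar.symm]
  rcases c with c | c
  · exact h.orth₁ (h.basis.mem k) (h.lie_mem₁ j c)
  · exact h.orth₂ (h.basis.mem k) (h.lie_mem₂ j c)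

theorem lie_apply_of_ne (h : IsTwoSummandSplitting Q H m₁ m₂ e₁ e₂ w) (x₁ x₂ : ℝ) (j : Fin q)
    (c i : Fin d₁ ⊕ Fin d₂) (hne : (Sum.elim (fun _ ↦ x₁) (fun _ ↦ x₂) i : ℝ)
      ≠ Sum.elim (fun _ ↦ x₁) (fun _ ↦ x₂) c) :
    Q ⁅w j, Sum.elim e₁ e₂ c⁆ (Sum.elim e₁ e₂ i) = 0 := by
  rcases c with c | c <;> rcases i with i | i
  · exact absurd rfl hne
  · exact h.perp _ (h.lie_mem₁ j c) _ (h.basis₂.mem i)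
  · rw [h.scalar.symm]
    exact h.perp _ (h.basis₁.mem i) _ (h.lie_mem₂ j c)
  · exact absurd rfl hne

variable [CompleteSpace E] [LieGroup 𝓘(ℝ, E) (minSmoothness ℝ 3) G] [FiniteDimensional ℝ F]
  [IsManifold 𝓘(ℝ, F) ∞ (G ⧸ H)]

theorem two_mul_ricci (h : IsTwoSummandSplitting Q H m₁ m₂ e₁ e₂ w)
    (hproj : Manifold.IsSubmersion 𝓘(ℝ, E) 𝓘(ℝ, F) ∞ (fun x : G ↦ (x : G ⧸ H)))
    {g : RiemMetric F (G ⧸ H)} (hg : IsInvariantField G g.inner) {x₁ x₂ : ℝ} (hx₁ : 0 < x₁)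
    (hx₂ : 0 < x₂) {x : Fin d₁ ⊕ Fin d₂ → ℝ} (hx : x = Sum.elim (fun _ ↦ x₁) (fun _ ↦ x₂))
    {f : Fin d₁ ⊕ Fin d₂ → LieAlg E G} (hf : f = Sum.elim e₁ e₂)
    {b : LieAlg E G → LieAlg E G → ℝ} (hb : ∀ X Y, b X Y = atBasePoint g.inner X Y)
    (hgx : ∀ X Y, atBasePoint g.inner X Y = diagForm Q e₁ e₂ x₁ x₂ X Y) (a : G)
    (Y Z : LieAlg E G) :
    2 * ricci g (a • basePt H) (actDeriv F a (basePt H) (projDeriv E H F Y))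
        (actDeriv F a (basePt H) (projDeriv E H F Z))
      = ∑ i, (x i)⁻¹ * (b ⁅f i, ⁅Z, f i⁆⁆ Y - b ⁅Y, ⁅Z, f i⁆⁆ (f i) - b ⁅Z, f i⁆ ⁅Y, f i⁆)
        + ∑ i, ∑ j, (x i)⁻¹ * (x j)⁻¹ * 2⁻¹ *
          ((b ⁅f i, Z⁆ (f j) + b ⁅f i, f j⁆ Z + b ⁅Z, f j⁆ (f i)) *
            (b ⁅Y, f i⁆ (f j) + b ⁅Y, f j⁆ (f i) + b ⁅f i, f j⁆ Y)) := by
  have hff : ∀ i j, Q (f i) (f j) = if i = j then 1 else 0 := hf ▸ h.orthonormal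
  have hbx : ∀ X Y, b X Y = ∑ i, x i * (Q X (f i) * Q Y (f i)) := fun X Y ↦ by
    rw [hb, hgx, diagForm_apply, hx, hf]
  have hbf : ∀ X c, b X (f c) = x c * Q X (f c) := fun X c ↦ (diagonal_form_apply hff hbx X c).1
  refine two_mul_ricci_homogeneous hproj hg (l := x) (fun i ↦ ?_) hb (fun i j hij ↦ ?_)
    (fun i ↦ ?_) (hf ▸ h.span_projDeriv hproj) (fun i j ↦ ?_) a Y Z
  · rw [hx]
    rcases i with i | i
    exacts [hx₁, hx₂]
  · rw [hbf, hff, if_neg hij, mul_zero]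
  · rw [hbf, hff, if_pos rfl, mul_one]
  -- `b ⁅f i, f j⁆ (f i)` is a multiple of `Q ⁅f i, f j⁆ (f i)`, which the cyclic identity turns
  -- into `Q ⁅f i, f i⁆ (f j) = 0`.
  · rw [hbf, lie_form_cyclic h.scalar.symm h.scalar.lie_left,
      lie_form_cyclic h.scalar.symm h.scalar.lie_left, lie_self, map_zero, LinearMap.zero_apply,
      mul_zero]

/-- The formula for the Ricci curvature at `a • o` has a right side free of `a`; comparing with `a =
1` gives invariance. -/
theorem ricci_smul (h : IsTwoSummandSplitting Q H m₁ m₂ e₁ e₂ w)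
    (hproj : Manifold.IsSubmersion 𝓘(ℝ, E) 𝓘(ℝ, F) ∞ (fun x : G ↦ (x : G ⧸ H)))
    {g : RiemMetric F (G ⧸ H)} (hg : IsInvariantField G g.inner) {x₁ x₂ : ℝ} (hx₁ : 0 < x₁)
    (hx₂ : 0 < x₂) (hgx : ∀ X Y, atBasePoint g.inner X Y = diagForm Q e₁ e₂ x₁ x₂ X Y) (a : G)
    (Y Z : LieAlg E G) :
    ricci g (a • basePt H) (actDeriv F a (basePt H) (projDeriv E H F Y))
        (actDeriv F a (basePt H) (projDeriv E H F Z)) = ricciForm E g Y Z := by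
  have h1 := h.two_mul_ricci hproj hg hx₁ hx₂ rfl rfl (fun _ _ ↦ rfl) hgx a Y Z
  have h2 := h.two_mul_ricci hproj hg hx₁ hx₂ rfl rfl (fun _ _ ↦ rfl) hgx 1 Y Z
  rw [← h2] at h1
  rw [mul_left_cancel₀ two_ne_zero h1, ricci_eq_flatRicci, one_smul, actDeriv_one, actDeriv_one]
  rfl

theorem ricciForm_Ad (h : IsTwoSummandSplitting Q H m₁ m₂ e₁ e₂ w)
    (hproj : Manifold.IsSubmersion 𝓘(ℝ, E) 𝓘(ℝ, F) ∞ (fun x : G ↦ (x : G ⧸ H)))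
    {g : RiemMetric F (G ⧸ H)} (hg : IsInvariantField G g.inner) {x₁ x₂ : ℝ} (hx₁ : 0 < x₁)
    (hx₂ : 0 < x₂) (hgx : ∀ X Y, atBasePoint g.inner X Y = diagForm Q e₁ e₂ x₁ x₂ X Y) {a : G}
    (ha : a ∈ H) (X Y : LieAlg E G) : ricciForm E g (Ad a X) (Ad a Y) = ricciForm E g X Y := by
  have h1 := h.ricci_smul hproj hg hx₁ hx₂ hgx a X Y
  rw [ricci_eq_flatRicci, smul_basePt_of_mem ha] at h1
  have h2 := fun X : E ↦ projDeriv_AdModel (E := E) hproj ha X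
  rw [← h1, ← h2 X, ← h2 Y]
  rfl

theorem two_mul_ricciForm_basis (h : IsTwoSummandSplitting Q H m₁ m₂ e₁ e₂ w)
    (hproj : Manifold.IsSubmersion 𝓘(ℝ, E) 𝓘(ℝ, F) ∞ (fun x : G ↦ (x : G ⧸ H)))
    {g : RiemMetric F (G ⧸ H)} (hg : IsInvariantField G g.inner) {x₁ x₂ : ℝ} (hx₁ : 0 < x₁)
    (hx₂ : 0 < x₂) {x : Fin d₁ ⊕ Fin d₂ → ℝ} (hx : x = Sum.elim (fun _ ↦ x₁) (fun _ ↦ x₂))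
    {f : Fin d₁ ⊕ Fin d₂ → LieAlg E G} (hf : f = Sum.elim e₁ e₂)
    (hgx : ∀ X Y, atBasePoint g.inner X Y = diagForm Q e₁ e₂ x₁ x₂ X Y)
    (c c' : Fin d₁ ⊕ Fin d₂) :
    2 * ricciForm E g (f c) (f c')
      = ∑ i, (x i)⁻¹ * ((x c + x i) * Q ⁅f c', f i⁆ ⁅f c, f i⁆
          - ∑ j, x j * (Q ⁅f i, f c'⁆ (f j) * Q ⁅f i, f c⁆ (f j)))
        + ∑ i, ∑ j, (x i)⁻¹ * (x j)⁻¹ * 2⁻¹ * ((x i + x j - x c') * (x i - x j - x c) *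
            (Q ⁅f i, f c'⁆ (f j) * Q ⁅f i, f c⁆ (f j))) := by
  have hff : ∀ i j, Q (f i) (f j) = if i = j then 1 else 0 := hf ▸ h.orthonormal
  rw [← h.ricci_smul hproj hg hx₁ hx₂ hgx 1]
  refine (h.two_mul_ricci hproj hg hx₁ hx₂ hx hf (fun _ _ ↦ rfl) hgx 1 _ _).trans ?_
  exact ricci_sum_basis h.scalar.symm h.scalar.lie_left hff
    (fun X Y ↦ by rw [hgx, diagForm_apply, hx, hf]) c c'

/-- When both indices carry the same coefficient, the explicit sum is symmetric in them by
inspection. Symmetry inside each summand is all that `exists_eq_diagForm` needs. -/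
theorem ricciForm_comm (h : IsTwoSummandSplitting Q H m₁ m₂ e₁ e₂ w)
    (hproj : Manifold.IsSubmersion 𝓘(ℝ, E) 𝓘(ℝ, F) ∞ (fun x : G ↦ (x : G ⧸ H)))
    {g : RiemMetric F (G ⧸ H)} (hg : IsInvariantField G g.inner) {x₁ x₂ : ℝ} (hx₁ : 0 < x₁)
    (hx₂ : 0 < x₂) (hgx : ∀ X Y, atBasePoint g.inner X Y = diagForm Q e₁ e₂ x₁ x₂ X Y)
    (c c' : Fin d₁ ⊕ Fin d₂) (hcc : (Sum.elim (fun _ ↦ x₁) (fun _ ↦ x₂) c : ℝ)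
      = Sum.elim (fun _ ↦ x₁) (fun _ ↦ x₂) c') :
    ricciForm E g (Sum.elim e₁ e₂ c) (Sum.elim e₁ e₂ c')
      = ricciForm E g (Sum.elim e₁ e₂ c') (Sum.elim e₁ e₂ c) := by
  refine mul_left_cancel₀ two_ne_zero ?_
  rw [h.two_mul_ricciForm_basis hproj hg hx₁ hx₂ rfl rfl hgx,
    h.two_mul_ricciForm_basis hproj hg hx₁ hx₂ rfl rfl hgx, hcc]
  congr 1
  · refine Finset.sum_congr rfl fun i _ ↦ ?_
    rw [h.scalar.symm ⁅Sum.elim e₁ e₂ c', _⁆]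
    simp only [mul_comm (Q ⁅_, Sum.elim e₁ e₂ c'⁆ _)]
  · simp only [mul_comm (Q ⁅_, Sum.elim e₁ e₂ c'⁆ _)]

theorem two_mul_ricciForm_diag (h : IsTwoSummandSplitting Q H m₁ m₂ e₁ e₂ w)
    (hproj : Manifold.IsSubmersion 𝓘(ℝ, E) 𝓘(ℝ, F) ∞ (fun x : G ↦ (x : G ⧸ H)))
    {g : RiemMetric F (G ⧸ H)} (hg : IsInvariantField G g.inner) {x₁ x₂ : ℝ} (hx₁ : 0 < x₁)
    (hx₂ : 0 < x₂) {x : Fin d₁ ⊕ Fin d₂ → ℝ} (hx : x = Sum.elim (fun _ ↦ x₁) (fun _ ↦ x₂))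
    {f : Fin d₁ ⊕ Fin d₂ → LieAlg E G} (hf : f = Sum.elim e₁ e₂)
    (hgx : ∀ X Y, atBasePoint g.inner X Y = diagForm Q e₁ e₂ x₁ x₂ X Y) (c : Fin d₁ ⊕ Fin d₂) :
    2 * ricciForm E g (f c) (f c) = 2 * Q (casimir w (f c)) (f c)
      + ∑ i, ∑ j, ((x c + x i - x j) / x i + ((x i - x c) ^ 2 - x j ^ 2) / (2 * x i * x j)) *
          Q ⁅f i, f c⁆ (f j) ^ 2 := by
  rw [h.two_mul_ricciForm_basis hproj hg hx₁ hx₂ hx hf hgx]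
  subst hx hf
  refine ricci_sum_diagonal h.scalar.symm h.scalar.lie_left (fun i ↦ ?_) h.parseval
    h.lie_apply_isotropy (h.lie_apply_of_ne x₁ x₂) c
  rcases i with i | i
  exacts [hx₁, hx₂]

/-- The Ricci curvature of the invariant metric `x₁ Q|m₁ + x₂ Q|m₂`. -/
theorem ricciForm_eq_diagForm (h : IsTwoSummandSplitting Q H m₁ m₂ e₁ e₂ w)
    (hproj : Manifold.IsSubmersion 𝓘(ℝ, E) 𝓘(ℝ, F) ∞ (fun x : G ↦ (x : G ⧸ H)))
    {g : RiemMetric F (G ⧸ H)} (hg : IsInvariantField G g.inner) {x₁ x₂ : ℝ} (hx₁ : 0 < x₁)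
    (hx₂ : 0 < x₂) (hgx : ∀ X Y, atBasePoint g.inner X Y = diagForm Q e₁ e₂ x₁ x₂ X Y)
    {ζ₁ ζ₂ : ℝ} (hζ₁ : ∀ X ∈ m₁, casimir w X = ζ₁ • X) (hζ₂ : ∀ X ∈ m₂, casimir w X = ζ₂ • X)
    (X Y : LieAlg E G) :
    ricciForm E g X Y = diagForm Q e₁ e₂
      (ζ₁ + gammaConst Q e₁ e₁ e₁ / (4 * d₁) + gammaConst Q e₂ e₂ e₁ / (4 * d₁) * (x₁ / x₂) ^ 2)
      (ζ₂ + gammaConst Q e₂ e₂ e₂ / (4 * d₂) + gammaConst Q e₂ e₂ e₁ / d₂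
        - gammaConst Q e₂ e₂ e₁ / (2 * d₂) * (x₁ / x₂)) X Y := by
  -- By Schur the Ricci form is diagonal with unknown coefficients. Summing its diagonal values over
  -- each basis gives `d₁ r₁` and `d₂ r₂` in terms of the structure constants.
  obtain ⟨r₁, r₂, hr⟩ := h.exists_eq_diagForm (ricciForm E g)
    (fun a ha X Y ↦ h.ricciForm_Ad hproj hg hx₁ hx₂ hgx ha X Y)
    (fun X hX Y ↦ pullForm_of_mem_left hproj _ hX Y)
    (fun X hX Y ↦ pullForm_of_mem_right hproj _ hX Y)
    (h.basis₁.form_comm fun i j ↦ h.ricciForm_comm hproj hg hx₁ hx₂ hgx (.inl i) (.inl j) rfl)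
    (h.basis₂.form_comm fun i j ↦ h.ricciForm_comm hproj hg hx₁ hx₂ hgx (.inr i) (.inr j) rfl)
  obtain ⟨i₁⟩ := h.basis₁.nonempty h.irr₁.ne_bot
  obtain ⟨i₂⟩ := h.basis₂.nonempty h.irr₂.ne_bot
  have hd₁ : (d₁ : ℝ) ≠ 0 := Nat.cast_ne_zero.2 i₁.pos.ne'
  have hd₂ : (d₂ : ℝ) ≠ 0 := Nat.cast_ne_zero.2 i₂.pos.ne'
  have h112 : ∀ i j k, Q ⁅e₁ i, e₁ j⁆ (e₂ k) = 0 := fun i j k ↦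
    h.lie₁ _ (h.basis₁.mem i) _ (h.basis₁.mem j) _ (h.basis₂.mem k)
  have s₁ := sum_coeff_left (Q := Q) h.scalar.symm h.scalar.lie_left hx₁ hx₂ h112
  have s₂ := sum_coeff_right (Q := Q) h.scalar.symm h.scalar.lie_left hx₁ hx₂ h112
  have t₁ : ∀ c : Fin d₁, _ := fun c ↦
    h.two_mul_ricciForm_diag hproj hg hx₁ hx₂ rfl rfl hgx (.inl c)
  have t₂ : ∀ c : Fin d₂, _ := fun c ↦
    h.two_mul_ricciForm_diag hproj hg hx₁ hx₂ rfl rfl hgx (.inr c)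
  have u₁ : ∀ c, ricciForm E g (e₁ c) (e₁ c) = r₁ := fun c ↦ by
    rw [hr, h.diagForm_left _ _ (h.basis₁.mem c) (h.basis₁.mem c), h.basis₁.orthonormal]
    simp
  have u₂ : ∀ c, ricciForm E g (e₂ c) (e₂ c) = r₂ := fun c ↦ by
    rw [hr, h.diagForm_right _ _ (h.basis₂.mem c) (h.basis₂.mem c), h.basis₂.orthonormal]
    simp
  have v₁ : ∀ c, Q (casimir w (e₁ c)) (e₁ c) = ζ₁ := fun c ↦ by
    rw [hζ₁ _ (h.basis₁.mem c), map_smul, LinearMap.smul_apply, h.basis₁.orthonormal]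
    simp
  have v₂ : ∀ c, Q (casimir w (e₂ c)) (e₂ c) = ζ₂ := fun c ↦ by
    rw [hζ₂ _ (h.basis₂.mem c), map_smul, LinearMap.smul_apply, h.basis₂.orthonormal]
    simp
  simp only [Sum.elim_inl, u₁, v₁] at t₁
  simp only [Sum.elim_inr, u₂, v₂] at t₂
  have w₁ := Finset.sum_congr rfl fun c (_ : c ∈ Finset.univ) ↦ t₁ c
  have w₂ := Finset.sum_congr rfl fun c (_ : c ∈ Finset.univ) ↦ t₂ c
  rw [Finset.sum_add_distrib, s₁] at w₁
  rw [Finset.sum_add_distrib, s₂] at w₂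
  simp only [Finset.sum_const, Finset.card_univ, Fintype.card_fin, nsmul_eq_mul] at w₁ w₂
  change _ = _ + (2⁻¹ * gammaConst Q e₁ e₁ e₁ + 2⁻¹ * (x₁ / x₂) ^ 2 * gammaConst Q e₂ e₂ e₁) at w₁
  change _ = _ + (2⁻¹ * gammaConst Q e₂ e₂ e₂ + (2 - x₁ / x₂) * gammaConst Q e₂ e₂ e₁) at w₂
  have r₁_eq : r₁ = ζ₁ + gammaConst Q e₁ e₁ e₁ / (4 * d₁)
      + gammaConst Q e₂ e₂ e₁ / (4 * d₁) * (x₁ / x₂) ^ 2 := by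
    field_simp at w₁ ⊢
    linarith
  have r₂_eq : r₂ = ζ₂ + gammaConst Q e₂ e₂ e₂ / (4 * d₂) + gammaConst Q e₂ e₂ e₁ / d₂
        - gammaConst Q e₂ e₂ e₁ / (2 * d₂) * (x₁ / x₂) := by
    field_simp at w₂ ⊢
    linarith
  rw [hr, r₁_eq, r₂_eq]

end IsTwoSummandSplitting

end RicciOfSplitting

/-! ### The algebraic system for the ratio of the metric coefficients -/

section PrescribedRatio

variable {A₁ A₂ B₁ B₂ z₁ z₂ : ℝ}

/-- Eliminating `c` leaves one continuous function of `s`, positive at `0` exactly under the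
inequality and nonpositive at `A₂ / B₂`. -/
theorem exists_ratio_iff (hA₁ : 0 ≤ A₁) (hB₁ : 0 < B₁) (hB₂ : 0 < B₂) (hz₁ : 0 ≤ z₁)
    (hz₂ : 0 ≤ z₂) :
    (∃ s c : ℝ, 0 < s ∧ 0 < c ∧ A₁ + B₁ * s ^ 2 = c * z₁ ∧ A₂ - B₂ * s = c * z₂)
      ↔ A₂ * z₁ > A₁ * z₂ := by
  constructor
  · rintro ⟨s, c, hs, hc, h1, h2⟩
    have hA₂ : A₂ = c * z₂ + B₂ * s := by linarith
    have h3 : c * (A₂ * z₁ - A₁ * z₂) = c * z₂ * (B₁ * s ^ 2) + B₂ * s * (B₁ * s ^ 2)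
        + A₁ * (B₂ * s) := by
      -- The difference is `A₂ B₁ s² + A₁ B₂ s` after elimination; substituting `A₂ = c z₂ + B₂ s`
      -- shows all terms nonnegative and `B₂ s · B₁ s²` positive.
      linear_combination (-A₂) * h1 + A₁ * h2 + B₁ * s ^ 2 * hA₂
    have h4 : 0 < c * (A₂ * z₁ - A₁ * z₂) := by
      rw [h3]
      positivity
    have h5 := pos_of_mul_pos_right h4 hc.le
    linarith
  · intro h
    have h0 : 0 < A₂ * z₁ := lt_of_le_of_lt (by positivity) h
    have hz₁' : 0 < z₁ := lt_of_le_of_ne hz₁ fun h' ↦ by simp [← h'] at h0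
    have hA₂ : 0 < A₂ := pos_of_mul_pos_left h0 hz₁
    let f : ℝ → ℝ := fun s ↦ (A₂ - B₂ * s) * z₁ - (A₁ + B₁ * s ^ 2) * z₂
    have hf : ContinuousOn f (Set.Icc 0 (A₂ / B₂)) := by fun_prop
    have hend : f (A₂ / B₂) ≤ 0 := by
      have h1 : A₂ - B₂ * (A₂ / B₂) = 0 := by field_simp; ring
      have h2 : 0 ≤ (A₁ + B₁ * (A₂ / B₂) ^ 2) * z₂ := by positivity
      simp only [f, h1]
      linarith
    have hstart : 0 < f 0 := by
      simp only [f]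
      nlinarith
    obtain ⟨s, hs, hfs⟩ := intermediate_value_Icc' (by positivity) hf ⟨hend, hstart.le⟩
    have hs0 : 0 < s := lt_of_le_of_ne hs.1 fun h' ↦ by rw [← h'] at hfs; exact hstart.ne' hfs
    -- The first equation dictates `c`; the inequality has forced `z₁ > 0`.
    refine ⟨s, (A₁ + B₁ * s ^ 2) / z₁, hs0, by positivity, by field_simp, ?_⟩
    have h1 : (A₂ - B₂ * s) * z₁ = (A₁ + B₁ * s ^ 2) * z₂ := sub_eq_zero.1 hfs
    field_simp
    linarith

/-- If `s < s'`, the first equation gives `c < c'`, whereas the left side of the second decreases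
strictly and its right side does not. Once `s = s'`, the positive left side of the first equation
shows `z₁ ≠ 0`, which determines `c`. -/
theorem ratio_unique (hA₁ : 0 ≤ A₁) (hB₁ : 0 < B₁) (hB₂ : 0 < B₂) (hz₁ : 0 ≤ z₁) (hz₂ : 0 ≤ z₂)
    {s c s' c' : ℝ} (hs : 0 < s) (hs' : 0 < s')
    (h₁ : A₁ + B₁ * s ^ 2 = c * z₁) (h₂ : A₂ - B₂ * s = c * z₂)
    (h₁' : A₁ + B₁ * s' ^ 2 = c' * z₁) (h₂' : A₂ - B₂ * s' = c' * z₂) : s = s' ∧ c = c' := by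
  have key : ∀ {s c s' c' : ℝ}, 0 < s → A₁ + B₁ * s ^ 2 = c * z₁ → A₂ - B₂ * s = c * z₂ →
      A₁ + B₁ * s' ^ 2 = c' * z₁ → A₂ - B₂ * s' = c' * z₂ → ¬ s < s' := by
    intro s c s' c' hs h₁ h₂ h₁' h₂' hlt
    have h3 : c * z₁ < c' * z₁ := by
      rw [← h₁, ← h₁']
      gcongr
    have h4 : c < c' := lt_of_mul_lt_mul_right h3 hz₁
    have h5 : c * z₂ ≤ c' * z₂ := by gcongr
    have h6 : B₂ * s < B₂ * s' := by gcongr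
    linarith
  have hss : s = s' := le_antisymm (not_lt.1 (key hs' h₁' h₂' h₁ h₂)) (not_lt.1 (key hs h₁ h₂ h₁' h₂'))
  refine ⟨hss, ?_⟩
  subst hss
  have h3 : z₁ ≠ 0 := fun h ↦ by
    have : 0 < A₁ + B₁ * s ^ 2 := by positivity
    rw [h₁, h, mul_zero] at this
    exact lt_irrefl _ this
  exact mul_right_cancel₀ h3 (h₁.symm.trans h₁')

end PrescribedRatio

/-! ### Reduction of the prescribed Ricci equation to the algebraic system -/

section InvariantTensors

variable {E : Type*} [NormedAddCommGroup E] [NormedSpace ℝ E]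
  {G : Type*} [TopologicalSpace G] [ChartedSpace E G] [Group G] [LieGroup 𝓘(ℝ, E) ∞ G]
  {d₁ d₂ q : ℕ} {Q : LinearMap.BilinForm ℝ (LieAlg E G)} {H : Subgroup G}
  {m₁ m₂ : Submodule ℝ (LieAlg E G)} {e₁ : Fin d₁ → LieAlg E G} {e₂ : Fin d₂ → LieAlg E G}
  {w : Fin q → LieAlg E G}
  {F : Type*} [NormedAddCommGroup F] [NormedSpace ℝ F] [ChartedSpace F (G ⧸ H)]

namespace IsTwoSummandSplitting

theorem exists_baseForm_eq (h : IsTwoSummandSplitting Q H m₁ m₂ e₁ e₂ w)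
    (hproj : Manifold.IsSubmersion 𝓘(ℝ, E) 𝓘(ℝ, F) ∞ (fun x : G ↦ (x : G ⧸ H)))
    {T : BilinField F (G ⧸ H)} (hT : IsInvariantField G T) (hs : ∀ p u v, T p u v = T p v u) :
    ∃ z₁ z₂ : ℝ, ∀ X Y, baseForm E T X Y = diagForm Q e₁ e₂ z₁ z₂ X Y :=
  h.exists_eq_diagForm (baseForm E T) (fun _ ha X Y ↦ baseForm_Ad hproj hT ha X Y)
    (fun _ hX Y ↦ pullForm_of_mem_left hproj _ hX Y)
    (fun _ hX Y ↦ pullForm_of_mem_right hproj _ hX Y)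
    (fun _ _ _ _ ↦ hs _ _ _) (fun _ _ _ _ ↦ hs _ _ _)

theorem coeff_eq (h : IsTwoSummandSplitting Q H m₁ m₂ e₁ e₂ w) (z₁ z₂ : ℝ) :
    (∃ X ∈ m₁, Q X X = 1 ∧ diagForm Q e₁ e₂ z₁ z₂ X X = z₁) ∧
      ∃ X ∈ m₂, Q X X = 1 ∧ diagForm Q e₁ e₂ z₁ z₂ X X = z₂ := by
  obtain ⟨i₁⟩ := h.basis₁.nonempty h.irr₁.ne_bot
  obtain ⟨i₂⟩ := h.basis₂.nonempty h.irr₂.ne_bot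
  have o₁ : Q (e₁ i₁) (e₁ i₁) = 1 := by rw [h.basis₁.orthonormal, if_pos rfl]
  have o₂ : Q (e₂ i₂) (e₂ i₂) = 1 := by rw [h.basis₂.orthonormal, if_pos rfl]
  refine ⟨⟨_, h.basis₁.mem i₁, o₁, ?_⟩, ⟨_, h.basis₂.mem i₂, o₂, ?_⟩⟩
  · rw [h.diagForm_left _ _ (h.basis₁.mem i₁) (h.basis₁.mem i₁), o₁, mul_one]
  · rw [h.diagForm_right _ _ (h.basis₂.mem i₂) (h.basis₂.mem i₂), o₂, mul_one]

theorem coeff_nonneg (h : IsTwoSummandSplitting Q H m₁ m₂ e₁ e₂ w)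
    {T : BilinField F (G ⧸ H)} (hpos : ∀ p u, 0 ≤ T p u u) {z₁ z₂ : ℝ}
    (hz : ∀ X Y, baseForm E T X Y = diagForm Q e₁ e₂ z₁ z₂ X Y) : 0 ≤ z₁ ∧ 0 ≤ z₂ := by
  obtain ⟨⟨X, -, -, hX⟩, ⟨Y, -, -, hY⟩⟩ := h.coeff_eq z₁ z₂
  rw [← hz] at hX hY
  exact ⟨hX ▸ hpos _ _, hY ▸ hpos _ _⟩

/-- The coefficients are values of the metric on unit vectors of the summands, which are orthogonal
to the Lie algebra of `H` and hence do not project to zero. -/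
theorem exists_metric_coeff [IsManifold 𝓘(ℝ, F) ∞ (G ⧸ H)]
    (h : IsTwoSummandSplitting Q H m₁ m₂ e₁ e₂ w)
    (hproj : Manifold.IsSubmersion 𝓘(ℝ, E) 𝓘(ℝ, F) ∞ (fun x : G ↦ (x : G ⧸ H)))
    {g : RiemMetric F (G ⧸ H)} (hg : IsInvariantField G g.inner) :
    ∃ x₁ x₂ : ℝ, 0 < x₁ ∧ 0 < x₂ ∧
      ∀ X Y, baseForm E g.inner X Y = diagForm Q e₁ e₂ x₁ x₂ X Y := by
  obtain ⟨x₁, x₂, hx⟩ := h.exists_baseForm_eq hproj hg fun p u v ↦ g.symm p u v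
  have hpos : ∀ X : LieAlg E G, X ∉ subgroupLieAlgebra H → 0 < baseForm E g.inner X X :=
    fun X hX ↦ g.pos _ _ fun h0 ↦ hX ((mem_subgroupLieAlgebra_iff_projDeriv hproj X).2 h0)
  obtain ⟨⟨X, hXm, hX1, hX⟩, ⟨Y, hYm, hY1, hY⟩⟩ := h.coeff_eq x₁ x₂
  rw [← hx] at hX hY
  refine ⟨x₁, x₂, hX ▸ hpos X fun h0 ↦ ?_, hY ▸ hpos Y fun h0 ↦ ?_, hx⟩
  · rw [h.orth₁ h0 hXm] at hX1
    exact zero_ne_one hX1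
  · rw [h.orth₂ h0 hYm] at hY1
    exact zero_ne_one hY1

theorem exists_metric [FiniteDimensional ℝ F] [IsManifold 𝓘(ℝ, F) ∞ (G ⧸ H)]
    (h : IsTwoSummandSplitting Q H m₁ m₂ e₁ e₂ w)
    (hproj : Manifold.IsSubmersion 𝓘(ℝ, E) 𝓘(ℝ, F) ∞ (fun x : G ↦ (x : G ⧸ H)))
    {x₁ x₂ : ℝ} (hx₁ : 0 < x₁) (hx₂ : 0 < x₂) :
    ∃ g : RiemMetric F (G ⧸ H), IsInvariantField G g.inner ∧
      ∀ X Y, baseForm E g.inner X Y = diagForm Q e₁ e₂ x₁ x₂ X Y :=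
  exists_invariantMetric hproj (diagForm Q e₁ e₂ x₁ x₂) (diagForm_symm Q e₁ e₂ x₁ x₂)
    (fun _ hX Y ↦ h.diagForm_of_mem _ _ hX Y) (fun _ hX ↦ h.diagForm_pos hx₁ hx₂ hX)
    (fun _ ha X Y ↦ h.diagForm_Ad _ _ ha X Y)

/-- Both sides are invariant and diagonal at the base point, so comparing two coefficients is
equivalent to the equation on all of `G ⧸ H`. -/
theorem ricci_eq_mul_iff [FiniteDimensional ℝ E] [CompleteSpace E]
    [LieGroup 𝓘(ℝ, E) (minSmoothness ℝ 3) G] [FiniteDimensional ℝ F]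
    [IsManifold 𝓘(ℝ, F) ∞ (G ⧸ H)] (h : IsTwoSummandSplitting Q H m₁ m₂ e₁ e₂ w)
    (hproj : Manifold.IsSubmersion 𝓘(ℝ, E) 𝓘(ℝ, F) ∞ (fun x : G ↦ (x : G ⧸ H)))
    {ζ₁ ζ₂ : ℝ} (hζ₁ : ∀ X ∈ m₁, casimir w X = ζ₁ • X) (hζ₂ : ∀ X ∈ m₂, casimir w X = ζ₂ • X)
    {T : BilinField F (G ⧸ H)} (hT : IsInvariantField G T) {z₁ z₂ : ℝ}
    (hz : ∀ X Y, baseForm E T X Y = diagForm Q e₁ e₂ z₁ z₂ X Y)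
    {g : RiemMetric F (G ⧸ H)} (hg : IsInvariantField G g.inner) {x₁ x₂ : ℝ} (hx₁ : 0 < x₁)
    (hx₂ : 0 < x₂) (hx : ∀ X Y, baseForm E g.inner X Y = diagForm Q e₁ e₂ x₁ x₂ X Y) (c : ℝ) :
    (∀ p u v, ricci g p u v = c * T p u v) ↔
      ζ₁ + gammaConst Q e₁ e₁ e₁ / (4 * d₁) + gammaConst Q e₂ e₂ e₁ / (4 * d₁) * (x₁ / x₂) ^ 2
          = c * z₁ ∧
        ζ₂ + gammaConst Q e₂ e₂ e₂ / (4 * d₂) + gammaConst Q e₂ e₂ e₁ / d₂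
          - gammaConst Q e₂ e₂ e₁ / (2 * d₂) * (x₁ / x₂) = c * z₂ := by
  have hr := h.ricciForm_eq_diagForm hproj hg hx₁ hx₂ hx hζ₁ hζ₂
  have hcz : ∀ X Y, c * baseForm E T X Y = diagForm Q e₁ e₂ (c * z₁) (c * z₂) X Y := fun X Y ↦ by
    rw [hz, diagForm_apply, diagForm_apply, Finset.mul_sum]
    refine Finset.sum_congr rfl fun i _ ↦ ?_
    rcases i with i | i <;> simp [mul_assoc]
  constructor
  · intro hric
    refine h.diagForm_inj fun X Y ↦ ?_
    rw [← hr, ← hcz, ricciForm_apply]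
    exact hric _ _ _
  · rintro ⟨h1, h2⟩ p u v
    have h3 : ∀ X Y, ricciForm E g X Y = c * baseForm E T X Y := fun X Y ↦ by
      rw [hr, h1, h2, hcz]
    obtain ⟨a, rfl⟩ := exists_eq_smul_basePt p
    obtain ⟨X, rfl⟩ := exists_eq_actDeriv_projDeriv hproj a u
    obtain ⟨Y, rfl⟩ := exists_eq_actDeriv_projDeriv hproj a v
    refine (h.ricci_smul hproj hg hx₁ hx₂ hx a X Y).trans ((h3 X Y).trans ?_)
    exact congrArg (c * ·) (hT.modelForm_eq a (basePt H) _ _).symm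

end IsTwoSummandSplitting

end InvariantTensors

end

/-! ### The main theorem -/

theorem proposition2
    -- `G` is a compact connected Lie group
    {E : Type*} [NormedAddCommGroup E] [NormedSpace ℝ E] [FiniteDimensional ℝ E]
    {G : Type*} [TopologicalSpace G] [T2Space G] [CompactSpace G] [ConnectedSpace G]
    [ChartedSpace E G] [Group G] [LieGroup 𝓘(ℝ, E) ∞ G]
    -- `H` is a closed connected subgroup
    (H : Subgroup G) (hHclosed : IsClosed (H : Set G)) (hHconn : IsConnected (H : Set G))
    -- `G/H` carries its smooth structure, for which the projection is a smooth submersion;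
    -- it has dimension at least three, and `G` acts on it effectively
    {F : Type*} [NormedAddCommGroup F] [NormedSpace ℝ F] [FiniteDimensional ℝ F]
    [ChartedSpace F (G ⧸ H)] [IsManifold 𝓘(ℝ, F) ∞ (G ⧸ H)]
    (hproj : Manifold.IsSubmersion 𝓘(ℝ, E) 𝓘(ℝ, F) ∞ (fun x : G ↦ (x : G ⧸ H)))
    (hdim : 3 ≤ Module.finrank ℝ F) [FaithfulSMul G (G ⧸ H)]
    -- an `Ad(G)`-invariant scalar product on the Lie algebra of `G`
    (Q : LinearMap.BilinForm ℝ (LieAlg E G)) (hQ : IsAdInvariantScalarProduct Q)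
    -- the decomposition of the orthogonal complement of the Lie algebra of `H`
    (m₁ m₂ : Submodule ℝ (LieAlg E G))
    (hm : m₁ ⊔ m₂ = Q.orthogonal (subgroupLieAlgebra H))
    (hperp : ∀ X ∈ m₁, ∀ Y ∈ m₂, Q X Y = 0)
    (hirr₁ : IsAdIrreducible H m₁) (hirr₂ : IsAdIrreducible H m₂)
    (hineq : ¬ AdEquivalent H m₁ m₂)
    -- the intermediate subgroup
    (K : Subgroup G) (hK : IsConnectedLieSubgroup E K) (hHK : H < K) (hKG : K < ⊤)
    (hk : subgroupLieAlgebra (E := E) K = subgroupLieAlgebra H ⊔ m₁)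
    -- orthonormal bases of the summands and of the Lie algebra of `H`
    {d₁ d₂ q : ℕ} (e₁ : Fin d₁ → LieAlg E G) (e₂ : Fin d₂ → LieAlg E G)
    (w : Fin q → LieAlg E G)
    (he₁ : IsOrthonormalBasisOf Q m₁ e₁) (he₂ : IsOrthonormalBasisOf Q m₂ e₂)
    (hw : IsOrthonormalBasisOf Q (subgroupLieAlgebra H) w)
    (hγ : gammaConst Q e₂ e₂ e₁ ≠ 0)
    -- the tensor field `T`
    (T : BilinField F (G ⧸ H)) (hTinv : IsInvariantField G T)
    (hTsymm : ∀ p u v, T p u v = T p v u) (hTpos : ∀ p u, 0 ≤ T p u u) (hTne : T ≠ 0) :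
    ∃ ζ₁ ζ₂ z₁ z₂ : ℝ, 0 ≤ ζ₁ ∧ 0 ≤ ζ₂ ∧ 0 ≤ z₁ ∧ 0 ≤ z₂ ∧
      (∀ X ∈ m₁, casimir w X = ζ₁ • X) ∧ (∀ X ∈ m₂, casimir w X = ζ₂ • X) ∧
      (∀ X₁ ∈ m₁, ∀ X₂ ∈ m₂, ∀ Y₁ ∈ m₁, ∀ Y₂ ∈ m₂,
        atBasePoint T (X₁ + X₂) (Y₁ + Y₂) = z₁ * Q X₁ Y₁ + z₂ * Q X₂ Y₂) ∧
      ((∃ (g : RiemMetric F (G ⧸ H)) (c : ℝ), IsInvariantField G g.inner ∧ 0 < c ∧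
          ∀ p u v, ricci g p u v = c * T p u v) ↔
        (ζ₂ + gammaConst Q e₂ e₂ e₂ / (4 * d₂) + gammaConst Q e₂ e₂ e₁ / d₂) * z₁
          > (ζ₁ + gammaConst Q e₁ e₁ e₁ / (4 * d₁)) * z₂) ∧
      (∀ (g g' : RiemMetric F (G ⧸ H)) (c c' : ℝ),
        IsInvariantField G g.inner → IsInvariantField G g'.inner → 0 < c → 0 < c' →
        (∀ p u v, ricci g p u v = c * T p u v) → (∀ p u v, ricci g' p u v = c' * T p u v) →
        c = c' ∧ ∃ t : ℝ, 0 < t ∧ ∀ p u v, g'.inner p u v = t * g.inner p u v) := by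
  have hcomplete : CompleteSpace E := FiniteDimensional.complete ℝ E
  -- The finite smoothness under which the bracket on the tangent space at `1` satisfies the laws of
  -- a Lie algebra.
  have hsmooth : LieGroup 𝓘(ℝ, E) (minSmoothness ℝ 3) G := LieGroup.of_le (n := ∞) (by
    rw [minSmoothness_of_isRCLikeNormedField]
    exact WithTop.coe_le_coe.2 le_top)
  have hinvK := isAdInvariant_subgroupLieAlgebra (E := E) K
  have hle : m₁ ⊔ m₂ ≤ Q.orthogonal (subgroupLieAlgebra H) := hm.le
  have h : IsTwoSummandSplitting Q H m₁ m₂ e₁ e₂ w :=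
    { scalar := hQ, sup_eq := hm, perp := hperp, irr₁ := hirr₁, irr₂ := hirr₂, inequiv := hineq
      basis₁ := he₁, basis₂ := he₂, basis := hw
      -- The only use of `K`: its Lie algebra `𝔥 ⊕ 𝔪₁` is closed under brackets and orthogonal to
      -- `𝔪₂`.
      lie₁ := fun X hX Y hY Z hZ ↦ by
        have hle₁ : m₁ ≤ subgroupLieAlgebra K := hk ▸ le_sup_right
        have hmem := lie_mem_of_isAdInvariant hinvK (hle₁ hX) (hle₁ hY)
        rw [hk] at hmem
        obtain ⟨U, hU, V, hV, hUV⟩ := Submodule.mem_sup.1 hmem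
        have h0 : Q U Z = 0 := LinearMap.BilinForm.mem_orthogonal_iff.1
          (hle (Submodule.mem_sup_right hZ)) U hU
        rw [← hUV, map_add, LinearMap.add_apply, h0, hperp V hV Z hZ, add_zero] }
  obtain ⟨ζ₁, hζ₁0, hζ₁⟩ := hirr₁.exists_casimir_eq hQ he₁ hw
  obtain ⟨ζ₂, hζ₂0, hζ₂⟩ := hirr₂.exists_casimir_eq hQ he₂ hw
  obtain ⟨z₁, z₂, hz⟩ := h.exists_baseForm_eq hproj hTinv hTsymm
  obtain ⟨hz₁, hz₂⟩ := h.coeff_nonneg hTpos hz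
  have hd₁ : 0 < (d₁ : ℝ) := by
    obtain ⟨i⟩ := he₁.nonempty hirr₁.ne_bot
    exact Nat.cast_pos.2 i.pos
  have hd₂ : 0 < (d₂ : ℝ) := by
    obtain ⟨i⟩ := he₂.nonempty hirr₂.ne_bot
    exact Nat.cast_pos.2 i.pos
  have hnonneg : ∀ {a b c : ℕ} (e : Fin a → LieAlg E G) (f : Fin b → LieAlg E G)
      (k : Fin c → LieAlg E G), 0 ≤ gammaConst Q e f k := fun e f k ↦
    Finset.sum_nonneg fun _ _ ↦ Finset.sum_nonneg fun _ _ ↦ Finset.sum_nonneg fun _ _ ↦ sq_nonneg _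
  have hγ0 : 0 < gammaConst Q e₂ e₂ e₁ := lt_of_le_of_ne (hnonneg _ _ _) hγ.symm
  have hA₁ : 0 ≤ ζ₁ + gammaConst Q e₁ e₁ e₁ / (4 * d₁) :=
    add_nonneg hζ₁0 (div_nonneg (hnonneg _ _ _) (by positivity))
  have hB₁ : 0 < gammaConst Q e₂ e₂ e₁ / (4 * d₁) := by positivity
  have hB₂ : 0 < gammaConst Q e₂ e₂ e₁ / (2 * d₂) := by positivity
  refine ⟨ζ₁, ζ₂, z₁, z₂, hζ₁0, hζ₂0, hz₁, hz₂, hζ₁, hζ₂, ?_, ?_, ?_⟩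
  · intro X₁ hX₁ X₂ hX₂ Y₁ hY₁ Y₂ hY₂
    have h0 := (subgroupLieAlgebra H : Submodule ℝ (LieAlg E G)).zero_mem
    have h1 := h.diagForm_add z₁ z₂ h0 hX₁ hX₂ h0 hY₁ hY₂
    rwa [zero_add, zero_add, ← hz] at h1
  · rw [← exists_ratio_iff hA₁ hB₁ hB₂ hz₁ hz₂]
    constructor
    · rintro ⟨g, c, hg, hc, hric⟩
      obtain ⟨x₁, x₂, hx₁, hx₂, hx⟩ := h.exists_metric_coeff hproj hg
      obtain ⟨h1, h2⟩ := (h.ricci_eq_mul_iff hproj hζ₁ hζ₂ hTinv hz hg hx₁ hx₂ hx c).1 hric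
      exact ⟨x₁ / x₂, c, by positivity, hc, h1, h2⟩
    · rintro ⟨s, c, hs, hc, h1, h2⟩
      -- Only the ratio `x₁ / x₂` matters, so take `x₁ = s` and `x₂ = 1`.
      obtain ⟨g, hg, hx⟩ := h.exists_metric hproj hs one_pos
      refine ⟨g, c, hg, hc, (h.ricci_eq_mul_iff hproj hζ₁ hζ₂ hTinv hz hg hs one_pos hx c).2 ?_⟩
      rw [div_one]
      exact ⟨h1, h2⟩
  · intro g g' c c' hg hg' _ _ hric hric'
    obtain ⟨x₁, x₂, hx₁, hx₂, hx⟩ := h.exists_metric_coeff hproj hg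
    obtain ⟨x₁', x₂', hx₁', hx₂', hx'⟩ := h.exists_metric_coeff hproj hg'
    obtain ⟨h1, h2⟩ := (h.ricci_eq_mul_iff hproj hζ₁ hζ₂ hTinv hz hg hx₁ hx₂ hx c).1 hric
    obtain ⟨h1', h2'⟩ := (h.ricci_eq_mul_iff hproj hζ₁ hζ₂ hTinv hz hg' hx₁' hx₂' hx' c').1 hric'
    obtain ⟨hs, hc⟩ := ratio_unique hA₁ hB₁ hB₂ hz₁ hz₂ (div_pos hx₁ hx₂) (div_pos hx₁' hx₂')
      h1 h2 h1' h2'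
    -- Equality of the ratios makes `x₂' / x₂` the common factor on both summands.
    refine ⟨hc, x₂' / x₂, by positivity, fun p u v ↦ ?_⟩
    refine hg.eq_mul_of_baseForm hproj hg' (fun X Y ↦ ?_) p u v
    rw [hx, hx', diagForm_apply, diagForm_apply, Finset.mul_sum]
    refine Finset.sum_congr rfl fun i _ ↦ ?_
    rcases i with i | i <;> simp only [Sum.elim_inl, Sum.elim_inr]
    · have hx₁'_eq : x₁' = x₂' / x₂ * x₁ := by
        field_simp at hs ⊢
        linarith
      rw [hx₁'_eq, mul_assoc]
    · field_simp
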